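/- Let $n:\mathbb N\to\mathbb N$ be a polynomially bounded function with $n(\lambda)\ge\lambda+1$ for all $\lambda$, and let $\mathcal H_n$ be the Haar (unitarily invariant) probability measure on $n$-qubit pure states. In the common Haar state (CHS) model all parties receive copies of one common state $|\vartheta\rangle\leftarrow\mathcal H_{n(\lambda)}$. Put $p=p(\lambda)=\lambda$, write $n=n(\lambda)$, and consider the following bit commitment scheme. Let $$|\psi_0\rangle=2^{-\lambda/2}\sum_{k\in\{0,1\}^\lambda}(Z^k\otimes I_{n-\lambda})|\vartheta\rangle\otimes|k\,\|\,0^{n-\lambda}\rangle,\qquad |\psi_1\rangle=2^{-n/2}\sum_{j\in\{0,1\}^n}|j\rangle\otimes|j\rangle ,$$ where $Z^k=Z^{k_1}\otimes\cdots\otimes Z^{k_\lambda}$, and $|\Psi_b\rangle_{\mathsf{CR}}=\bigotimes_{i=1}^p|\psi_b\rangle_{\mathsf C_i\mathsf R_i}$. *Commit.* To commit to $b\in\{0,1\}$ the sender uses $p$ copies of $|\vartheta\rangle$ to prepare $|\Psi_b\rangle_{\mathsf{CR}}$, and sends $\mathsf C=(\mathsf C_1,\dots,\mathsf C_p)$.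 *Reveal.* The sender sends $b$ and $\mathsf R=(\mathsf R_1,\dots,\mathsf R_p)$. The receiver uses $p$ copies of $|\vartheta\rangle$ to prepare its own $|\Psi_b\rangle_{\mathsf C'\mathsf R'}$, performs for each $i\in\{1,\dots,p\}$ the SWAP test between $(\mathsf C_i,\mathsf R_i)$ and $(\mathsf C'_i,\mathsf R'_i)$, and outputs $b$ if all tests accept and $\bot$ otherwise. **Theorem.** This scheme is a quantum bit commitment in the CHS model with perfect correctness, poly-copy statistical hiding and statistical sum-binding. That is: 1. (Efficiency.) Sender and receiver use polynomially many copies of $|\vartheta\rangle$ and are uniform quantum polynomial-time algorithms: for each bit, each of them is implemented exactly by a family of quantum circuits (gates $X$, $H$, $T$, CNOT, Toffoli; auxiliary wires initialised to $|0\rangle$), and one Turing machine, given $1^\lambda$ and the state length $1^{n(\lambda)}$, writes down the $\lambda$-th circuit in time polynomial in $\lambda$. 2. (Perfect correctness.) For all $\lambda$, all $b$ and every $n(\lambda)$-qubit state $|\vartheta\rangle$, an honest opening to $b$ of an honest commitment to $b$ is accepted with probability $1$. 3. (Poly-copy statistical hiding.) For every polynomially bounded $t$ and every non-uniform, computationally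 unbounded receiver $R^*=\{R^*_\lambda\}$ with one-bit output there is a negligible function $\mathsf{negl}$ such that for all $\lambda$ $$\Bigl|\Pr_{|\vartheta\rangle\leftarrow\mathcal H_{n}}\bigl[R^*_\lambda\bigl(|\vartheta\rangle^{\otimes t(\lambda)},\operatorname{Tr}_{\mathsf R}|\Psi_0\rangle\langle\Psi_0|\bigr)=1\bigr]-\Pr_{|\vartheta\rangle\leftarrow\mathcal H_{n}}\bigl[R^*_\lambda\bigl(|\vartheta\rangle^{\otimes t(\lambda)},\operatorname{Tr}_{\mathsf R}|\Psi_1\rangle\langle\Psi_1|\bigr)=1\bigr]\Bigr|\le\mathsf{negl}(\lambda).$$ 4. (Statistical sum-binding.) Let $T:\mathbb N\to\mathbb N$ be arbitrary, and let $C_0^*,C_1^*$ be non-uniform, computationally unbounded senders that receive $|\vartheta\rangle^{\otimes T(\lambda)}$ and act identically in the commit phase (they apply the same channel, keep a finite-dimensional private register and send $\mathsf C$), and that in the reveal phase each apply a channel of their own to the private register to produce $\mathsf R$, $C_b^*$ revealing $b$. If $p_b$ is the probability, over $|\vartheta\rangle\leftarrow\mathcal H_{n}$ and the execution, that the receiver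 outputs $b$ in the interaction with $C_b^*$, then there is a negligible function $\mathsf{negl}$ with $p_0+p_1\le 1+\mathsf{negl}(\lambda)$ for all $\lambda$. -/

import Mathlib

open MeasureTheory
open scoped Matrix Kronecker ComplexOrder

noncomputable section

namespace CHS

/-! ### Qubit registers, pure states, Haar random states -/

/-- Labels of the computational basis of an `m`-qubit register. -/
abbrev Qubits (m : ℕ) : Type := Fin m → Bool

/-- The Hilbert space of `m` qubits. -/
abbrev Ket (m : ℕ) : Type := EuclideanSpace ℂ (Qubits m)

/-- The Haar measure on `m`-qubit pure states: the normalised (unitarily invariant) surface measure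
of the unit sphere of the `m`-qubit Hilbert space. -/
def haarState (m : ℕ) : Measure (Metric.sphere (0 : Ket m) 1) :=
  ((Measure.addHaar : Measure (Ket m)).toSphere Set.univ)⁻¹ •
    (Measure.addHaar : Measure (Ket m)).toSphere

/-- The rank-one operator `|ψ⟩⟨ψ|`. -/
def ketBra {ι : Type} (ψ : ι → ℂ) : Matrix ι ι ℂ := Matrix.vecMulVec ψ (star ψ)

/-- The amplitudes of `|θ⟩^{⊗ t}`. -/
def copiesOf {m : ℕ} (t : ℕ) (θ : Ket m) : (Fin t → Qubits m) → ℂ := fun v => ∏ i, θ (v i)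

/-- The `b` consecutive bits of `x` that start at position `off`; positions beyond the end of `x`
are read as `0`. -/
def window {a : ℕ} (x : Qubits a) (off b : ℕ) : Qubits b := fun i =>
  if h : off + (i : ℕ) < a then x ⟨off + i, h⟩ else false

/-- Density matrices. -/
def IsDensity {ι : Type} [Fintype ι] (ρ : Matrix ι ι ℂ) : Prop := ρ.PosSemidef ∧ ρ.trace = 1

/-- The partial trace over the second register. -/
def traceRight {A B : Type} [Fintype B] (ρ : Matrix (A × B) (A × B) ℂ) : Matrix A A ℂ :=
  fun a a' => ∑ b, ρ (a, b) (a', b)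

/-- Quantum channels (completely positive trace preserving maps), given by Kraus operators. -/
structure QChannel (A B : Type) [Fintype A] [DecidableEq A] [Fintype B] where
  num : ℕ
  kraus : Fin num → Matrix B A ℂ
  complete : ∑ i, (kraus i)ᴴ * kraus i = 1

/-- The output `Φ(ρ)` of a channel. -/
def QChannel.apply {A B : Type} [Fintype A] [DecidableEq A] [Fintype B] (Φ : QChannel A B)
    (ρ : Matrix A A ℂ) : Matrix B B ℂ :=
  ∑ i, Φ.kraus i * ρ * (Φ.kraus i)ᴴ

/-- The output `(id ⊗ Φ)(ρ)` of a channel that acts on the second of two registers. -/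
def QChannel.applyRight {S A B : Type} [Fintype S] [DecidableEq S] [Fintype A] [DecidableEq A]
    [Fintype B] (Φ : QChannel A B) (ρ : Matrix (S × A) (S × A) ℂ) :
    Matrix (S × B) (S × B) ℂ :=
  ∑ i, ((1 : Matrix S S ℂ) ⊗ₖ Φ.kraus i) * ρ * ((1 : Matrix S S ℂ) ⊗ₖ Φ.kraus i)ᴴ

/-! ### Uniform families of polynomial-size quantum circuits -/

/-- Elementary gates on `w` wires: `X`, Hadamard, `T = diag(1, e^{iπ/4})`, controlled-NOT (control
first) and Toffoli (controls first). -/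
inductive Gate (w : ℕ) : Type
  | x (i : Fin w) : Gate w
  | h (i : Fin w) : Gate w
  | t (i : Fin w) : Gate w
  | cx (i j : Fin w) (hij : i ≠ j) : Gate w
  | ccx (i j k : Fin w) (hij : i ≠ j) (hik : i ≠ k) (hjk : j ≠ k) : Gate w

/-- The unitary matrix of a gate; the entry at `(z', z)` is the amplitude of `z → z'`. -/
def Gate.toMatrix {w : ℕ} : Gate w → Matrix (Qubits w) (Qubits w) ℂ
  | .x i => fun z' z => if z' = Function.update z i (!z i) then 1 else 0
  | .h i => fun z' z => if ∀ j, j ≠ i → z' j = z j then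
      ((√2 : ℝ) : ℂ)⁻¹ * (if z' i && z i then -1 else 1) else 0
  | .t i => fun z' z => if z' = z then
      (if z i then Complex.exp (Complex.I * (Real.pi / 4)) else 1) else 0
  | .cx i j _ => fun z' z => if z' = Function.update z j (xor (z j) (z i)) then 1 else 0
  | .ccx i j k _ _ _ => fun z' z =>
      if z' = Function.update z k (xor (z k) (z i && z j)) then 1 else 0

/-- The unitary of a circuit, whose gates are applied from left to right. -/
def circuitUnitary {w : ℕ} : List (Gate w) → Matrix (Qubits w) (Qubits w) ℂ
  | [] => 1
  | g :: gs => circuitUnitary gs * g.toMatrix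

/-- The alphabet of circuit descriptions. -/
inductive Sym : Type
  | one | sep | x | h | t | cx | ccx

/-- Unary description of a number. -/
def unary (i : ℕ) : List Sym := List.replicate i Sym.one ++ [Sym.sep]

/-- The description of a gate: its name and its wires. -/
def Gate.describe {w : ℕ} : Gate w → List Sym
  | .x i => Sym.x :: unary i
  | .h i => Sym.h :: unary i
  | .t i => Sym.t :: unary i
  | .cx i j _ => Sym.cx :: (unary i ++ unary j)
  | .ccx i j k _ _ _ => Sym.ccx :: (unary i ++ unary j ++ unary k)

/-- The description of a circuit: its number of wires and its list of gates. -/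
def describe (w : ℕ) (gs : List (Gate w)) : List Sym := unary w ++ gs.flatMap Gate.describe

/-- The classical input of the parties in unary: the security parameter `k` and the length `n k`
of the common Haar state, that is, the string `1^k 0 1^{n k}`. -/
def encodeParam (n : ℕ → ℕ) (k : ℕ) : List Bool :=
  List.replicate k true ++ false :: List.replicate (n k) true

/-- Growth at most polynomial. -/
def PolyBounded (f : ℕ → ℕ) : Prop := ∃ P : Polynomial ℕ, ∀ k, f k ≤ P.eval k

/-- The circuit family `gs` is uniform of polynomial size: a single Turing machine, run on the
security parameter `k` (and the length `n k`) in unary, writes down the description of the `k`-th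
circuit within a number of steps that is polynomial in `k`. -/
def IsUniformPolyTime (n w : ℕ → ℕ) (gs : ∀ k, List (Gate (w k))) : Prop :=
  ∃ M : Turing.TM2ComputableInTime (encodeParam n) (id : List Sym → List Sym)
      (fun k => describe (w k) (gs k)),
    PolyBounded fun k => M.time (encodeParam n k).length

/-! ### Quantum commitments in the common Haar state model -/

/-- The data of a non-interactive quantum bit commitment scheme in the common Haar state model with
common Haar states of `n k` qubits at security parameter `k`.  The honest parties use `copies k`
copies of the common Haar state `θ`.
`commit k θ b` is the state on the registers `C` and `R` that the committer prepares for the bit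
`b` (`C` is sent in the commit phase and `R`, together with `b`, in the reveal phase);
`accept k θ b ρ` is the probability that the receiver outputs `b`, rather than rejecting, when it
is given `b` and registers `C` and `R` in the state `ρ`. -/
structure CommitmentScheme (n : ℕ → ℕ) where
  copies : ℕ → ℕ
  cQubits : ℕ → ℕ
  rQubits : ℕ → ℕ
  commit : ∀ k, Ket (n k) → Bool →
    Matrix (Qubits (cQubits k) × Qubits (rQubits k)) (Qubits (cQubits k) × Qubits (rQubits k)) ℂ
  accept : ∀ k, Ket (n k) → Bool →
    Matrix (Qubits (cQubits k) × Qubits (rQubits k)) (Qubits (cQubits k) × Qubits (rQubits k)) ℂ →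
    ℝ

/-- The input of a committer circuit with `w` wires: `p` copies of `θ` on the first `p * m` wires,
and `|0⟩` on every other wire. -/
def committerInput {m : ℕ} (p w : ℕ) (θ : Ket m) : Qubits w → ℂ := fun z =>
  if ∀ i : Fin w, p * m ≤ (i : ℕ) → z i = false then
    copiesOf p θ (fun i => window z ((i : ℕ) * m) m)
  else 0

/-- The state of the first `c` wires and the next `r` wires; all other wires are traced out. -/
def outputState {w : ℕ} (c r : ℕ) (ρ : Matrix (Qubits w) (Qubits w) ℂ) :
    Matrix (Qubits c × Qubits r) (Qubits c × Qubits r) ℂ := fun a a' =>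
  ∑ z, ∑ z', if (window z 0 c, window z c r) = a ∧ (window z' 0 c, window z' c r) = a' ∧
    (∀ i : Fin w, c + r ≤ (i : ℕ) → z i = z' i) then ρ z z' else 0

/-- The input of a receiver circuit with `w` wires: `p` copies of `θ`, then the registers `C` and
`R` in the state `ρ`, then `|0⟩` on every other wire. -/
def receiverInput {m c r : ℕ} (p w : ℕ) (θ : Ket m)
    (ρ : Matrix (Qubits c × Qubits r) (Qubits c × Qubits r) ℂ) :
    Matrix (Qubits w) (Qubits w) ℂ := fun z z' =>
  if (∀ i : Fin w, p * m + c + r ≤ (i : ℕ) → z i = false ∧ z' i = false) then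
    ketBra (copiesOf p θ) (fun i => window z ((i : ℕ) * m) m)
        (fun i => window z' ((i : ℕ) * m) m) *
      ρ (window z (p * m) c, window z (p * m + c) r)
        (window z' (p * m) c, window z' (p * m + c) r)
  else 0

/-- The probability that measuring wire `i` in the computational basis gives `1`. -/
def probOne {w : ℕ} (i : Fin w) (ρ : Matrix (Qubits w) (Qubits w) ℂ) : ℝ :=
  (∑ z : Qubits w, if z i then ρ z z else 0).re

namespace CommitmentScheme

variable {n : ℕ → ℕ}

/-- The committer is a uniform quantum polynomial-time algorithm. -/
def IsQPTCommitter (S : CommitmentScheme n) : Prop :=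
  ∀ b : Bool, ∃ (w : ℕ → ℕ) (gs : ∀ k, List (Gate (w k))), IsUniformPolyTime n w gs ∧
    ∀ k, S.copies k * n k ≤ w k ∧ S.cQubits k + S.rQubits k ≤ w k ∧
      ∀ θ : Ket (n k), ‖θ‖ = 1 →
        outputState (S.cQubits k) (S.rQubits k)
          (circuitUnitary (gs k) * ketBra (committerInput (S.copies k) (w k) θ) *
            (circuitUnitary (gs k))ᴴ) = S.commit k θ b

/-- The receiver is a uniform quantum polynomial-time algorithm: it accepts if and only if the
first auxiliary wire is found to be `1` at the end. -/
def IsQPTReceiver (S : CommitmentScheme n) : Prop :=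
  ∀ b : Bool, ∃ (w : ℕ → ℕ) (gs : ∀ k, List (Gate (w k))), IsUniformPolyTime n w gs ∧
    ∀ k, ∃ h : S.copies k * n k + S.cQubits k + S.rQubits k < w k,
      ∀ θ : Ket (n k), ‖θ‖ = 1 →
        ∀ ρ : Matrix (Qubits (S.cQubits k) × Qubits (S.rQubits k))
          (Qubits (S.cQubits k) × Qubits (S.rQubits k)) ℂ, IsDensity ρ →
          probOne ⟨S.copies k * n k + S.cQubits k + S.rQubits k, h⟩
            (circuitUnitary (gs k) * receiverInput (S.copies k) (w k) θ ρ *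
              (circuitUnitary (gs k))ᴴ) = S.accept k θ b ρ

/-- A quantum commitment scheme in the common Haar state model: committer and receiver use
polynomially many copies of the common Haar state and are uniform quantum polynomial-time
algorithms. -/
def IsQuantumCommitment (S : CommitmentScheme n) : Prop :=
  PolyBounded S.copies ∧ S.IsQPTCommitter ∧ S.IsQPTReceiver

/-- The honestly revealed bit is accepted with probability one. -/
def IsPerfectlyCorrect (S : CommitmentScheme n) : Prop :=
  ∀ (k : ℕ) (θ : Ket (n k)), ‖θ‖ = 1 → ∀ b : Bool, S.accept k θ b (S.commit k θ b) = 1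

/-- Negligible functions. -/
def Negligible (f : ℕ → ℝ) : Prop :=
  Asymptotics.SuperpolynomialDecay Filter.atTop (fun k : ℕ => (k : ℝ)) f

/-- The probability that a malicious receiver, who is given `t` copies of the common Haar state
and the register `C` of a commitment to `b` and makes the two-outcome measurement `{M, 1 - M}`,
outputs `1`. -/
def hidingProb (S : CommitmentScheme n) (k t : ℕ)
    (M : Matrix ((Fin t → Qubits (n k)) × Qubits (S.cQubits k))
      ((Fin t → Qubits (n k)) × Qubits (S.cQubits k)) ℂ) (b : Bool) : ℝ :=
  ∫ θ : Metric.sphere (0 : Ket (n k)) 1,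
    (M * (ketBra (copiesOf t (θ : Ket (n k))) ⊗ₖ
      traceRight (S.commit k (θ : Ket (n k)) b))).trace.re ∂(haarState (n k))

/-- Poly-copy statistical hiding.  A non-uniform, unbounded receiver that outputs a bit is an
arbitrary family of two-outcome measurements. -/
def IsPolyCopyStatisticallyHiding (S : CommitmentScheme n) : Prop :=
  ∀ t : ℕ → ℕ, PolyBounded t →
    ∀ M : ∀ k, Matrix ((Fin (t k) → Qubits (n k)) × Qubits (S.cQubits k))
        ((Fin (t k) → Qubits (n k)) × Qubits (S.cQubits k)) ℂ,
      (∀ k, (M k).PosSemidef ∧ (1 - M k).PosSemidef) →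
      ∃ negl : ℕ → ℝ, Negligible negl ∧
        ∀ k, |S.hidingProb k (t k) (M k) false - S.hidingProb k (t k) (M k) true| ≤ negl k

/-- The probability that the receiver accepts the bit `b` revealed by a malicious sender, who
applies the channel `com` to `T` copies of the common Haar state in order to prepare the register
`C` and a private register of dimension `d`, and in the reveal phase applies the channel `rev` to
the private register in order to produce the register `R`. -/
def bindingProb (S : CommitmentScheme n) (k T d : ℕ)
    (com : QChannel (Fin T → Qubits (n k)) (Qubits (S.cQubits k) × Fin d))
    (rev : QChannel (Fin d) (Qubits (S.rQubits k))) (b : Bool) : ℝ :=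
  ∫ θ : Metric.sphere (0 : Ket (n k)) 1,
    S.accept k (θ : Ket (n k)) b
      (rev.applyRight (com.apply (ketBra (copiesOf T (θ : Ket (n k)))))) ∂(haarState (n k))

/-- Statistical sum-binding.  The two malicious senders share their commit phase `com`, may use
any number of copies of the common Haar state, and are non-uniform and unbounded. -/
def IsStatisticallySumBinding (S : CommitmentScheme n) : Prop :=
  ∀ (T d : ℕ → ℕ)
    (com : ∀ k, QChannel (Fin (T k) → Qubits (n k)) (Qubits (S.cQubits k) × Fin (d k)))
    (rev : Bool → ∀ k, QChannel (Fin (d k)) (Qubits (S.rQubits k))),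
    ∃ negl : ℕ → ℝ, Negligible negl ∧
      ∀ k, S.bindingProb k (T k) (d k) (com k) (rev false k) false +
        S.bindingProb k (T k) (d k) (com k) (rev true k) true ≤ 1 + negl k

end CommitmentScheme

/-! ### The scheme -/

/-- The Pauli operator `Z^s ⊗ I_{m-k}` on `m` qubits, for `s ∈ {0,1}^k`. -/
def pauliZ {k : ℕ} (s : Qubits k) (m : ℕ) : Matrix (Qubits m) (Qubits m) ℂ :=
  Matrix.diagonal fun x => ∏ j : Fin k, if s j && window x 0 k j then -1 else 1

/-- The amplitudes of `|ψ_0⟩ = 2^{-k/2} ∑_s (Z^s ⊗ I)|θ⟩ ⊗ |s 0^{m-k}⟩`. -/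
def psiZero (k : ℕ) {m : ℕ} (θ : Ket m) : Qubits m × Qubits m → ℂ := fun a =>
  ((√(2 ^ k) : ℝ) : ℂ)⁻¹ *
    ∑ s : Qubits k, (pauliZ s m *ᵥ θ.ofLp) a.1 * (Pi.single (window s 0 m) 1 : Qubits m → ℂ) a.2

/-- The amplitudes of `|ψ_1⟩ = 2^{-m/2} ∑_j |j⟩ ⊗ |j⟩`. -/
def psiOne (m : ℕ) : Qubits m × Qubits m → ℂ := fun a =>
  ((√(2 ^ m) : ℝ) : ℂ)⁻¹ *
    ∑ j : Qubits m, (Pi.single j 1 : Qubits m → ℂ) a.1 * (Pi.single j 1 : Qubits m → ℂ) a.2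

/-- `|ψ_b⟩`, with `false` for the bit `0` and `true` for the bit `1`. -/
def psi (k : ℕ) {m : ℕ} (θ : Ket m) (b : Bool) : Qubits m × Qubits m → ℂ :=
  if b then psiOne m else psiZero k θ

/-- The basis label of the `i`-th pair `(C_i, R_i)` of `m`-qubit registers inside
`C = (C_1, …, C_p)` and `R = (R_1, …, R_p)`. -/
def block {p m : ℕ} (i : Fin p) (a : Qubits (p * m) × Qubits (p * m)) : Qubits m × Qubits m :=
  (window a.1 ((i : ℕ) * m) m, window a.2 ((i : ℕ) * m) m)

/-- The amplitudes of `|Ψ_b⟩ = ⨂_{i=1}^p |ψ_b⟩_{C_i R_i}`. -/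
def bigPsi (k p : ℕ) {m : ℕ} (θ : Ket m) (b : Bool) : Qubits (p * m) × Qubits (p * m) → ℂ :=
  fun a => ∏ i : Fin p, psi k θ b (block i a)

/-- The Hadamard matrix. -/
def hadamard : Matrix Bool Bool ℂ := fun x y => ((√2 : ℝ) : ℂ)⁻¹ * (if x && y then -1 else 1)

/-- The controlled swap of two registers; the control qubit is the first component. -/
def controlledSwap (D : Type) [DecidableEq D] : Matrix (Bool × D × D) (Bool × D × D) ℂ :=
  fun x y => if x = (y.1, if y.1 then y.2.swap else y.2) then 1 else 0

/-- The operator of the accepting outcome of the SWAP test of two registers: a control qubit `|0⟩`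
undergoes a Hadamard gate, controls the swap, undergoes a second Hadamard gate, and is measured;
the test accepts if the outcome is `0`. -/
def swapTestAccept (D : Type) [Fintype D] [DecidableEq D] : Matrix (D × D) (D × D) ℂ :=
  ((hadamard ⊗ₖ (1 : Matrix (D × D) (D × D) ℂ)) * controlledSwap D *
    (hadamard ⊗ₖ (1 : Matrix (D × D) (D × D) ℂ))).submatrix
      (fun d => (false, d)) (fun d => (false, d))

/-- The operator of the event that all `p` SWAP tests, the `i`-th one between `(C_i, R_i)` and
`(C'_i, R'_i)`, accept. -/
def allTestsAccept (p m : ℕ) :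
    Matrix ((Qubits (p * m) × Qubits (p * m)) × (Qubits (p * m) × Qubits (p * m)))
      ((Qubits (p * m) × Qubits (p * m)) × (Qubits (p * m) × Qubits (p * m))) ℂ :=
  fun a a' => ∏ i : Fin p, swapTestAccept (Qubits m × Qubits m)
    (block i a.1, block i a.2) (block i a'.1, block i a'.2)

/-- The commitment scheme, with `p = k` repetitions at security parameter `k`.  To commit to `b`
prepare `|Ψ_b⟩_{CR}`; to check an opening to `b` prepare `|Ψ_b⟩_{C'R'}` and perform the SWAP test
between `(C_i, R_i)` and `(C'_i, R'_i)` for every `i`. -/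
def swapTestScheme (n : ℕ → ℕ) : CommitmentScheme n where
  copies k := k
  cQubits k := k * n k
  rQubits k := k * n k
  commit k θ b := ketBra (bigPsi k k θ b)
  accept k θ b ρ :=
    (allTestsAccept k (n k) * (ρ ⊗ₖ ketBra (bigPsi k k θ b)) *
      (allTestsAccept k (n k))ᴴ).trace.re

end CHS

end

open MeasureTheory
open scoped Matrix Kronecker ComplexOrder

noncomputable section

namespace CHS

/-! Efficiency is an explicit construction. Circuits on numbered wires (`prepOps`, `receiverOps`)
are evaluated on amplitudes indexed by infinite bit strings. For the bit 0, a CNOT followed by a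
Hadamard on the copy produces the sum over s of Z^s|x⟩|s⟩; for the bit 1, the copy of θ is moved out
of the way and Bell pairs are made. Either way the auxiliary register ends in a product state with C
and R, so it drops out. The descriptions of these circuits are generated by nested loops (`Gen`),
which are compiled to counter programs (`Prog`) and then to stack machines with polynomial running
time (`Gen.isUniformPolyTime`).

A SWAP test against a prepared pure state ψ accepts with operator (|ψ⟩⟨ψ| + 1)/2, so acceptance is
the trace against the tensor power `acceptOp` (`accept_eq_trace`). It fixes Ψ_b, which is perfect
correctness.

Binding holds for every single θ. Expanding the tensor power, `acceptOp` is the average over sets S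
of pairs of the projection of the pairs in S onto ψ_b. The C-part of ψ_0 lies in the span of the
restrictions of θ to the 2^λ prefixes, so the projection for the bit 0 is dominated by a projection
Q on C alone. The reveal phase cannot influence its probability, hence both bits can be judged on
one state. The projection P for the bit 1 involves maximally entangled states, whose C-part is
maximally mixed, so PQP = cP with c ≤ 2^{(λ-n)|S|} ≤ 2^{-|S|}. Two such projections have
probabilities adding up to at most 1 + 2^{-|S|/2} (`re_trace_add_le`), and averaging over S gives 1
+ ((1 + 2^{-1/2})/2)^λ (`trace_acceptOp_add_le`).

Hiding compares Haar averages. Given θ, the register C_i holds θ dephased with respect to its first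
λ bits for the bit 0, and the maximally mixed state for the bit 1. Phase invariance kills all
moments between label tuples that are not permutations of each other (`moment_eq_zero`); invariance
under basis permutations makes the remaining ones equal on tuples of distinct labels. If all
prefixes differ, dephasing forces the permutation to fix the committed registers, so both averages
are multiples of one and the same 0-1 matrix (`exists_averageState_eq`). Their distance is then at
most their weight on tuples with colliding prefixes (`abs_trace_sub_le`), a birthday bound of order
(t + λ)² 2^{-λ} that rests on fourth moments of the Haar measure (`pairMoment_le`). -/

/-! ### Counter programs and their compilation to Turing machines -/

/-- Programs that act on counters with names in `ρ` and append symbols to an output list. -/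
inductive Prog (ρ : Type) : Type
  | skip : Prog ρ
  | emit (s : Sym) : Prog ρ
  | inc (r : ρ) : Prog ρ
  | seq (a b : Prog ρ) : Prog ρ
  | whileDec (r : ρ) (a : Prog ρ) : Prog ρ

namespace Prog

variable {ρ : Type}

/-- `Exec P e l e' l' t`: started with counters `e` and reversed output `l`, the program `P` stops
after `t` steps with counters `e'` and reversed output `l'`. -/
inductive Exec [DecidableEq ρ] : Prog ρ → (ρ → ℕ) → List Sym → (ρ → ℕ) → List Sym → ℕ → Prop
  | skip (e l) : Exec .skip e l e l 1
  | emit (s e l) : Exec (.emit s) e l e (s :: l) 1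
  | inc (r e l) : Exec (.inc r) e l (Function.update e r (e r + 1)) l 1
  | seq {a b e l e₁ l₁ t₁ e₂ l₂ t₂} : Exec a e l e₁ l₁ t₁ → Exec b e₁ l₁ e₂ l₂ t₂ →
      Exec (.seq a b) e l e₂ l₂ (t₁ + t₂)
  | done {r a e l} : e r = 0 → Exec (.whileDec r a) e l e l 1
  | loop {r a e l m e₁ l₁ t₁ e₂ l₂ t₂} : e r = m + 1 →
      Exec a (Function.update e r m) l e₁ l₁ t₁ → Exec (.whileDec r a) e₁ l₁ e₂ l₂ t₂ →
      Exec (.whileDec r a) e l e₂ l₂ (1 + t₁ + t₂)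

/-- The control points of a program. -/
def Pos : Prog ρ → Type
  | .skip => Unit
  | .emit _ => Unit
  | .inc _ => Unit
  | .seq a b => Pos a ⊕ Pos b
  | .whileDec _ a => Option (Pos a)

/-- The first control point. -/
def entry : (P : Prog ρ) → Pos P
  | .skip => ()
  | .emit _ => ()
  | .inc _ => ()
  | .seq a _ => Sum.inl (entry a)
  | .whileDec _ _ => none

theorem finite_pos (P : Prog ρ) : Finite (Pos P) := by
  induction P with
  | skip => exact inferInstanceAs (Finite Unit)
  | emit _ => exact inferInstanceAs (Finite Unit)
  | inc _ => exact inferInstanceAs (Finite Unit)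
  | seq a b iha ihb => exact inferInstanceAs (Finite (Pos a ⊕ Pos b))
  | whileDec _ a ih => exact inferInstanceAs (Finite (Option (Pos a)))

variable [DecidableEq ρ]

/-- The stack alphabets: two stackAt of symbols (reversed output and output) and stackAt of bits
(the input and the counters). -/
abbrev Alphabet (ρ : Type) : Bool ⊕ Option ρ → Type
  | .inl _ => Sym
  | .inr _ => Bool

/-- The stackAt that represent an input, counters, a reversed output and an output. -/
def stackAt (x : List Bool) (e : ρ → ℕ) (l o : List Sym) : ∀ k, List (Alphabet ρ k)
  | .inl false => l
  | .inl true => o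
  | .inr none => x
  | .inr (some r) => List.replicate (e r) true

theorem update_stackAt_reg (x : List Bool) (e : ρ → ℕ) (l o : List Sym) (r : ρ) (m : ℕ) :
    Function.update (stackAt x e l o) (.inr (some r)) (List.replicate m true) =
      stackAt x (Function.update e r m) l o := by
  funext k
  rcases k with (_ | _) | _ | r'
  · rfl
  · rfl
  · rfl
  · by_cases h : r' = r
    · subst h; simp [stackAt]
    · rw [Function.update_of_ne (by simpa using h)]; simp [stackAt, h]

theorem update_stackAt_acc (x : List Bool) (e : ρ → ℕ) (l o l' : List Sym) :
    Function.update (stackAt x e l o) (.inl false) l' = stackAt x e l' o := by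
  funext k
  rcases k with (_ | _) | _ | r' <;> rfl

theorem update_stackAt_out (x : List Bool) (e : ρ → ℕ) (l o o' : List Sym) :
    Function.update (stackAt x e l o) (.inl true) o' = stackAt x e l o' := by
  funext k
  rcases k with (_ | _) | _ | r' <;> rfl

theorem update_stackAt_inp (x x' : List Bool) (e : ρ → ℕ) (l o : List Sym) :
    Function.update (stackAt x e l o) (.inr none) x' = stackAt x' e l o := by
  funext k
  rcases k with (_ | _) | _ | r' <;> rfl

/-- The internal memory after a bit has been popped. -/
def bitMemory (o : Option Bool) : Option Sym := o.map fun b => if b then Sym.one else Sym.sep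

/-- The statement at a control point of a program that is embedded into a machine with labels
`Λ` and left through the label `exit`. -/
def code {Λ : Type} : (P : Prog ρ) → (Pos P → Λ) → Λ → Pos P →
    Turing.TM2.Stmt (Alphabet ρ) Λ (Option Sym)
  | .skip, _, exit, _ => .goto fun _ => exit
  | .emit s, _, exit, _ => .push (.inl false) (fun _ => s) (.goto fun _ => exit)
  | .inc r, _, exit, _ => .push (.inr (some r)) (fun _ => true) (.goto fun _ => exit)
  | .seq a b, f, _, .inl p => code a (f ∘ .inl) (f (.inr (entry b))) p
  | .seq _ b, f, exit, .inr p => code b (f ∘ .inr) exit p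
  | .whileDec r a, f, exit, none => .pop (.inr (some r)) (fun _ o => bitMemory o)
      (.branch Option.isSome (.load (fun _ => none) (.goto fun _ => f (some (entry a))))
        (.load (fun _ => none) (.goto fun _ => exit)))
  | .whileDec _ a, f, _, some p => code a (f ∘ some) (f none) p

theorem iterate_step_add {α : Type} (f : α → Option α) {a b : α} {c : Option α} {s t : ℕ}
    (h₁ : (flip bind f)^[s] (some a) = some b) (h₂ : (flip bind f)^[t] (some b) = c) :
    (flip bind f)^[s + t] (some a) = c := by
  rw [add_comm, Function.iterate_add_apply, h₁, h₂]

theorem some_cfg_congr {Λ : Type} (q : Option Λ) {S S' : ∀ k, List (Alphabet ρ k)} (h : S = S') :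
    some (⟨q, none, S⟩ : Turing.TM2.Cfg (Alphabet ρ) Λ (Option Sym)) = some ⟨q, none, S'⟩ := by
  rw [h]

/-- The internal memory is `none` at every control point, and each constructor of `Exec` charges
exactly the steps that its statement takes. Sequencing is free because the exit label of the first
part is the entry of the second. -/
theorem iterate_step_code {Λ : Type} (M : Λ → Turing.TM2.Stmt (Alphabet ρ) Λ (Option Sym))
    (x : List Bool) (o : List Sym) {P : Prog ρ} {e e' : ρ → ℕ} {l l' : List Sym} {t : ℕ}
    (h : Exec P e l e' l' t) (f : Pos P → Λ) (exit : Λ) (hM : ∀ p, M (f p) = code P f exit p) :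
    (flip bind (Turing.TM2.step M))^[t] (some ⟨some (f (entry P)), none, stackAt x e l o⟩) =
      some ⟨some exit, none, stackAt x e' l' o⟩ := by
  induction h generalizing exit with
  | skip e l =>
    change some (Turing.TM2.stepAux (M (f (entry _))) _ _) = _
    rw [hM]
    rfl
  | emit s e l =>
    change some (Turing.TM2.stepAux (M (f (entry _))) _ _) = _
    rw [hM]
    exact some_cfg_congr (some exit) (update_stackAt_acc x e l o _)
  | inc r e l =>
    change some (Turing.TM2.stepAux (M (f (entry _))) _ _) = _
    rw [hM]
    exact some_cfg_congr (some exit) (update_stackAt_reg x e l o r (e r + 1))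
  | @seq a b e l e₁ l₁ t₁ e₂ l₂ t₂ _ _ ih₁ ih₂ =>
    exact iterate_step_add _ (ih₁ (f ∘ .inl) (f (.inr (entry b))) fun p => hM (.inl p))
      (ih₂ (f ∘ .inr) exit fun p => hM (.inr p))
  | @done r a e l hr =>
    have h0 : stackAt x e l o (.inr (some r)) = [] := by simp [stackAt, hr]
    change some (Turing.TM2.stepAux (M (f (entry _))) _ _) = _
    rw [hM]
    simp only [code, entry, Turing.TM2.stepAux, h0]
    -- Popping an empty stack leaves it empty, so leaving the loop changes no counter.
    refine some_cfg_congr (some exit)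
      ((update_stackAt_reg x e l o r 0).trans ?_)
    rw [← hr, Function.update_eq_self]
  | @loop r a e l m e₁ l₁ t₁ e₂ l₂ t₂ hr _ _ ih₁ ih₂ =>
    have h0 : stackAt x e l o (.inr (some r)) = true :: List.replicate m true := by
      simp [stackAt, hr, List.replicate_succ]
    refine iterate_step_add _ (iterate_step_add _ ?_ (ih₁ (f ∘ some) (f none) fun p => hM (some p)))
      (ih₂ f exit hM)
    change some (Turing.TM2.stepAux (M (f (entry _))) _ _) = _
    rw [hM]
    simp only [code, entry, Turing.TM2.stepAux, h0]
    exact some_cfg_congr (some (f (some (entry a))))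
      (update_stackAt_reg x e l o r m)

/-! ### Reading the input and reversing the output -/

/-- The labels of the machine of a program: the control points of the program, two labels that
read the input, and one that reverses the output. -/
abbrev Label (P : Prog ρ) : Type := Pos P ⊕ Fin 3

/-- Move a block of `true` from the input to a counter. -/
def readCode {Λ : Type} (r : ρ) (self next : Λ) : Turing.TM2.Stmt (Alphabet ρ) Λ (Option Sym) :=
  .pop (.inr none) (fun _ o => bitMemory o)
    (.branch (fun v => match v with
        | some .one => true
        | _ => false)
      (.load (fun _ => none) (.push (.inr (some r)) (fun _ => true) (.goto fun _ => self)))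
      (.load (fun _ => none) (.goto fun _ => next)))

/-- The machine that reads `1^a 0 1^b` into the counters `ra` and `rb`, runs the program, and
reverses its output. -/
def machineCode (P : Prog ρ) (ra rb : ρ) :
    Label P → Turing.TM2.Stmt (Alphabet ρ) (Label P) (Option Sym)
  | .inl p => code P .inl (.inr 2) p
  | .inr 0 => readCode ra (.inr 0) (.inr 1)
  | .inr 1 => readCode rb (.inr 1) (.inl (entry P))
  | .inr 2 => .pop (.inl false) (fun _ o => o)
      (.branch Option.isSome
        (.push (.inl true) (fun v => v.getD .one) (.load (fun _ => none) (.goto fun _ => .inr 2)))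
        (.load (fun _ => none) .halt))

/-- The block ends at the first symbol other than `true` or at the end of the input. The step that
notices this also consumes the separator, whence `a + 1` steps and `x.tail`. -/
theorem iterate_step_readCode {Λ : Type} (M : Λ → Turing.TM2.Stmt (Alphabet ρ) Λ (Option Sym))
    {r : ρ} {self next : Λ} (hM : M self = readCode r self next) (x : List Bool)
    (hx : x.head? ≠ some true) (a : ℕ) (e : ρ → ℕ) (l o : List Sym) :
    (flip bind (Turing.TM2.step M))^[a + 1]
        (some ⟨some self, none, stackAt (List.replicate a true ++ x) e l o⟩) =
      some ⟨some next, none, stackAt x.tail (Function.update e r (e r + a)) l o⟩ := by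
  induction a generalizing e with
  | zero =>
    change some (Turing.TM2.stepAux (M self) _ _) = _
    rw [hM, add_zero, Function.update_eq_self]
    refine Eq.trans ?_ (some_cfg_congr (some next)
      (update_stackAt_inp x x.tail e l o))
    rcases x with _ | ⟨_ | _, x⟩
    · rfl
    · rfl
    · simp at hx
  | succ a ih =>
    rw [add_comm]
    have key := ih (Function.update e r (e r + 1))
    rw [Function.update_self, Function.update_idem] at key
    rw [show e r + (a + 1) = e r + 1 + a by ring]
    refine iterate_step_add _ ?_ key
    change some (Turing.TM2.stepAux (M self) _ _) = _
    rw [hM]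
    refine some_cfg_congr (some self) (Eq.trans ?_
      (update_stackAt_reg (List.replicate a true ++ x) e l o r (e r + 1)))
    rw [← update_stackAt_inp (List.replicate (a + 1) true ++ x) (List.replicate a true ++ x)]
    rfl

theorem iterate_step_flush (P : Prog ρ) (ra rb : ρ) (x : List Bool) (e : ρ → ℕ)
    (l o : List Sym) :
    (flip bind (Turing.TM2.step (machineCode P ra rb)))^[l.length + 1]
        (some ⟨some (.inr 2), none, stackAt x e l o⟩) =
      some ⟨none, none, stackAt x e [] (l.reverse ++ o)⟩ := by
  induction l generalizing o with
  | nil =>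
    change some (Turing.TM2.stepAux (machineCode P ra rb (.inr 2)) _ _) = _
    exact some_cfg_congr none (update_stackAt_acc x e [] o _)
  | cons s l ih =>
    rw [List.length_cons, add_comm]
    refine iterate_step_add _ ?_ ((ih (s :: o)).trans (by simp))
    change some (Turing.TM2.stepAux (machineCode P ra rb (.inr 2)) _ _) = _
    refine some_cfg_congr (some (Sum.inr 2)) (Eq.trans ?_ (update_stackAt_out x e l o (s :: o)))
    rw [← update_stackAt_acc x e (s :: l) o l]
    rfl

theorem finite_sym : Finite Sym :=
  Finite.of_injective (β := Fin 7)
    (fun s => match s with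
      | .one => 0 | .sep => 1 | .x => 2 | .h => 3 | .t => 4 | .cx => 5 | .ccx => 6)
    (by intro a b; cases a <;> cases b <;> simp)

/-- The machine of a program. -/
def machine [Fintype ρ] (P : Prog ρ) (ra rb : ρ) : Turing.FinTM2 :=
  haveI := finite_pos P
  haveI := finite_sym
  { K := Bool ⊕ Option ρ
    k₀ := .inr none
    k₁ := .inl true
    Γ := Alphabet ρ
    Λ := Label P
    main := .inr 0
    ΛFin := Fintype.ofFinite _
    σ := Option Sym
    initialState := none
    σFin := Fintype.ofFinite _
    Γk₀Fin := inferInstanceAs (Fintype Bool)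
    m := machineCode P ra rb }

/-- A program that turns the numbers `k` and `n k` into the word `F k` and leaves its counters empty
gives a Turing machine that computes `F`. -/
def computableInTime [Fintype ρ] (P : Prog ρ) (ra rb : ρ) (hab : ra ≠ rb) (n : ℕ → ℕ)
    (F : ℕ → List Sym) (T : ℕ → ℕ)
    (h : ∀ k, ∃ t, Exec P (Function.update (Function.update 0 ra k) rb (n k)) [] 0 (F k).reverse t ∧
      k + 1 + (n k + 1) + t + ((F k).length + 1) ≤ T (encodeParam n k).length) :
    Turing.TM2ComputableInTime (encodeParam n) (id : List Sym → List Sym) F where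
  tm := machine P ra rb
  inputAlphabet := Equiv.refl Bool
  outputAlphabet := Equiv.refl Sym
  time := T
  outputsFun k :=
    -- Reading the two blocks, running the program, and reversing the output; each of the three
    -- scanning phases needs one extra step to notice its end.
    { steps := k + 1 + (n k + 1) + (h k).choose + ((F k).length + 1)
      steps_le_m := (h k).choose_spec.2
      evals_in_steps := by
        obtain ⟨h₁, -⟩ := (h k).choose_spec
        set t := (h k).choose
        have e₀ : Turing.initList (machine P ra rb) (encodeParam n k) =
            ⟨some (.inr 0), none, stackAt (List.replicate k true ++ false ::
              (List.replicate (n k) true ++ [])) 0 [] []⟩ := by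
          refine congrArg (Turing.TM2.Cfg.mk (some (Sum.inr 0)) none) ?_
          funext s
          rcases s with (_ | _) | _ | r
          · rfl
          · rfl
          · exact (congrArg (fun y => List.replicate k true ++ false :: y)
              (List.append_nil _)).symm
          · rfl
        have e₁ : Turing.haltList (machine P ra rb) (F k) =
            ⟨none, none, stackAt [] 0 [] ((F k).reverse.reverse ++ [])⟩ := by
          refine congrArg (Turing.TM2.Cfg.mk none none) ?_
          funext s
          rcases s with (_ | _) | _ | r
          · rfl
          · change F k = (F k).reverse.reverse ++ []
            rw [List.reverse_reverse, List.append_nil]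
          · rfl
          · rfl
        have i₁ : List.map (Equiv.refl Bool).invFun (encodeParam n k) = encodeParam n k :=
          List.map_id _
        have i₂ : List.map (Equiv.refl Sym).invFun (F k) = F k := List.map_id _
        refine (congrArg _ (congrArg some ((congrArg _ i₁).trans e₀))).trans (Eq.trans ?_
          (congrArg some ((congrArg _ i₂).trans e₁)).symm)
        have s₁ := iterate_step_readCode (machineCode P ra rb) (r := ra) (self := .inr 0)
          (next := .inr 1) rfl (false :: (List.replicate (n k) true ++ [])) (by simp) k 0 [] []
        have s₂ := iterate_step_readCode (machineCode P ra rb) (r := rb) (self := .inr 1)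
          (next := .inl (entry P)) rfl [] (by simp) (n k) (Function.update 0 ra k) [] []
        have s₃ := iterate_step_code (machineCode P ra rb) [] [] h₁ .inl (.inr 2) fun p => rfl
        have s₄ := iterate_step_flush P ra rb [] 0 (F k).reverse []
        rw [List.length_reverse] at s₄
        rw [Pi.zero_apply, zero_add] at s₁
        rw [Function.update_of_ne hab.symm, Pi.zero_apply, zero_add] at s₂
        exact iterate_step_add _ (iterate_step_add _ (iterate_step_add _ s₁ s₂) s₃) s₄ }

end Prog

/-! ### A language for uniform families of words -/

/-- Descriptions of words that depend on numbers with names in `ι`; `loop r i G` stands for the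
concatenation of the words of `G` for `i = 0, …, r - 1`. -/
inductive Gen (ι : Type) : Type
  | emit (s : Sym) : Gen ι
  | seq (G H : Gen ι) : Gen ι
  | loop (r i : ι) (G : Gen ι) : Gen ι

namespace Gen

variable {ι : Type} [DecidableEq ι]

/-- The word that is described. -/
def den : Gen ι → (ι → ℕ) → List Sym
  | emit s, _ => [s]
  | seq G H, e => den G e ++ den H e
  | loop r i G, e => (List.range (e r)).flatMap fun j => den G (Function.update e i j)

/-- Loop indices are fresh and bounds are in scope. -/
def WellScoped : Finset ι → Gen ι → Prop
  | _, emit _ => True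
  | L, seq G H => WellScoped L G ∧ WellScoped L H
  | L, loop r i G => r ∈ L ∧ i ∉ L ∧ WellScoped (insert i L) G

instance decidableWellScoped : ∀ (L : Finset ι) (G : Gen ι), Decidable (WellScoped L G)
  | _, emit _ => inferInstanceAs (Decidable True)
  | L, seq G H =>
    haveI := decidableWellScoped L G
    haveI := decidableWellScoped L H
    inferInstanceAs (Decidable (_ ∧ _))
  | L, loop r i G =>
    haveI := decidableWellScoped (insert i L) G
    inferInstanceAs (Decidable (_ ∧ _ ∧ _))

/-- The counters of the compiled program: a scratch counter, and for every name its value and the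
number of outstanding iterations of its loop. -/
abbrev Counter (ι : Type) : Type := Option (ι × Bool)

/-- Compilation to counter programs. -/
def compile : Gen ι → Prog (Counter ι)
  | emit s => .emit s
  | seq G H => .seq (compile G) (compile H)
  | loop r i G =>
    -- Counters can only be read destructively. The bound goes to the scratch counter and back, the
    -- way back also filling the counter of outstanding rounds. The index is cleared at the end, so
    -- that a name is `0` outside its loop.
    .seq (.whileDec (some (r, false)) (.inc none))
      (.seq (.whileDec none (.seq (.inc (some (r, false))) (.inc (some (i, true)))))
        (.seq (.whileDec (some (i, true)) (.seq (compile G) (.inc (some (i, false)))))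
          (.whileDec (some (i, false)) .skip)))

/-- A bound for the running time if all numbers are at most `W`. -/
def cost : Gen ι → ℕ → ℕ
  | emit _, _ => 1
  | seq G H, W => cost G W + cost H W
  -- Two transfers, then rounds that cost the body plus a test and an increment, then the clearing
  -- of the index.
  | loop _ _ G, W => (2 * W + 1) + ((3 * W + 1) + ((W * (cost G W + 2) + 1) + (2 * W + 1)))

end Gen

/-! ### Execution and running time of compiled loops -/

namespace Prog

variable {ρ : Type} [DecidableEq ρ]

/-- Bounds the time of the final reversal of the output by the running time of the program. -/
theorem Exec.length_le {P : Prog ρ} {e e' : ρ → ℕ} {l l' : List Sym} {t : ℕ}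
    (h : Exec P e l e' l' t) : l'.length ≤ l.length + t := by
  induction h <;> (try simp only [List.length_cons]) <;> omega

theorem Exec.cast {P : Prog ρ} {e e₁ e₂ : ρ → ℕ} {l l₁ l₂ : List Sym} {t₁ t₂ : ℕ}
    (h : Exec P e l e₁ l₁ t₁) (he : e₁ = e₂) (hl : l₁ = l₂) (ht : t₁ = t₂) :
    Exec P e l e₂ l₂ t₂ := by
  subst he hl ht; exact h

theorem Exec.cast_left {P : Prog ρ} {e e₀ e' : ρ → ℕ} {l l' : List Sym} {t : ℕ}
    (h : Exec P e l e' l' t) (he : e₀ = e) : Exec P e₀ l e' l' t := by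
  subst he; exact h

theorem exec_clear (r : ρ) (e : ρ → ℕ) (l : List Sym) :
    Exec (.whileDec r .skip) e l (Function.update e r 0) l (2 * e r + 1) := by
  generalize hm : e r = m
  induction m generalizing e with
  | zero => exact (Exec.done hm).cast (by rw [← hm, Function.update_eq_self]) rfl rfl
  | succ m ih =>
    exact (Exec.loop hm (Exec.skip _ _) (ih (Function.update e r m) (by simp))).cast
      (by simp) rfl (by ring)

theorem exec_transfer {r s : ρ} (hrs : r ≠ s) (e : ρ → ℕ) (l : List Sym) :
    Exec (.whileDec r (.inc s)) e l
      (Function.update (Function.update e r 0) s (e s + e r)) l (2 * e r + 1) := by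
  generalize hm : e r = m
  induction m generalizing e with
  | zero =>
    refine (Exec.done hm).cast ?_ rfl rfl
    rw [← hm, Function.update_eq_self, hm, add_zero, Function.update_eq_self]
  | succ m ih =>
    refine (Exec.loop hm (Exec.inc _ _ _) (ih _ ?_)).cast ?_ rfl (by ring)
    · simp [hrs]
    · funext x
      by_cases hx : x = s
      · subst hx; simp [hrs.symm]; ring
      · by_cases hr : x = r
        · subst hr; simp [hrs]
        · simp [hx, hr]

theorem exec_transfer_two {r s u : ρ} (hrs : r ≠ s) (hru : r ≠ u) (hsu : s ≠ u) (e : ρ → ℕ)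
    (l : List Sym) :
    Exec (.whileDec r (.seq (.inc s) (.inc u))) e l
      (Function.update (Function.update (Function.update e r 0) s (e s + e r)) u (e u + e r)) l
      (3 * e r + 1) := by
  generalize hm : e r = m
  induction m generalizing e with
  | zero =>
    refine (Exec.done hm).cast ?_ rfl rfl
    rw [← hm, Function.update_eq_self, hm, add_zero, Function.update_eq_self, add_zero,
      Function.update_eq_self]
  | succ m ih =>
    refine (Exec.loop hm (Exec.seq (Exec.inc _ _ _) (Exec.inc _ _ _)) (ih _ ?_)).cast ?_ rfl
      (by ring)
    · simp [hrs, hru]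
    · funext x
      by_cases hu : x = u
      · subst hu; simp [hru.symm, hsu.symm]; ring
      · by_cases hs : x = s
        · subst hs; simp [hrs.symm, hu]; ring
        · by_cases hr : x = r
          · subst hr; simp [hrs, hru]
          · simp [hu, hs, hr]

end Prog

namespace Gen

variable {ι : Type} [DecidableEq ι]

-- Induction on the number `m` of rounds left out of `M`: the index stands at `M - m`, and `range'
-- (M - m) m` lists the indices still to come.
open Prog in
theorem exec_compile_loop {i : ι} {P : Prog (Counter ι)} {F : ℕ → List Sym} {c : ℕ}
    (E : Counter ι → ℕ) (m M : ℕ) (hmM : m ≤ M)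
    (h : ∀ m j l, j ≤ M → ∃ t ≤ c, Exec P
      (Function.update (Function.update E (some (i, true)) m) (some (i, false)) j) l
      (Function.update (Function.update E (some (i, true)) m) (some (i, false)) j)
      ((F j).reverse ++ l) t) (l : List Sym) :
    ∃ t ≤ m * (c + 2) + 1,
      Exec (.whileDec (some (i, true)) (.seq P (.inc (some (i, false)))))
        (Function.update (Function.update E (some (i, true)) m) (some (i, false)) (M - m)) l
        (Function.update (Function.update E (some (i, true)) 0) (some (i, false)) M)
        (((List.range' (M - m) m).flatMap F).reverse ++ l) t := by
  induction m generalizing l with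
  | zero => exact ⟨1, by omega, (Exec.done (by simp)).cast rfl (by simp) rfl⟩
  | succ m ih =>
    obtain ⟨t₁, ht₁, h₁⟩ := h m (M - (m + 1)) l (by omega)
    obtain ⟨t₂, ht₂, h₂⟩ := ih (by omega) ((F (M - (m + 1))).reverse ++ l)
    refine ⟨1 + (t₁ + 1) + t₂, by nlinarith, ?_⟩
    have e₁ := Exec.inc (some (i, false)) (Function.update (Function.update E (some (i, true)) m)
      (some (i, false)) (M - (m + 1))) ((F (M - (m + 1))).reverse ++ l)
    rw [Function.update_self, Function.update_idem, show M - (m + 1) + 1 = M - m by omega] at e₁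
    refine (Exec.loop (m := m) (by simp) (Exec.seq (h₁.cast_left ?_) e₁) h₂).cast rfl ?_ rfl
    · rw [Function.update_comm (by simp), Function.update_idem]
    · rw [List.range'_succ]
      simp [show M - (m + 1) + 1 = M - m by omega]

-- Bodies can be iterated because compiled code restores every counter. Names outside the scope `L`
-- must hold `0`, since a loop counts its index up from the value it finds.
open Prog in
theorem exec_compile (G : Gen ι) (L : Finset ι) (hG : WellScoped L G) (E : Counter ι → ℕ) (W : ℕ)
    (hE : E none = 0) (hL : ∀ i ∉ L, ∀ b, E (some (i, b)) = 0)
    (hW : ∀ i, E (some (i, false)) ≤ W) (l : List Sym) :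
    ∃ t ≤ cost G W,
      Exec (compile G) E l E ((den G fun i => E (some (i, false))).reverse ++ l) t := by
  induction G generalizing L E l with
  | emit s => exact ⟨1, le_rfl, Exec.emit s E l⟩
  | seq G H ihG ihH =>
    obtain ⟨t₁, ht₁, h₁⟩ := ihG L hG.1 E hE hL hW l
    obtain ⟨t₂, ht₂, h₂⟩ := ihH L hG.2 E hE hL hW _
    exact ⟨t₁ + t₂, add_le_add ht₁ ht₂, (Exec.seq h₁ h₂).cast rfl (by simp [den]) rfl⟩
  | loop r i G ih =>
    obtain ⟨hr, hi, hG⟩ := hG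
    have hri : r ≠ i := fun h => hi (h ▸ hr)
    set m := E (some (r, false)) with hm
    have hmW : m ≤ W := hW r
    have hi0 : E (some (i, false)) = 0 := hL i hi false
    have hi1 : E (some (i, true)) = 0 := hL i hi true
    obtain ⟨t, ht, h⟩ := exec_compile_loop (c := cost G W) (i := i) (P := compile G)
      (F := fun j => den G (Function.update (fun i => E (some (i, false))) i j)) E m m le_rfl
      (fun c j l hj => by
        obtain ⟨t, ht, h⟩ := ih (insert i L) hG
          (Function.update (Function.update E (some (i, true)) c) (some (i, false)) j)
          (by simpa using hE)
          (fun i' hi' b => by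
            rw [Finset.mem_insert, not_or] at hi'
            simpa [hi'.1] using hL i' hi'.2 b)
          (fun i' => by
            by_cases h : i' = i
            · subst h; simpa using hj.trans hmW
            · simpa [h] using hW i') l
        refine ⟨t, ht, h.cast rfl ?_ rfl⟩
        congr 3
        funext i'
        by_cases h : i' = i
        · subst h; simp
        · simp [h]) l
    rw [Nat.sub_self] at h
    have e₁ := exec_transfer (r := some (r, false)) (s := none) (by simp) E l
    have e₂ := exec_transfer_two (r := none) (s := some (r, false)) (u := some (i, true))
      (by simp) (by simp) (by simp) (Function.update (Function.update E (some (r, false)) 0) none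
        (E none + E (some (r, false)))) l
    have e₄ := exec_clear (some (i, false))
      (Function.update (Function.update E (some (i, true)) 0) (some (i, false)) m)
      (((List.range' 0 m).flatMap fun j =>
        den G (Function.update (fun i => E (some (i, false))) i j)).reverse ++ l)
    refine ⟨_, ?_, Exec.seq e₁ (Exec.seq (e₂.cast ?_ rfl rfl) (Exec.seq h (e₄.cast ?_ ?_ rfl)))⟩
    · simp only [Function.update_self, hE, zero_add, cost, ← hm]
      have : m * (cost G W + 2) ≤ W * (cost G W + 2) := Nat.mul_le_mul_right _ hmW
      omega
    · funext x
      rcases x with _ | ⟨x, _ | _⟩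
      · simp [hE]
      · by_cases hx : x = r
        · subst hx; simp [hE, hri, hm]
        · by_cases hx' : x = i
          · subst hx'; simp [hx, hi0]
          · simp [hx, hx']
      · by_cases hx' : x = i
        · subst hx'; simp [hi1, hE, hm]
        · simp [hx']
    · funext x
      rcases x with _ | ⟨x, _ | _⟩
      · simp
      · by_cases hx' : x = i
        · subst hx'; simp [hi0]
        · simp [hx']
      · by_cases hx' : x = i
        · subst hx'; simp [hi1]
        · simp [hx']
    · rw [den, ← hm, List.range_eq_range']

theorem polyBounded_cost (G : Gen ι) {f : ℕ → ℕ} (hf : PolyBounded f) :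
    PolyBounded fun k => cost G (f k) := by
  induction G with
  | emit s => exact ⟨1, fun k => by simp [cost]⟩
  | seq G H ihG ihH =>
    obtain ⟨P, hP⟩ := ihG
    obtain ⟨Q, hQ⟩ := ihH
    exact ⟨P + Q, fun k => by simpa [cost] using add_le_add (hP k) (hQ k)⟩
  | loop r i G ih =>
    obtain ⟨P, hP⟩ := ih
    obtain ⟨Q, hQ⟩ := hf
    refine ⟨(2 * Q + 1) + ((3 * Q + 1) + ((Q * (P + 2) + 1) + (2 * Q + 1))), fun k => ?_⟩
    have h₁ := hP k
    have h₂ := hQ k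
    simp only [cost, Polynomial.eval_add, Polynomial.eval_mul, Polynomial.eval_one,
      Polynomial.eval_ofNat]
    gcongr

open Prog in
/-- Families of circuits whose descriptions are generated by loops are uniform. -/
theorem isUniformPolyTime [Fintype ι] (G : Gen ι) {a b : ι} (hab : a ≠ b)
    (hG : WellScoped {a, b} G) {n w : ℕ → ℕ} (hn : PolyBounded n) (gs : ∀ k, List (Gate (w k)))
    (h : ∀ k, den G (Function.update (Function.update 0 a k) b (n k)) = describe (w k) (gs k)) :
    IsUniformPolyTime n w gs := by
  have hab' : b ≠ a := hab.symm
  -- The two final loops empty the input counters, as the machine has to halt with all stacks but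
  -- the output empty. In the time bound, the linear part pays for reading and clearing; the cost
  -- occurs twice, once for the run and once for reversing an output that is no longer than the run.
  refine ⟨Prog.computableInTime (.seq (compile G) (.seq (.whileDec (some (a, false)) .skip)
    (.whileDec (some (b, false)) .skip))) (some (a, false)) (some (b, false)) (by simpa using hab) n
    (fun k => describe (w k) (gs k)) (fun L => 6 * L + 5 + 2 * cost G L) fun k => ?_, ?_⟩
  · set E : Counter ι → ℕ :=
      Function.update (Function.update 0 (some (a, false)) k) (some (b, false)) (n k) with hE
    have hL : (encodeParam n k).length = k + 1 + n k := by simp [encodeParam]; ring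
    rw [hL]
    have Ea : E (some (a, false)) = k := by simp [hE, hab]
    have Eb : E (some (b, false)) = n k := by simp [hE]
    obtain ⟨t, ht, h₁⟩ := exec_compile G {a, b} hG E (k + 1 + n k) (by simp [hE])
      (fun i hi c => by
        simp only [Finset.mem_insert, Finset.mem_singleton, not_or] at hi
        simp [hE, hi.1, hi.2])
      (fun i => by
        by_cases hib : i = b
        · subst hib; rw [Eb]; omega
        · by_cases hia : i = a
          · subst hia; rw [Ea]; omega
          · simp [hE, hia, hib]) []
    have h₂ := exec_clear (some (a, false)) E
      ((den G fun i => E (some (i, false))).reverse ++ [])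
    have h₃ := exec_clear (some (b, false)) (Function.update E (some (a, false)) 0)
      ((den G fun i => E (some (i, false))).reverse ++ [])
    have hd : (den G fun i => E (some (i, false))) = describe (w k) (gs k) := by
      rw [← h k]
      congr 1
      funext i
      by_cases hib : i = b
      · subst hib; simp [Eb]
      · by_cases hia : i = a
        · subst hia; simp [Ea, hib]
        · simp [hE, hia, hib]
    have hl := h₁.length_le
    rw [hd] at h₁ h₂ h₃ hl
    refine ⟨_, (Exec.seq h₁ (Exec.seq h₂ h₃)).cast ?_ (by simp) rfl, ?_⟩
    · funext x
      simp only [hE]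
      by_cases hxb : x = some (b, false)
      · subst hxb; simp
      · by_cases hxa : x = some (a, false)
        · subst hxa; simp [hab]
        · simp [hxa, hxb]
    · simp only [List.append_nil, List.length_reverse, List.length_nil] at hl
      rw [Function.update_of_ne (by simpa using hab'), Ea, Eb]
      omega
  · obtain ⟨Q, hQ⟩ := hn
    have hL : PolyBounded fun k => (encodeParam n k).length :=
      ⟨Polynomial.X + 1 + Q, fun k => by
        have := hQ k
        simp [encodeParam]; omega⟩
    obtain ⟨P, hP⟩ := polyBounded_cost G hL
    obtain ⟨R, hR⟩ := hL
    refine ⟨6 * R + 5 + 2 * P, fun k => ?_⟩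
    have h₁ : cost G (encodeParam n k).length ≤ _ := hP k
    have h₂ : (encodeParam n k).length ≤ _ := hR k
    change 6 * (encodeParam n k).length + 5 + 2 * cost G (encodeParam n k).length ≤ _
    simp only [Polynomial.eval_add, Polynomial.eval_mul, Polynomial.eval_ofNat]
    omega

end Gen

/-! ### Circuits on numbered wires -/

/-- Gates on wires that are given by numbers. -/
inductive Op : Type
  | x (i : ℕ) : Op
  | h (i : ℕ) : Op
  | cx (i j : ℕ) : Op
  | ccx (i j k : ℕ) : Op

namespace Op

/-- The gate acts on distinct wires among the first `w`. -/
def Valid (w : ℕ) : Op → Prop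
  | x i => i < w
  | h i => i < w
  | cx i j => i < w ∧ j < w ∧ i ≠ j
  | ccx i j k => i < w ∧ j < w ∧ k < w ∧ i ≠ j ∧ i ≠ k ∧ j ≠ k

open Classical in
/-- The gate on `w` wires, if it is valid. -/
def gates (w : ℕ) : Op → List (Gate w)
  | x i => if h : i < w then [.x ⟨i, h⟩] else []
  | h i => if h : i < w then [.h ⟨i, h⟩] else []
  | cx i j => if h : i < w ∧ j < w ∧ i ≠ j then
      [.cx ⟨i, h.1⟩ ⟨j, h.2.1⟩ (by simpa using h.2.2)] else []
  | ccx i j k => if h : i < w ∧ j < w ∧ k < w ∧ i ≠ j ∧ i ≠ k ∧ j ≠ k then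
      [.ccx ⟨i, h.1⟩ ⟨j, h.2.1⟩ ⟨k, h.2.2.1⟩ (by simpa using h.2.2.2.1) (by simpa using h.2.2.2.2.1)
        (by simpa using h.2.2.2.2.2)] else []

/-- The description of the gate. -/
def word : Op → List Sym
  | x i => Sym.x :: unary i
  | h i => Sym.h :: unary i
  | cx i j => Sym.cx :: (unary i ++ unary j)
  | ccx i j k => Sym.ccx :: (unary i ++ unary j ++ unary k)

/-- The action on amplitudes that are indexed by infinite bit strings. -/
def act : Op → ((ℕ → Bool) → ℂ) → (ℕ → Bool) → ℂ
  | x i, f => fun s => f (Function.update s i (!s i))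
  | h i, f => fun s => ((√2 : ℝ) : ℂ)⁻¹ * (f (Function.update s i false) +
      (if s i then -1 else 1) * f (Function.update s i true))
  | cx i j, f => fun s => f (Function.update s j (xor (s j) (s i)))
  | ccx i j k, f => fun s => f (Function.update s k (xor (s k) (s i && s j)))

theorem describe_gates {w : ℕ} {o : Op} (ho : o.Valid w) :
    (o.gates w).flatMap Gate.describe = o.word := by
  cases o <;> simp only [Valid] at ho <;> simp [gates, ho, Gate.describe, word]

/-- The first `w` bits of a bit string. -/
def _root_.CHS.ofBits (w : ℕ) (s : ℕ → Bool) : Qubits w := fun i => s i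

theorem ofBits_update {w i : ℕ} (hi : i < w) (s : ℕ → Bool) (b : Bool) :
    ofBits w (Function.update s i b) = Function.update (ofBits w s) ⟨i, hi⟩ b := by
  funext j
  by_cases h : j = ⟨i, hi⟩
  · subst h; simp [ofBits]
  · rw [Function.update_of_ne h]
    exact Function.update_of_ne (fun h' => h (Fin.ext h')) _ _

/-- A permutation matrix moves amplitudes to preimages; involutivity is what allows `p z` instead of
the preimage of `z`. -/
theorem mulVec_permutation {w : ℕ} {M : Matrix (Qubits w) (Qubits w) ℂ} {p : Qubits w → Qubits w}
    (hp : Function.Involutive p) (hM : ∀ z' z, M z' z = if z' = p z then 1 else 0)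
    (f : Qubits w → ℂ) (z : Qubits w) : (M *ᵥ f) z = f (p z) := by
  change ∑ y, M z y * f y = _
  rw [Finset.sum_eq_single (p z)]
  · simp [hM, hp z]
  · intro y _ hy
    rw [hM, if_neg, zero_mul]
    rintro rfl
    exact hy (hp y).symm
  · simp

theorem mulVec_x {w : ℕ} (i : Fin w) (f : Qubits w → ℂ) (z : Qubits w) :
    ((Gate.x i).toMatrix *ᵥ f) z = f (Function.update z i (!z i)) :=
  mulVec_permutation (p := fun z => Function.update z i (!z i)) (fun z => by simp)
    (fun _ _ => rfl) f z

theorem mulVec_cx {w : ℕ} (i j : Fin w) (h : i ≠ j) (f : Qubits w → ℂ) (z : Qubits w) :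
    ((Gate.cx i j h).toMatrix *ᵥ f) z = f (Function.update z j (xor (z j) (z i))) :=
  mulVec_permutation (p := fun z => Function.update z j (xor (z j) (z i)))
    (fun z => by simp [h]) (fun _ _ => rfl) f z

theorem mulVec_ccx {w : ℕ} (i j k : Fin w) (hij : i ≠ j) (hik : i ≠ k) (hjk : j ≠ k)
    (f : Qubits w → ℂ) (z : Qubits w) :
    ((Gate.ccx i j k hij hik hjk).toMatrix *ᵥ f) z =
      f (Function.update z k (xor (z k) (z i && z j))) :=
  mulVec_permutation (p := fun z => Function.update z k (xor (z k) (z i && z j)))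
    (fun z => by simp [hik, hjk]) (fun _ _ => rfl) f z

theorem mulVec_h {w : ℕ} (i : Fin w) (f : Qubits w → ℂ) (z : Qubits w) :
    ((Gate.h i).toMatrix *ᵥ f) z = ((√2 : ℝ) : ℂ)⁻¹ * (f (Function.update z i false) +
      (if z i then -1 else 1) * f (Function.update z i true)) := by
  have hne : Function.update z i false ≠ Function.update z i true := fun h => by
    simpa using congrFun h i
  change ∑ y, (Gate.h i).toMatrix z y * f y = _
  rw [Finset.sum_eq_add_of_mem _ _ (Finset.mem_univ _) (Finset.mem_univ _) hne]
  · have h1 : ∀ b, ∀ j, j ≠ i → z j = Function.update z i b j := fun b j hj => by simp [hj]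
    simp only [Gate.toMatrix, if_pos (h1 _), Function.update_self, Bool.and_false, Bool.and_true,
      Bool.false_eq_true, if_false]
    ring
  · rintro y - ⟨hy0, hy1⟩
    simp only [Gate.toMatrix]
    rw [if_neg, zero_mul]
    intro h
    have hy : y = Function.update z i (y i) := by
      funext j
      by_cases hj : j = i
      · subst hj; simp
      · simp [hj, h j hj]
    cases hb : y i <;> rw [hb] at hy
    · exact hy0 hy
    · exact hy1 hy

/-- On infinite bit strings wires are plain natural numbers, so that later register arithmetic needs
no bounded indices. -/
theorem mulVec_gates {w : ℕ} {o : Op} (ho : o.Valid w) (f : Qubits w → ℂ) (s : ℕ → Bool) :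
    (circuitUnitary (o.gates w) *ᵥ f) (ofBits w s) = o.act (fun s => f (ofBits w s)) s := by
  cases o with
  | x i =>
    have ho : i < w := ho
    rw [gates, dif_pos ho, circuitUnitary, circuitUnitary, one_mul, mulVec_x, act]
    simp only [ofBits_update ho]
    rfl
  | h i =>
    have ho : i < w := ho
    rw [gates, dif_pos ho, circuitUnitary, circuitUnitary, one_mul, mulVec_h, act]
    simp only [ofBits_update ho]
    rfl
  | cx i j =>
    have ho : i < w ∧ j < w ∧ i ≠ j := ho
    rw [gates, dif_pos ho, circuitUnitary, circuitUnitary, one_mul, mulVec_cx, act]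
    simp only [ofBits_update ho.2.1]
    rfl
  | ccx i j k =>
    have ho : i < w ∧ j < w ∧ k < w ∧ i ≠ j ∧ i ≠ k ∧ j ≠ k := ho
    rw [gates, dif_pos ho, circuitUnitary, circuitUnitary, one_mul, mulVec_ccx, act]
    simp only [ofBits_update ho.2.2.1]
    rfl

/-- The action of a list of gates. -/
def acts : List Op → ((ℕ → Bool) → ℂ) → (ℕ → Bool) → ℂ
  | [], f => f
  | o :: l, f => acts l (o.act f)

theorem acts_append (l l' : List Op) (f : (ℕ → Bool) → ℂ) :
    acts (l ++ l') f = acts l' (acts l f) := by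
  induction l generalizing f with
  | nil => rfl
  | cons o l ih => exact ih _

theorem _root_.CHS.circuitUnitary_append {w : ℕ} (l l' : List (Gate w)) :
    circuitUnitary (l ++ l') = circuitUnitary l' * circuitUnitary l := by
  induction l with
  | nil => simp [circuitUnitary]
  | cons g l ih => simp [circuitUnitary, ih, Matrix.mul_assoc]

theorem mulVec_flatMap_gates {w : ℕ} {l : List Op} (hl : ∀ o ∈ l, o.Valid w) (f : Qubits w → ℂ)
    (s : ℕ → Bool) :
    (circuitUnitary (l.flatMap (gates w)) *ᵥ f) (ofBits w s) =
      acts l (fun s => f (ofBits w s)) s := by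
  induction l generalizing f with
  | nil => simp [circuitUnitary, acts]
  | cons o l ih =>
    rw [List.flatMap_cons, circuitUnitary_append, ← Matrix.mulVec_mulVec,
      ih fun o' ho' => hl o' (List.mem_cons_of_mem _ ho')]
    rw [acts]
    congr 1
    funext s
    exact mulVec_gates (hl o List.mem_cons_self) f s

theorem describe_flatMap_gates {w : ℕ} {l : List Op} (hl : ∀ o ∈ l, o.Valid w) :
    describe w (l.flatMap (gates w)) = unary w ++ l.flatMap word := by
  rw [describe, List.flatMap_assoc]
  congr 1
  exact List.flatMap_congr fun o ho => describe_gates (hl o ho)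

end Op

/-! ### The circuits of the scheme -/

/-- The circuit that prepares `|Ψ_b⟩`: the register `C` is at the beginning and holds the copies of
the common Haar state, the register `R` is at `r`, and there is an auxiliary register at `a`. -/
def prepOps (k m r a : ℕ) (b : Bool) : List Op :=
  if b then
    -- The first two gates move a qubit of `θ` to an auxiliary wire that is `0` and empty its wire
    -- of C; the Hadamard and the last CNOT create a Bell pair.
    (List.range k).flatMap fun i => (List.range m).flatMap fun j =>
      [.cx (i * m + j) (a + (i * m + j)), .cx (a + (i * m + j)) (i * m + j), .h (i * m + j),
        .cx (i * m + j) (r + (i * m + j))]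
  else
    -- Only the first `k` wires of each block are copied to R. The Hadamard turns the copy of a bit
    -- x into the sum over s of (-1)^{xs}|s⟩, and this sign is the action of Z^s on x.
    (List.range k).flatMap fun i => (List.range k).flatMap fun j =>
      [.cx (i * m + j) (r + (i * m + j)), .h (r + (i * m + j))]

/-- The controlled swap of two wires. -/
def cswapOps (c i j : ℕ) : List Op := [.cx j i, .ccx c i j, .cx j i]

/-- The position of the receiver's register `R'`. -/
def recvR (k m : ℕ) : ℕ := 3 * (k * m) + k + 2

/-- The `i`-th SWAP test, with control wire `recvR + 2 k m + i`; wire `3 k m + 2 + i` is set if this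
and all earlier tests accept. -/
def testOps (k m i : ℕ) : List Op :=
  [.h (recvR k m + 2 * (k * m) + i)] ++
    ((List.range m).flatMap fun j =>
      cswapOps (recvR k m + 2 * (k * m) + i) (i * m + j) (k * m + (i * m + j)) ++
      cswapOps (recvR k m + 2 * (k * m) + i) (recvR k m + (i * m + j))
        (2 * (k * m) + (i * m + j))) ++
    -- Acceptance is outcome `0`; the X gate turns it into `1`, and the Toffoli gate conjoins it
    -- with the flag of the earlier tests.
    [.h (recvR k m + 2 * (k * m) + i), .x (recvR k m + 2 * (k * m) + i),
      .ccx (recvR k m + 2 * (k * m) + i) (3 * (k * m) + 1 + i) (3 * (k * m) + 2 + i)]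

/-- The circuit of the receiver. -/
def receiverOps (k m : ℕ) (b : Bool) : List Op :=
  -- Wire layout, with M = `k * m`: C' at 0, C at M, R at 2M, the answer at 3M, the flags at 3M + 1,
  -- …, 3M + 1 + k, then R', the auxiliary register and the `k` control wires. The initial flag is
  -- set to `1`, and the last one is copied to the answer.
  prepOps k m (recvR k m) (recvR k m + k * m) b ++ ([.x (3 * (k * m) + 1)] ++
    ((List.range k).flatMap (testOps k m) ++ [.cx (3 * (k * m) + 1 + k) (3 * (k * m))]))

theorem mul_add_lt_mul {k m i j : ℕ} (hi : i < k) (hj : j < m) : i * m + j < k * m :=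
  calc i * m + j < i * m + m := by omega
    _ = (i + 1) * m := by ring
    _ ≤ k * m := Nat.mul_le_mul_right _ hi

theorem valid_prepOps {k m r a w : ℕ} (hkm : k ≤ m) (b : Bool) (hr : k * m ≤ r)
    (hra : r + k * m ≤ a) (haw : a + k * m ≤ w) : ∀ o ∈ prepOps k m r a b, o.Valid w := by
  intro o ho
  cases b <;>
  · simp only [prepOps, if_true, Bool.false_eq_true, if_false, List.mem_flatMap,
      List.mem_range, List.mem_cons, List.not_mem_nil, or_false] at ho
    obtain ⟨i, hi, j, hj, ho⟩ := ho
    have := mul_add_lt_mul hi (show j < m by omega)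
    obtain rfl | rfl | rfl | rfl | rfl := ho <;> simp only [Op.Valid] <;> omega

theorem valid_receiverOps {k m : ℕ} (hkm : k ≤ m) (b : Bool) :
    ∀ o ∈ receiverOps k m b, o.Valid (recvR k m + 2 * (k * m) + k) := by
  intro o ho
  simp only [receiverOps, List.mem_append] at ho
  obtain ho | ho | ho | ho := ho
  · exact valid_prepOps hkm b (by unfold recvR; omega) le_rfl (by omega) o ho
  · simp only [List.mem_singleton] at ho
    subst ho
    simp only [Op.Valid, recvR]
    omega
  · simp only [testOps, cswapOps, List.mem_flatMap, List.mem_range, List.mem_cons, List.mem_append,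
      List.not_mem_nil, or_false] at ho
    obtain ⟨i, hi, (rfl | ⟨j, hj, ho⟩) | ho⟩ := ho
    · simp only [Op.Valid]; omega
    · have := mul_add_lt_mul hi hj
      obtain (rfl | rfl | rfl) | rfl | rfl | rfl := ho <;> simp only [Op.Valid, recvR] <;> omega
    · obtain rfl | rfl | rfl := ho <;> simp only [Op.Valid, recvR] <;> omega
  · simp only [List.mem_singleton] at ho
    subst ho
    simp only [Op.Valid, recvR]
    omega

/-! ### The circuits are uniform -/

namespace Gen

/-- A unary number that is the value of a name. -/
def var (r : Fin 6) : Gen (Fin 6) := loop r 4 (emit .one)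

/-- The unary product of two names. -/
def mul (r s : Fin 6) : Gen (Fin 6) := loop r 4 (loop s 5 (emit .one))

/-- The wire `i m + j`, where the names `0`, `1`, `2`, `3` stand for `k`, `m`, `i`, `j`. -/
def pos : Gen (Fin 6) := seq (mul 2 1) (var 3)

/-- The gate names and wires of a gate. -/
def gateX (G : Gen (Fin 6)) : Gen (Fin 6) := seq (emit .x) (seq G (emit .sep))

def gateH (G : Gen (Fin 6)) : Gen (Fin 6) := seq (emit .h) (seq G (emit .sep))

def gateCX (G H : Gen (Fin 6)) : Gen (Fin 6) :=
  seq (emit .cx) (seq (seq G (emit .sep)) (seq H (emit .sep)))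

def gateCCX (G H J : Gen (Fin 6)) : Gen (Fin 6) :=
  seq (emit .ccx) (seq (seq G (emit .sep)) (seq (seq H (emit .sep)) (seq J (emit .sep))))

theorem den_var (r : Fin 6) (e : Fin 6 → ℕ) : den (var r) e = List.replicate (e r) .one := by
  simp only [var, den]
  rw [← List.map_eq_flatMap]
  simp

/-- The outer loop overwrites the name `4`, so the inner bound must not be read from it. -/
theorem den_mul (r : Fin 6) {s : Fin 6} (hs : s ≠ 4) (e : Fin 6 → ℕ) :
    den (mul r s) e = List.replicate (e r * e s) .one := by
  simp only [mul, den, Function.update_of_ne hs]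
  have : ((List.range (e s)).flatMap fun _ => [Sym.one]) = List.replicate (e s) .one := by
    rw [← List.map_eq_flatMap]; simp
  rw [this]
  induction e r with
  | zero => simp
  | succ a ih =>
    rw [List.range_succ, List.flatMap_append, ih, Nat.succ_mul, List.replicate_add,
      List.flatMap_singleton]

theorem den_seq_ones {G H : Gen (Fin 6)} {e : Fin 6 → ℕ} {x y : ℕ}
    (hG : den G e = List.replicate x .one) (hH : den H e = List.replicate y .one) :
    den (seq G H) e = List.replicate (x + y) .one := by
  rw [den, hG, hH, List.replicate_add]

theorem den_pos (e : Fin 6 → ℕ) : den pos e = List.replicate (e 2 * e 1 + e 3) .one :=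
  den_seq_ones (den_mul 2 (by decide) e) (den_var 3 e)

theorem den_gateX {G : Gen (Fin 6)} {e : Fin 6 → ℕ} {x : ℕ}
    (hG : den G e = List.replicate x .one) : den (gateX G) e = (Op.x x).word := by
  simp [gateX, den, hG, Op.word, unary]

theorem den_gateH {G : Gen (Fin 6)} {e : Fin 6 → ℕ} {x : ℕ}
    (hG : den G e = List.replicate x .one) : den (gateH G) e = (Op.h x).word := by
  simp [gateH, den, hG, Op.word, unary]

theorem den_gateCX {G H : Gen (Fin 6)} {e : Fin 6 → ℕ} {x y : ℕ}
    (hG : den G e = List.replicate x .one) (hH : den H e = List.replicate y .one) :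
    den (gateCX G H) e = (Op.cx x y).word := by
  simp [gateCX, den, hG, hH, Op.word, unary]

theorem den_gateCCX {G H J : Gen (Fin 6)} {e : Fin 6 → ℕ} {x y z : ℕ}
    (hG : den G e = List.replicate x .one) (hH : den H e = List.replicate y .one)
    (hJ : den J e = List.replicate z .one) :
    den (gateCCX G H J) e = (Op.ccx x y z).word := by
  simp [gateCCX, den, hG, hH, hJ, Op.word, unary]

/-- `G` describes the unary number `x` as soon as the names `0` and `1` stand for `k` and `m`. -/
def IsNumber (k m : ℕ) (G : Gen (Fin 6)) (x : ℕ) : Prop :=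
  ∀ e : Fin 6 → ℕ, e 0 = k → e 1 = m → den G e = List.replicate x .one

variable {k m : ℕ}

theorem IsNumber.seq {G H : Gen (Fin 6)} {x y : ℕ} (hG : IsNumber k m G x)
    (hH : IsNumber k m H y) : IsNumber k m (seq G H) (x + y) :=
  fun e h₀ h₁ => den_seq_ones (hG e h₀ h₁) (hH e h₀ h₁)

theorem isNumber_one : IsNumber k m (emit .one) 1 := fun _ _ _ => rfl

theorem isNumber_var : IsNumber k m (var 0) k := fun e h₀ _ => by rw [den_var, h₀]

theorem isNumber_mul : IsNumber k m (mul 0 1) (k * m) := fun e h₀ h₁ => by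
  rw [den_mul 0 (by decide), h₀, h₁]

/-- The words of `prepOps`. -/
def prep (R A : Gen (Fin 6)) (b : Bool) : Gen (Fin 6) :=
  if b then loop 0 2 (loop 1 3 (seq (gateCX pos (seq A pos)) (seq (gateCX (seq A pos) pos)
    (seq (gateH pos) (gateCX pos (seq R pos))))))
  else loop 0 2 (loop 0 3 (seq (gateCX pos (seq R pos)) (gateH (seq R pos))))

theorem den_prep {R A : Gen (Fin 6)} {r a : ℕ} (hR : IsNumber k m R r) (hA : IsNumber k m A a)
    (b : Bool) {e : Fin 6 → ℕ} (h₀ : e 0 = k) (h₁ : e 1 = m) :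
    den (prep R A b) e = (prepOps k m r a b).flatMap Op.word := by
  cases b <;>
  · simp only [prep, prepOps, Bool.false_eq_true, if_false, if_true, den, List.flatMap_assoc]
    simp only [Function.update_of_ne (show (0 : Fin 6) ≠ 2 by decide),
      Function.update_of_ne (show (1 : Fin 6) ≠ 2 by decide), h₀, h₁]
    refine List.flatMap_congr fun i _ => List.flatMap_congr fun j _ => ?_
    set e' : Fin 6 → ℕ := Function.update (Function.update e 2 i) 3 j with he
    have e0 : e' 0 = k := by simpa [he] using h₀
    have e1 : e' 1 = m := by simpa [he] using h₁
    have e2 : e' 2 = i := by simp [he]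
    have e3 : e' 3 = j := by simp [he]
    have hp : den pos e' = List.replicate (i * m + j) .one := by rw [den_pos, e1, e2, e3]
    have hr := den_seq_ones (hR e' e0 e1) hp
    have ha := den_seq_ones (hA e' e0 e1) hp
    simp only [den_gateCX hp hr, den_gateH hr, den_gateCX hp ha, den_gateCX ha hp, den_gateH hp,
      List.flatMap_cons, List.flatMap_nil, List.append_nil]

/-- `2 k m` in unary. -/
def twoKM : Gen (Fin 6) := seq (mul 0 1) (mul 0 1)

/-- `3 k m` in unary. -/
def threeKM : Gen (Fin 6) := seq twoKM (mul 0 1)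

/-- `recvR k m` in unary. -/
def recvPos : Gen (Fin 6) := seq threeKM (seq (var 0) (seq (emit .one) (emit .one)))

theorem isNumber_twoKM : IsNumber k m twoKM (2 * (k * m)) := by
  rw [two_mul]; exact isNumber_mul.seq isNumber_mul

theorem isNumber_threeKM : IsNumber k m threeKM (3 * (k * m)) := by
  rw [show 3 * (k * m) = 2 * (k * m) + k * m by ring]; exact isNumber_twoKM.seq isNumber_mul

theorem isNumber_recvPos : IsNumber k m recvPos (recvR k m) := by
  rw [recvR, add_assoc]
  exact isNumber_threeKM.seq (isNumber_var.seq (isNumber_one.seq isNumber_one))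

/-- The words of `cswapOps`. -/
def cswap (G H J : Gen (Fin 6)) : Gen (Fin 6) :=
  seq (gateCX J H) (seq (gateCCX G H J) (gateCX J H))

theorem den_cswap {G H J : Gen (Fin 6)} {e : Fin 6 → ℕ} {x y z : ℕ}
    (hG : den G e = List.replicate x .one) (hH : den H e = List.replicate y .one)
    (hJ : den J e = List.replicate z .one) :
    den (cswap G H J) e = (cswapOps x y z).flatMap Op.word := by
  simp [cswap, cswapOps, den, den_gateCX hJ hH, den_gateCCX hG hH hJ]

/-- The control wire of the SWAP test with index `2`. -/
def control : Gen (Fin 6) := seq (seq recvPos twoKM) (var 2)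

/-- The words of `testOps`. -/
def test : Gen (Fin 6) :=
  seq (gateH control)
    (seq (loop 1 3 (seq (cswap control pos (seq (mul 0 1) pos))
      (cswap control (seq recvPos pos) (seq twoKM pos))))
    (seq (gateH control) (seq (gateX control)
      (gateCCX control (seq (seq threeKM (emit .one)) (var 2))
        (seq (seq threeKM (seq (emit .one) (emit .one))) (var 2))))))

theorem den_test {e : Fin 6 → ℕ} (h₀ : e 0 = k) (h₁ : e 1 = m) :
    den test e = (testOps k m (e 2)).flatMap Op.word := by
  have hc : ∀ e : Fin 6 → ℕ, e 0 = k → e 1 = m →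
      den control e = List.replicate (recvR k m + 2 * (k * m) + e 2) .one := fun e h₀ h₁ =>
    den_seq_ones ((isNumber_recvPos.seq isNumber_twoKM) e h₀ h₁) (den_var 2 e)
  have ha := den_seq_ones ((isNumber_threeKM.seq isNumber_one) e h₀ h₁) (den_var 2 e)
  have hb := den_seq_ones ((isNumber_threeKM.seq (isNumber_one.seq isNumber_one)) e h₀ h₁)
    (den_var 2 e)
  have hl : den (loop 1 3 (seq (cswap control pos (seq (mul 0 1) pos))
      (cswap control (seq recvPos pos) (seq twoKM pos)))) e =
      ((List.range m).flatMap fun j =>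
        cswapOps (recvR k m + 2 * (k * m) + e 2) (e 2 * m + j) (k * m + (e 2 * m + j)) ++
        cswapOps (recvR k m + 2 * (k * m) + e 2) (recvR k m + (e 2 * m + j))
          (2 * (k * m) + (e 2 * m + j))).flatMap Op.word := by
    rw [den, h₁, List.flatMap_assoc]
    refine List.flatMap_congr fun j _ => ?_
    set e' : Fin 6 → ℕ := Function.update e 3 j with he
    have e0 : e' 0 = k := by simpa [he] using h₀
    have e1 : e' 1 = m := by simpa [he] using h₁
    have e2 : e' 2 = e 2 := by simp [he]
    have e3 : e' 3 = j := by simp [he]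
    have hp : den pos e' = List.replicate (e 2 * m + j) .one := by rw [den_pos, e1, e2, e3]
    have hc' := hc e' e0 e1
    rw [e2] at hc'
    rw [den, den_cswap hc' hp (den_seq_ones (isNumber_mul e' e0 e1) hp),
      den_cswap hc' (den_seq_ones (isNumber_recvPos e' e0 e1) hp)
        (den_seq_ones (isNumber_twoKM e' e0 e1) hp), List.flatMap_append]
  rw [test, den, den, den, den, hl, den_gateH (hc e h₀ h₁), den_gateX (hc e h₀ h₁),
    den_gateCCX (hc e h₀ h₁) ha hb]
  simp [testOps]

/-- The words of `receiverOps`. -/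
def receiver (b : Bool) : Gen (Fin 6) :=
  seq (prep recvPos (seq recvPos (mul 0 1)) b) (seq (gateX (seq threeKM (emit .one)))
    (seq (loop 0 2 test) (gateCX (seq (seq threeKM (emit .one)) (var 0)) threeKM)))

theorem den_receiver (b : Bool) {e : Fin 6 → ℕ} (h₀ : e 0 = k) (h₁ : e 1 = m) :
    den (receiver b) e = (receiverOps k m b).flatMap Op.word := by
  have hl : den (loop 0 2 test) e = ((List.range k).flatMap (testOps k m)).flatMap Op.word := by
    rw [den, h₀, List.flatMap_assoc]
    refine List.flatMap_congr fun j _ => ?_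
    rw [den_test (k := k) (m := m) (by simpa using h₀) (by simpa using h₁)]
    simp
  rw [receiver, den, den, den, hl,
    den_prep isNumber_recvPos (isNumber_recvPos.seq isNumber_mul) b h₀ h₁,
    den_gateX ((isNumber_threeKM.seq isNumber_one) e h₀ h₁),
    den_gateCX (((isNumber_threeKM.seq isNumber_one).seq isNumber_var) e h₀ h₁)
      (isNumber_threeKM e h₀ h₁)]
  simp [receiverOps]

/-- The description of a circuit, from its number of wires and the words of its gates. -/
def circuit (W G : Gen (Fin 6)) : Gen (Fin 6) := seq (seq W (emit .sep)) G

theorem den_circuit {W G : Gen (Fin 6)} {e : Fin 6 → ℕ} {w : ℕ} {l : List Op}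
    (hW : den W e = List.replicate w .one) (hG : den G e = l.flatMap Op.word)
    (hl : ∀ o ∈ l, o.Valid w) : den (circuit W G) e = describe w (l.flatMap (Op.gates w)) := by
  rw [Op.describe_flatMap_gates hl, circuit, den, den, hW, hG, den, unary]

end Gen

theorem isUniformPolyTime_committer {n : ℕ → ℕ} (hn : PolyBounded n) (hkn : ∀ k, k ≤ n k)
    (b : Bool) : IsUniformPolyTime n (fun k => 3 * (k * n k)) fun k =>
      (prepOps k (n k) (k * n k) (2 * (k * n k)) b).flatMap (Op.gates (3 * (k * n k))) := by
  refine Gen.isUniformPolyTime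
    (Gen.circuit Gen.threeKM (Gen.prep (Gen.mul 0 1) Gen.twoKM b)) (a := 0) (b := 1) (by decide)
    -- The description does not depend on `k`, so its scoping is checked by evaluation for each bit.
    (by cases b <;> decide) hn _ fun k => ?_
  exact Gen.den_circuit (Gen.isNumber_threeKM _ (by simp) (by simp))
    (Gen.den_prep Gen.isNumber_mul Gen.isNumber_twoKM b (by simp) (by simp))
    (valid_prepOps (hkn k) b le_rfl (by omega) (by omega))

theorem isUniformPolyTime_receiver {n : ℕ → ℕ} (hn : PolyBounded n) (hkn : ∀ k, k ≤ n k)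
    (b : Bool) : IsUniformPolyTime n (fun k => recvR k (n k) + 2 * (k * n k) + k) fun k =>
      (receiverOps k (n k) b).flatMap (Op.gates (recvR k (n k) + 2 * (k * n k) + k)) := by
  refine Gen.isUniformPolyTime
    (Gen.circuit (Gen.seq (Gen.seq Gen.recvPos Gen.twoKM) (Gen.var 0)) (Gen.receiver b))
    (a := 0) (b := 1) (by decide) (by cases b <;> decide) hn _ fun k => ?_
  exact Gen.den_circuit
    (((Gen.isNumber_recvPos.seq Gen.isNumber_twoKM).seq Gen.isNumber_var) _ (by simp) (by simp))
    (Gen.den_receiver b (by simp) (by simp)) (valid_receiverOps (hkn k) b)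

/-! ### The action of the circuits -/

namespace Op

/-- The sign of a bit. -/
def sgn (b : Bool) : ℂ := if b then -1 else 1

/-- The normalisation of the Hadamard gate. -/
def isqrt : ℂ := ((√2 : ℝ) : ℂ)⁻¹

theorem isqrt_mul_self : isqrt * isqrt = 1 / 2 := by
  rw [isqrt, ← mul_inv, ← Complex.ofReal_mul, Real.mul_self_sqrt (by norm_num)]
  norm_num

theorem act_h (i : ℕ) (f : (ℕ → Bool) → ℂ) (s : ℕ → Bool) :
    (h i).act f s = isqrt * (f (Function.update s i false) +
      sgn (s i) * f (Function.update s i true)) := rfl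

/-- The CNOT copies the bit of `c` to a wire that is `0`, and the Hadamard turns the copy into a
superposition with the sign of the conjunction of the two bits. -/
theorem acts_zeroPair {c r : ℕ} (hcr : c ≠ r) {f : (ℕ → Bool) → ℂ}
    (hf : ∀ s, s r = true → f s = 0) (s : ℕ → Bool) :
    acts [.cx c r, .h r] f s =
      isqrt * sgn (s c && s r) * f (Function.update s r false) := by
  simp only [acts, act_h]
  simp only [act, Function.update_self, Function.update_idem,
    Function.update_of_ne hcr]
  have h1 : f (Function.update s r true) = 0 := hf _ (by simp)
  cases hc : s c <;> cases hr : s r <;> simp [sgn, h1, mul_comm]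

/-- Set the bits of a list of positions to `0`. -/
def clear (l : List ℕ) (s : ℕ → Bool) : ℕ → Bool := fun j => if j ∈ l then false else s j

/-- Targets are distinct and never serve as controls, so each pair still finds its target at `0` and
sees the original control bit; the signs multiply. -/
theorem acts_zeroPairs (ps : List (ℕ × ℕ)) (f : (ℕ → Bool) → ℂ)
    (hf : ∀ p ∈ ps, ∀ s, s p.2 = true → f s = 0) (hn : (ps.map Prod.snd).Nodup)
    (hd : ∀ p ∈ ps, p.1 ∉ ps.map Prod.snd) (s : ℕ → Bool) :
    acts (ps.flatMap fun p => [.cx p.1 p.2, .h p.2]) f s =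
      (ps.map fun p => isqrt * sgn (s p.1 && s p.2)).prod * f (clear (ps.map Prod.snd) s) := by
  induction ps generalizing f with
  | nil => simp [acts, show clear [] s = s from funext fun j => by simp [clear]]
  | cons p ps ih =>
    rw [List.map_cons, List.nodup_cons] at hn
    have hp : p.1 ≠ p.2 := fun h => hd p List.mem_cons_self (by simp [h])
    have hf' : ∀ s, acts [.cx p.1 p.2, .h p.2] f s =
      isqrt * sgn (s p.1 && s p.2) * f (Function.update s p.2 false) :=
      acts_zeroPair hp (hf p List.mem_cons_self)
    have hd' : ∀ q ∈ p :: ps, q.1 ∉ ps.map Prod.snd := fun q hq h =>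
      hd q hq (by rw [List.map_cons]; exact List.mem_cons_of_mem _ h)
    rw [List.flatMap_cons, acts_append, ih]
    · rw [hf', List.map_cons, List.prod_cons]
      have e1 : clear (ps.map Prod.snd) s p.1 = s p.1 := if_neg (hd' p List.mem_cons_self)
      have e2 : clear (ps.map Prod.snd) s p.2 = s p.2 := if_neg hn.1
      have e3 : Function.update (clear (ps.map Prod.snd) s) p.2 false =
          clear ((p :: ps).map Prod.snd) s := by
        funext j
        by_cases hj : j = p.2
        · subst hj; simp [clear]
        · simp only [Function.update_of_ne hj, clear, List.map_cons, List.mem_cons, hj, false_or]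
      rw [e1, e2, e3]
      ring
    · intro q hq s hs
      rw [hf', hf q (List.mem_cons_of_mem _ hq), mul_zero]
      rw [Function.update_of_ne, hs]
      intro h
      exact hn.1 (h ▸ List.mem_map_of_mem hq)
    · exact hn.2
    · exact fun q hq => hd' q (List.mem_cons_of_mem _ hq)

/-- After the two CNOTs the wire `q` is surely `0`, so only this branch of the Hadamard survives
(`key`). The last CNOT correlates `q` with `r`, while the old content of `q` now sits in `a`. -/
theorem acts_onePair {q r a : ℕ} (hqr : q ≠ r) (hqa : q ≠ a) (hra : r ≠ a)
    {f : (ℕ → Bool) → ℂ} (hfr : ∀ s, s r = true → f s = 0) (hfa : ∀ s, s a = true → f s = 0)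
    (s : ℕ → Bool) :
    acts [.cx q a, .cx a q, .h q, .cx q r] f s = isqrt * (if s q = s r then 1 else 0) *
      f (Function.update (Function.update (Function.update s q (s a)) r false) a false) := by
  have key : ∀ b, f (Function.update (Function.update (Function.update
      (Function.update s r (xor (s r) (s q))) q b) q (xor b (s a))) a (xor (s a) (xor b (s a)))) =
      if b = false ∧ s q = s r then
        f (Function.update (Function.update (Function.update s q (s a)) r false) a false) else 0 := by
    intro b
    by_cases hb : b = false
    · subst hb
      by_cases h : s q = s r
      · rw [if_pos ⟨rfl, h⟩]
        congr 1
        funext j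
        simp only [Function.update_apply]
        by_cases h1 : j = a <;> by_cases h2 : j = q <;> by_cases h3 : j = r <;> simp_all
      · rw [if_neg (by tauto)]
        refine hfr _ ?_
        rw [Function.update_of_ne hra, Function.update_of_ne hqr.symm,
          Function.update_of_ne hqr.symm, Function.update_self]
        revert h
        cases s q <;> cases s r <;> simp
    · rw [if_neg (by tauto)]
      refine hfa _ ?_
      rw [Function.update_self]
      revert hb
      cases s a <;> cases b <;> simp
  simp only [acts]
  simp only [act, Function.update_self,
    Function.update_of_ne hqa.symm, Function.update_of_ne hra.symm]
  rw [key, key]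
  by_cases h : s q = s r <;> simp [h, isqrt]

/-- Move the bits at the positions `a + q`, for `q` in a list, to the positions `q`, and set those at
the positions `r + q` and `a + q` to `0`. -/
def move (r a : ℕ) (l : List ℕ) (s : ℕ → Bool) : ℕ → Bool := fun j =>
  if j ∈ l then s (a + j) else
    if (r ≤ j ∧ j - r ∈ l) ∨ (a ≤ j ∧ j - a ∈ l) then false else s j

/-- `hr` and `ha` keep the three registers of length `M` apart, so the gates for different `q` touch
disjoint wires. -/
theorem acts_onePairs {M r a : ℕ} (hr : M ≤ r) (ha : r + M ≤ a) (qs : List ℕ)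
    (hM : ∀ q ∈ qs, q < M) (hn : qs.Nodup) (f : (ℕ → Bool) → ℂ)
    (hfr : ∀ q ∈ qs, ∀ s, s (r + q) = true → f s = 0)
    (hfa : ∀ q ∈ qs, ∀ s, s (a + q) = true → f s = 0) (s : ℕ → Bool) :
    acts (qs.flatMap fun q => [.cx q (a + q), .cx (a + q) q, .h q, .cx q (r + q)]) f s =
      (qs.map fun q => isqrt * if s q = s (r + q) then 1 else 0).prod * f (move r a qs s) := by
  induction qs generalizing f with
  | nil => simp [acts, show move r a [] s = s from funext fun j => by simp [move]]
  | cons q qs ih =>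
    rw [List.nodup_cons] at hn
    have hqM : q < M := hM q List.mem_cons_self
    have hM' : ∀ x ∈ qs, x < M := fun x hx => hM x (List.mem_cons_of_mem _ hx)
    have hf' := acts_onePair (q := q) (r := r + q) (a := a + q) (by omega) (by omega) (by omega)
      (hfr q List.mem_cons_self) (hfa q List.mem_cons_self)
    have hne : ∀ x ∈ qs, x ≠ q := fun x hx h => hn.1 (h ▸ hx)
    rw [List.flatMap_cons, acts_append, ih hM' hn.2]
    · rw [hf', List.map_cons, List.prod_cons]
      have e1 : move r a qs s q = s q := by
        rw [move, if_neg hn.1, if_neg (by omega)]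
      have e2 : move r a qs s (r + q) = s (r + q) := by
        rw [move, if_neg (fun h => by have := hM' _ h; omega), if_neg]
        rintro (⟨-, h⟩ | ⟨h, -⟩)
        · exact hn.1 (by simpa using h)
        · omega
      have e3 : move r a qs s (a + q) = s (a + q) := by
        rw [move, if_neg (fun h => by have := hM' _ h; omega), if_neg]
        rintro (⟨-, h⟩ | ⟨-, h⟩)
        · have := hM' _ h; omega
        · exact hn.1 (by simpa using h)
      have e4 : Function.update (Function.update (Function.update (move r a qs s) q (s (a + q)))
          (r + q) false) (a + q) false = move r a (q :: qs) s := by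
        funext j
        simp only [Function.update_apply, move, List.mem_cons]
        by_cases h1 : j = q
        · subst h1
          rw [if_neg (by omega), if_neg (by omega), if_pos rfl, if_pos (Or.inl rfl)]
        by_cases h2 : j = r + q
        · subst h2
          rw [if_neg (by omega), if_pos rfl, if_neg, if_pos (by simp)]
          rintro (h | h)
          · omega
          · have := hM' _ h; omega
        by_cases h3 : j = a + q
        · subst h3
          rw [if_pos rfl, if_neg, if_pos (by simp)]
          rintro (h | h)
          · omega
          · have := hM' _ h; omega
        rw [if_neg h3, if_neg h2, if_neg h1]
        have i1 : (r ≤ j ∧ (j - r = q ∨ j - r ∈ qs)) ↔ (r ≤ j ∧ j - r ∈ qs) := by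
          constructor
          · rintro ⟨h, h' | h'⟩
            · omega
            · exact ⟨h, h'⟩
          · exact fun h => ⟨h.1, Or.inr h.2⟩
        have i2 : (a ≤ j ∧ (j - a = q ∨ j - a ∈ qs)) ↔ (a ≤ j ∧ j - a ∈ qs) := by
          constructor
          · rintro ⟨h, h' | h'⟩
            · omega
            · exact ⟨h, h'⟩
          · exact fun h => ⟨h.1, Or.inr h.2⟩
        simp only [h1, false_or, i1, i2]
      rw [e1, e2, e3, e4]
      ring
    · intro x hx s hs
      have := hM' x hx
      have := hne x hx
      rw [hf', hfr x (List.mem_cons_of_mem _ hx), mul_zero]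
      rw [Function.update_of_ne (by omega), Function.update_of_ne (by omega),
        Function.update_of_ne (by omega), hs]
    · intro x hx s hs
      have := hM' x hx
      have := hne x hx
      rw [hf', hfa x (List.mem_cons_of_mem _ hx), mul_zero]
      rw [Function.update_of_ne (by omega), Function.update_of_ne (by omega),
        Function.update_of_ne (by omega), hs]

/-- This is the swap by three CNOTs with a control on the middle one only: if that one does not
fire, the outer two cancel. -/
theorem acts_cswap {c i j : ℕ} (hci : c ≠ i) (hcj : c ≠ j) (hij : i ≠ j) (f : (ℕ → Bool) → ℂ)
    (s : ℕ → Bool) :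
    acts (cswapOps c i j) f s =
      f (if s c then Function.update (Function.update s i (s j)) j (s i) else s) := by
  simp only [cswapOps, acts, act, Function.update_self, Function.update_of_ne hij.symm,
    Function.update_of_ne hij, Function.update_of_ne hci]
  congr 1
  cases hc : s c
  · funext x
    simp only [Function.update_apply]
    by_cases h1 : x = i <;> by_cases h2 : x = j <;> simp_all
  · funext x
    simp only [Function.update_apply]
    by_cases h1 : x = i <;> by_cases h2 : x = j <;> simp_all
    cases s i <;> cases s j <;> rfl

end Op

/-! ### Registers and blocks -/

/-- The `b` bits of a bit string that start at position `off`. -/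
def bitsAt (s : ℕ → Bool) (off b : ℕ) : Qubits b := fun i => s (off + i)

theorem window_ofBits {w off b : ℕ} (h : off + b ≤ w) (s : ℕ → Bool) :
    window (ofBits w s) off b = bitsAt s off b := by
  funext i
  have := i.isLt
  simp only [window, bitsAt, ofBits]
  rw [dif_pos (by omega)]

theorem window_bitsAt {w o off b : ℕ} (h : off + b ≤ w) (s : ℕ → Bool) :
    window (bitsAt s o w) off b = bitsAt s (o + off) b := by
  funext i
  have := i.isLt
  simp only [window, bitsAt]
  rw [dif_pos (by omega), add_assoc]

theorem bitsAt_congr {s t : ℕ → Bool} {o o' b : ℕ} (h : ∀ i < b, s (o + i) = t (o' + i)) :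
    bitsAt s o b = bitsAt t o' b := funext fun i => h i i.isLt

theorem bitsAt_eq_iff {s t : ℕ → Bool} {o o' b : ℕ} :
    bitsAt s o b = bitsAt t o' b ↔ ∀ i < b, s (o + i) = t (o' + i) :=
  ⟨fun h i hi => congrFun h ⟨i, hi⟩, bitsAt_congr⟩

theorem block_bound {k m : ℕ} (i : Fin k) : (i : ℕ) * m + m ≤ k * m := by
  calc (i : ℕ) * m + m = (i + 1) * m := by ring
    _ ≤ k * m := Nat.mul_le_mul_right _ i.isLt

theorem block_bitsAt {k m : ℕ} (i : Fin k) (s : ℕ → Bool) (c r : ℕ) :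
    block i (bitsAt s c (k * m), bitsAt s r (k * m)) =
      (bitsAt s (c + i * m) m, bitsAt s (r + i * m) m) := by
  rw [block, window_bitsAt (block_bound i), window_bitsAt (block_bound i)]

/-- The summands have distinct labels s0…0 in the second register, so at most one s contributes: the
prefix of `a.2`, and only if the rest of `a.2` is zero. -/
theorem psiZero_apply {k m : ℕ} (hkm : k ≤ m) (θ : Ket m) (a : Qubits m × Qubits m) :
    psiZero k θ a = ((√(2 ^ k) : ℝ) : ℂ)⁻¹ *
      ((if ∀ j : Fin m, k ≤ (j : ℕ) → a.2 j = false then 1 else 0) *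
        ((∏ j : Fin k, Op.sgn (window a.1 0 k j && window a.2 0 k j)) * θ a.1)) := by
  rw [psiZero]
  congr 1
  have hz : ∀ s : Qubits k, (pauliZ s m *ᵥ θ.ofLp) a.1 =
      (∏ j : Fin k, Op.sgn (window a.1 0 k j && s j)) * θ a.1 := fun s => by
    rw [pauliZ, Matrix.mulVec_diagonal]
    simp only [Op.sgn, Bool.and_comm]
  have hw : ∀ s : Qubits k, window (window s 0 m) 0 k = s := fun s => by
    funext j
    have := j.isLt
    simp only [window]
    rw [dif_pos (by omega), dif_pos (by omega)]
    congr 1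
    ext
    simp
  by_cases ht : ∀ j : Fin m, k ≤ (j : ℕ) → a.2 j = false
  · have ha : window (window a.2 0 k) 0 m = a.2 := by
      funext j
      simp only [window]
      split_ifs with h1 h2
      · exact congrArg a.2 (Fin.ext (by simp))
      · exact absurd j.isLt (by omega)
      · rw [ht j (by omega)]
    rw [if_pos ht, one_mul, Finset.sum_eq_single (window a.2 0 k)]
    · rw [hz, ha, Pi.single_eq_same, mul_one]
    · intro s _ hs
      rw [Pi.single_eq_of_ne, mul_zero]
      intro h
      exact hs (by rw [h, hw])
    · simp
  · rw [if_neg ht, zero_mul]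
    refine Finset.sum_eq_zero fun s _ => ?_
    rw [Pi.single_eq_of_ne, mul_zero]
    intro h
    refine ht fun j hj => ?_
    rw [h, window, dif_neg (by omega)]

theorem psiOne_apply {m : ℕ} (a : Qubits m × Qubits m) :
    psiOne m a = ((√(2 ^ m) : ℝ) : ℂ)⁻¹ * if a.1 = a.2 then 1 else 0 := by
  rw [psiOne]
  congr 1
  simp [Pi.single_apply]

theorem inv_sqrt_two_pow (k : ℕ) : ((√(2 ^ k) : ℝ) : ℂ)⁻¹ = Op.isqrt ^ k := by
  rw [Op.isqrt, inv_pow, ← Complex.ofReal_pow]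
  congr 2
  rw [Real.sqrt_eq_iff_mul_self_eq (by positivity) (by positivity), ← mul_pow,
    Real.mul_self_sqrt (by norm_num)]

/-- The amplitudes of the auxiliary register after the preparation of `|Ψ_b⟩`. -/
def junk {k m : ℕ} (θ : Ket m) (b : Bool) (x : Qubits (k * m)) : ℂ :=
  if b then ∏ i : Fin k, θ (window x ((i : ℕ) * m) m) else if x = fun _ => false then 1 else 0

theorem flatMap_range_map_range (k m : ℕ) :
    ((List.range k).flatMap fun i => (List.range m).map fun j => i * m + j) =
      List.range (k * m) := by
  induction k with
  | zero => simp
  | succ k ih => rw [List.range_succ, List.flatMap_append, ih, List.flatMap_singleton, Nat.succ_mul,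
      List.range_add]

theorem prod_map_flatMap_range {α : Type} (k : ℕ) (F : ℕ → List α) (g : α → ℂ) :
    (((List.range k).flatMap F).map g).prod = ∏ i ∈ Finset.range k, ((F i).map g).prod := by
  induction k with
  | zero => simp
  | succ k ih => simp [List.range_succ, ih, Finset.prod_range_succ]

theorem prod_map_range (k : ℕ) (g : ℕ → ℂ) :
    ((List.range k).map g).prod = ∏ i ∈ Finset.range k, g i := by
  induction k with
  | zero => simp
  | succ k ih => simp [List.range_succ, ih, Finset.prod_range_succ]

theorem prod_ite_one_zero {α : Type} (s : Finset α) (p : α → Prop) [DecidablePred p]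
    [Decidable (∀ i ∈ s, p i)] :
    (∏ i ∈ s, if p i then (1 : ℂ) else 0) = if ∀ i ∈ s, p i then 1 else 0 := by
  rw [Finset.prod_ite_zero]; simp

/-- The amplitudes at the start of the preparation of `|Ψ_b⟩`. -/
def prepInput {m : ℕ} (k r a : ℕ) (θ : Ket m) (G : (ℕ → Bool) → ℂ) (s : ℕ → Bool) : ℂ :=
  (∏ i : Fin k, θ (bitsAt s (i * m) m)) * (if ∀ q < k * m, s (r + q) = false then 1 else 0) *
    (if ∀ q < k * m, s (a + q) = false then 1 else 0) * G s

/-- `G` stands for the amplitudes of all other wires; `hG` says that it ignores the three registers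
in use, so it passes through unchanged. -/
theorem acts_prepOps_true {k m r a : ℕ} (hr : k * m ≤ r) (ha : r + k * m ≤ a) (θ : Ket m)
    (G : (ℕ → Bool) → ℂ)
    (hG : ∀ s t : ℕ → Bool, (∀ j, ¬ j < k * m → ¬ (r ≤ j ∧ j < r + k * m) →
      ¬ (a ≤ j ∧ j < a + k * m) → s j = t j) → G s = G t) (s : ℕ → Bool) :
    Op.acts (prepOps k m r a true) (prepInput k r a θ G) s =
      bigPsi k k θ true (bitsAt s 0 (k * m), bitsAt s r (k * m)) *
        junk θ true (bitsAt s a (k * m)) * G s := by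
  have hops : prepOps k m r a true = (List.range (k * m)).flatMap fun q =>
      [.cx q (a + q), .cx (a + q) q, .h q, .cx q (r + q)] := by
    rw [← flatMap_range_map_range, List.flatMap_assoc]
    simp only [List.flatMap_map]
    rfl
  rw [hops, Op.acts_onePairs hr ha _ (by simp) List.nodup_range]
  · have hm1 : ∀ j < k * m, Op.move r a (List.range (k * m)) s j = s (a + j) := fun j hj => by
      rw [Op.move, if_pos (by simpa using hj)]
    have hm2 : ∀ j < k * m, Op.move r a (List.range (k * m)) s (r + j) = false := fun j hj => by
      rw [Op.move, if_neg (by simp; omega), if_pos (by simp; omega)]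
    have hm3 : ∀ j < k * m, Op.move r a (List.range (k * m)) s (a + j) = false := fun j hj => by
      rw [Op.move, if_neg (by simp; omega), if_pos (by simp; omega)]
    rw [prepInput, if_pos hm2, if_pos hm3, mul_one, mul_one,
      hG (Op.move r a (List.range (k * m)) s) s]
    · rw [prod_map_range, Finset.prod_mul_distrib, Finset.prod_const, Finset.card_range,
        prod_ite_one_zero, bigPsi]
      simp only [psi, if_true, psiOne_apply, block_bitsAt, bitsAt_eq_iff]
      rw [Finset.prod_mul_distrib, prod_ite_one_zero, inv_sqrt_two_pow, Finset.prod_const,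
        Finset.card_univ, Fintype.card_fin, ← pow_mul, mul_comm m k, junk, if_pos rfl]
      have h1 : ∀ i : Fin k, bitsAt (Op.move r a (List.range (k * m)) s) (i * m) m =
          window (bitsAt s a (k * m)) (i * m) m := fun i => by
        rw [window_bitsAt (block_bound i)]
        refine bitsAt_congr fun j hj => ?_
        rw [hm1 _ (mul_add_lt_mul i.isLt hj), add_assoc]
      simp only [h1]
      have h2 : (∀ i ∈ Finset.range (k * m), s i = s (r + i)) ↔ ∀ i ∈ (Finset.univ : Finset (Fin k)),
          ∀ j < m, s (0 + i * m + j) = s (r + i * m + j) := by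
        refine ⟨fun h i _ j hj => ?_, fun h q hq => ?_⟩
        · rw [zero_add, add_assoc]
          exact h _ (by simpa using mul_add_lt_mul i.isLt hj)
        · rw [Finset.mem_range] at hq
          have hm : 0 < m := Nat.pos_of_ne_zero fun h => by subst h; simp at hq
          have := h ⟨q / m, Nat.div_lt_of_lt_mul (by rwa [mul_comm])⟩ (Finset.mem_univ _) (q % m)
            (Nat.mod_lt _ hm)
          rw [zero_add, add_assoc] at this
          simpa only [Nat.div_add_mod'] using this
      simp only [h2]
      ring
    · intro j h1 h2 h3
      rw [Op.move, if_neg (by simpa using h1), if_neg (by simp; omega)]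
  · intro q hq s hs
    rw [prepInput, if_neg (fun h => ?_)]
    · simp
    · rw [h q (by simpa using hq)] at hs; simp at hs
  · intro q hq s hs
    rw [prepInput, mul_assoc, mul_comm, if_neg (fun h => ?_)]
    · simp
    · rw [h q (by simpa using hq)] at hs; simp at hs

theorem acts_prepOps_false {k m r a : ℕ} (hkm : k ≤ m) (hr : k * m ≤ r) (ha : r + k * m ≤ a)
    (θ : Ket m) (G : (ℕ → Bool) → ℂ)
    (hG : ∀ s t : ℕ → Bool, (∀ j, ¬ j < k * m → ¬ (r ≤ j ∧ j < r + k * m) →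
      ¬ (a ≤ j ∧ j < a + k * m) → s j = t j) → G s = G t) (s : ℕ → Bool) :
    Op.acts (prepOps k m r a false) (prepInput k r a θ G) s =
      bigPsi k k θ false (bitsAt s 0 (k * m), bitsAt s r (k * m)) *
        junk θ false (bitsAt s a (k * m)) * G s := by
  set ps : List (ℕ × ℕ) := (List.range k).flatMap fun i => (List.range k).map fun j =>
    (i * m + j, r + (i * m + j)) with hps
  have hops : prepOps k m r a false = ps.flatMap fun p => [.cx p.1 p.2, .h p.2] := by
    rw [hps, List.flatMap_assoc]
    simp only [List.flatMap_map]
    rfl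
  have hmem : ∀ p ∈ ps, ∃ q < k * m, p = (q, r + q) := by
    intro p hp
    simp only [hps, List.mem_flatMap, List.mem_range, List.mem_map] at hp
    obtain ⟨i, hi, j, hj, rfl⟩ := hp
    exact ⟨i * m + j, mul_add_lt_mul hi (by omega), rfl⟩
  -- The wires of R that are not targets keep their initial `0`; this yields the support condition
  -- of `psiZero_apply`.
  have hmem2 : ∀ i < k, ∀ j < m, r + (i * m + j) ∈ ps.map Prod.snd ↔ j < k := by
    intro i hi j hj
    simp only [hps, List.mem_flatMap, List.mem_range, List.mem_map, Prod.exists]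
    constructor
    · rintro ⟨x, y, ⟨i', hi', j', hj', h1⟩, h2⟩
      simp only [Prod.mk.injEq] at h1
      have h3 : i' * m + j' = i * m + j := by omega
      have h4 : j' < m := by omega
      have : (i' * m + j') % m = (i * m + j) % m := by rw [h3]
      rw [Nat.mul_add_mod_of_lt h4, Nat.mul_add_mod_of_lt hj] at this
      omega
    · exact fun hjk => ⟨_, _, ⟨i, hi, j, hjk, rfl⟩, rfl⟩
  have hsnd : ∀ x ∈ ps.map Prod.snd, ∃ q < k * m, x = r + q := by
    intro x hx
    obtain ⟨p, hp, rfl⟩ := List.mem_map.1 hx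
    obtain ⟨q, hq, rfl⟩ := hmem p hp
    exact ⟨q, hq, rfl⟩
  have hnd : (ps.map Prod.snd).Nodup := by
    rw [hps, List.map_flatMap, List.nodup_flatMap]
    constructor
    · intro i _
      rw [List.map_map]
      exact List.nodup_range.map fun x y h => by simpa using h
    · refine List.pairwise_lt_range.imp fun {i i'} hii' => ?_
      rw [Function.onFun, List.disjoint_left]
      intro x hx hx'
      simp only [List.map_map, List.mem_map, List.mem_range, Function.comp] at hx hx'
      obtain ⟨j, hj, rfl⟩ := hx
      obtain ⟨j', hj', h⟩ := hx'
      have h1 : (i + 1) * m ≤ i' * m := Nat.mul_le_mul_right _ hii'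
      rw [Nat.succ_mul] at h1
      omega
  rw [hops, Op.acts_zeroPairs ps _ _ hnd]
  · have hc : ∀ j, (∀ q < k * m, j ≠ r + q) → Op.clear (ps.map Prod.snd) s j = s j := fun j hj => by
      rw [Op.clear, if_neg]
      intro h
      obtain ⟨q, hq, rfl⟩ := hsnd j h
      exact hj q hq rfl
    rw [prepInput, hG (Op.clear (ps.map Prod.snd) s) s fun j h1 h2 h3 => hc j fun q hq => by omega]
    have h1 : ∀ i : Fin k, bitsAt (Op.clear (ps.map Prod.snd) s) (i * m) m =
        bitsAt s (0 + i * m) m := fun i => bitsAt_congr fun j hj => by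
      rw [zero_add]
      have := mul_add_lt_mul i.isLt hj
      exact hc _ fun q hq => by omega
    have h2 : (∀ q < k * m, Op.clear (ps.map Prod.snd) s (a + q) = false) ↔
        bitsAt s a (k * m) = fun _ => false := by
      rw [show (fun _ => false : Qubits (k * m)) = bitsAt (fun _ => false) 0 (k * m) from rfl,
        bitsAt_eq_iff]
      refine forall₂_congr fun q hq => ?_
      rw [hc _ fun q' hq' => by omega]
    have h3 : (∀ q < k * m, Op.clear (ps.map Prod.snd) s (r + q) = false) ↔
        ∀ i ∈ (Finset.univ : Finset (Fin k)), ∀ j : Fin m, k ≤ (j : ℕ) →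
          bitsAt s (r + i * m) m j = false := by
      constructor
      · intro h i _ j hj
        have := h _ (mul_add_lt_mul i.isLt j.isLt)
        rw [Op.clear, if_neg (by rw [hmem2 _ i.isLt _ j.isLt]; omega)] at this
        rw [bitsAt, add_assoc, this]
      · intro h q hq
        have hm : 0 < m := Nat.pos_of_ne_zero fun h => by subst h; simp at hq
        have hi : q / m < k := Nat.div_lt_of_lt_mul (by rwa [mul_comm])
        have hj : q % m < m := Nat.mod_lt _ hm
        by_cases hjk : q % m < k
        · rw [Op.clear, if_pos]
          have := (hmem2 _ hi _ hj).2 hjk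
          rwa [Nat.div_add_mod'] at this
        · have h4 := h ⟨q / m, hi⟩ (Finset.mem_univ _) ⟨q % m, hj⟩ (by simp only; omega)
          simp only [bitsAt, add_assoc, Nat.div_add_mod'] at h4
          rw [Op.clear, if_neg, h4]
          have := (hmem2 _ hi _ hj).not.2 hjk
          rwa [Nat.div_add_mod'] at this
    simp only [h1, h2, h3]
    rw [hps, prod_map_flatMap_range, bigPsi, Finset.prod_range]
    simp only [List.map_map, prod_map_range, Function.comp_def, psi, Bool.false_eq_true, if_false,
      psiZero_apply hkm, block_bitsAt, inv_sqrt_two_pow, junk]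
    have h5 : ∀ i : Fin k, (∏ j ∈ Finset.range k, Op.isqrt *
        Op.sgn (s (i * m + j) && s (r + (i * m + j)))) = Op.isqrt ^ k *
        ∏ j : Fin k, Op.sgn (window (bitsAt s (0 + i * m) m) 0 k j &&
          window (bitsAt s (r + i * m) m) 0 k j) := fun i => by
      rw [Finset.prod_mul_distrib, Finset.prod_const, Finset.card_range, Finset.prod_range,
        window_bitsAt (by omega), window_bitsAt (by omega)]
      simp only [bitsAt, zero_add, add_zero, add_assoc]
    simp only [h5]
    rw [Finset.prod_mul_distrib, Finset.prod_mul_distrib, Finset.prod_mul_distrib,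
      Finset.prod_mul_distrib, prod_ite_one_zero]
    ring
  · intro p hp h
    obtain ⟨q, hq, rfl⟩ := hmem p hp
    obtain ⟨q', hq', h⟩ := hsnd _ h
    simp only at h
    omega
  · intro p hp s hs
    obtain ⟨q, hq, rfl⟩ := hmem p hp
    rw [prepInput, if_neg (fun h => ?_)]
    · simp
    · rw [h q hq] at hs; simp at hs

theorem acts_prepOps {k m r a : ℕ} (hkm : k ≤ m) (hr : k * m ≤ r) (ha : r + k * m ≤ a)
    (θ : Ket m) (b : Bool) (G : (ℕ → Bool) → ℂ)
    (hG : ∀ s t : ℕ → Bool, (∀ j, ¬ j < k * m → ¬ (r ≤ j ∧ j < r + k * m) →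
      ¬ (a ≤ j ∧ j < a + k * m) → s j = t j) → G s = G t) (s : ℕ → Bool) :
    Op.acts (prepOps k m r a b) (prepInput k r a θ G) s =
      bigPsi k k θ b (bitsAt s 0 (k * m), bitsAt s r (k * m)) *
        junk θ b (bitsAt s a (k * m)) * G s := by
  cases b
  · exact acts_prepOps_false hkm hr ha θ G hG s
  · exact acts_prepOps_true hr ha θ G hG s

/-! ### The action of the SWAP tests -/

/-- The wire with which a wire of the registers `C'`, `C`, `R`, `R'` of the receiver is swapped. -/
def partner (k m j : ℕ) : ℕ :=
  if j < k * m then k * m + j else if j < 2 * (k * m) then j - k * m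
  else if j < 3 * (k * m) then recvR k m + (j - 2 * (k * m))
  else if recvR k m ≤ j ∧ j < recvR k m + k * m then 2 * (k * m) + (j - recvR k m) else j

/-- The index of the block of a wire of `C'`, `C`, `R`, `R'`; other wires get the index `k`. -/
def blockIndex (k m j : ℕ) : ℕ :=
  if j < k * m then j / m else if j < 2 * (k * m) then (j - k * m) / m
  else if j < 3 * (k * m) then (j - 2 * (k * m)) / m
  else if recvR k m ≤ j ∧ j < recvR k m + k * m then (j - recvR k m) / m else k

theorem partner_partner (k m j : ℕ) : partner k m (partner k m j) = j := by
  unfold partner recvR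
  split_ifs <;> omega

theorem blockIndex_partner (k m j : ℕ) : blockIndex k m (partner k m j) = blockIndex k m j := by
  unfold partner blockIndex recvR
  generalize k * m = M
  have h0 : ∀ a b, a = b → a / m = b / m := fun a b h => by rw [h]
  split_ifs <;> first | rfl | omega | (apply h0; omega)

/-- Swap the blocks with indices in `S` of the registers `C`, `R` with those of `C'`, `R'`. -/
def swapBits (k m : ℕ) (S : Finset ℕ) (s : ℕ → Bool) : ℕ → Bool := fun j =>
  if blockIndex k m j ∈ S then s (partner k m j) else s j

theorem swapBits_empty (k m : ℕ) (s : ℕ → Bool) : swapBits k m ∅ s = s := by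
  funext j; simp [swapBits]

theorem swapBits_swapBits_singleton {k m i : ℕ} {S : Finset ℕ} (hi : i ∉ S) (s : ℕ → Bool) :
    swapBits k m S (swapBits k m {i} s) = swapBits k m (insert i S) s := by
  funext j
  simp only [swapBits, blockIndex_partner, partner_partner, Finset.mem_singleton, Finset.mem_insert]
  by_cases h1 : blockIndex k m j ∈ S
  · have h2 : blockIndex k m j ≠ i := fun h => hi (h ▸ h1)
    simp [h1, h2]
  · simp [h1]

theorem blockIndex_of_le {k m j : ℕ} (hj : 3 * (k * m) ≤ j) (hj' : j < recvR k m ∨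
    recvR k m + k * m ≤ j) : blockIndex k m j = k := by
  unfold blockIndex recvR at *
  rw [if_neg (by omega), if_neg (by omega), if_neg (by omega), if_neg (by omega)]

theorem swapBits_of_le {k m : ℕ} {S : Finset ℕ} (hS : S ⊆ Finset.range k) (s : ℕ → Bool) {j : ℕ}
    (hj : 3 * (k * m) ≤ j) (hj' : j < recvR k m ∨ recvR k m + k * m ≤ j) :
    swapBits k m S s j = s j := by
  rw [swapBits, blockIndex_of_le hj hj', if_neg]
  intro h
  simpa using hS h

theorem partner_of_le {k m j : ℕ} (hj : 3 * (k * m) ≤ j) (hj' : j < recvR k m ∨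
    recvR k m + k * m ≤ j) : partner k m j = j := by
  unfold partner recvR at *
  rw [if_neg (by omega), if_neg (by omega), if_neg (by omega), if_neg (by omega)]

theorem div_eq_iff_mem {m i j : ℕ} (hm : 0 < m) : j / m = i ↔ i * m ≤ j ∧ j < i * m + m := by
  rw [Nat.div_eq_iff hm]
  omega

theorem blockIndex_eq_iff {k m i j : ℕ} (hm : 0 < m) (hi : i < k) : blockIndex k m j = i ↔
    (i * m ≤ j ∧ j < i * m + m) ∨ (k * m + i * m ≤ j ∧ j < k * m + i * m + m) ∨
      (2 * (k * m) + i * m ≤ j ∧ j < 2 * (k * m) + i * m + m) ∨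
      (recvR k m + i * m ≤ j ∧ j < recvR k m + i * m + m) := by
  have hb : i * m + m ≤ k * m := block_bound ⟨i, hi⟩
  unfold blockIndex recvR
  split_ifs
  · rw [div_eq_iff_mem hm]; omega
  · rw [div_eq_iff_mem hm]; omega
  · rw [div_eq_iff_mem hm]; omega
  · rw [div_eq_iff_mem hm]; omega
  · omega

/-- Induction on the number `m'` of wires of the block that are swapped. The last pair of swaps
concerns four wires, which are checked one by one; for any other wire the partner is not among these
four either, since `partner` is an involution. -/
theorem acts_cswaps {k m i c : ℕ} (hi : i < k) (hc : recvR k m + k * m ≤ c)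
    (f : (ℕ → Bool) → ℂ) (m' : ℕ) (hm' : m' ≤ m) (s : ℕ → Bool) :
    Op.acts ((List.range m').flatMap fun j =>
      cswapOps c (i * m + j) (k * m + (i * m + j)) ++
      cswapOps c (recvR k m + (i * m + j)) (2 * (k * m) + (i * m + j))) f s =
    f (fun j => if s c ∧ ((i * m ≤ j ∧ j < i * m + m') ∨
        (k * m + i * m ≤ j ∧ j < k * m + i * m + m') ∨
        (2 * (k * m) + i * m ≤ j ∧ j < 2 * (k * m) + i * m + m') ∨
        (recvR k m + i * m ≤ j ∧ j < recvR k m + i * m + m')) then s (partner k m j) else s j) := by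
  have hb : i * m + m ≤ k * m := block_bound ⟨i, hi⟩
  have hD : 3 * (k * m) + 2 ≤ recvR k m := by unfold recvR; omega
  induction m' generalizing s with
  | zero =>
    simp only [List.range_zero, List.flatMap_nil, Op.acts]
    congr 1
    funext j
    rw [if_neg (by omega)]
  | succ m' ih =>
    rw [List.range_succ, List.flatMap_append, Op.acts_append, List.flatMap_singleton,
      Op.acts_append, Op.acts_cswap (by omega) (by omega) (by omega)]
    set s₁ := if s c then Function.update (Function.update s (recvR k m + (i * m + m'))
      (s (2 * (k * m) + (i * m + m')))) (2 * (k * m) + (i * m + m'))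
      (s (recvR k m + (i * m + m'))) else s with hs₁
    have h1 : s₁ c = s c := by
      rw [hs₁]
      split_ifs
      · rw [Function.update_of_ne (by omega), Function.update_of_ne (by omega)]
      · rfl
    rw [Op.acts_cswap (by omega) (by omega) (by omega), ih (by omega)]
    congr 1
    cases hsc : s c
    · have e : s₁ = s := by rw [hs₁, if_neg (by simp [hsc])]
      simp only [e, hsc, Bool.false_eq_true, if_false, false_and]
    · rw [h1, hsc, if_pos rfl, Function.update_of_ne (by omega), Function.update_of_ne (by omega), h1,
        hsc]
      rw [hsc, if_pos rfl] at hs₁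
      funext j
      simp only [true_and, hs₁]
      by_cases hA : j = i * m + m'
      · subst hA
        have e : partner k m (i * m + m') = k * m + (i * m + m') := by
          unfold partner; rw [if_pos (by omega)]
        simp only [e, Function.update_apply]
        split_ifs <;> first | rfl | omega
      by_cases hB : j = k * m + (i * m + m')
      · subst hB
        have e : partner k m (k * m + (i * m + m')) = i * m + m' := by
          unfold partner; rw [if_neg (by omega), if_pos (by omega)]; omega
        simp only [e, Function.update_apply]
        split_ifs <;> first | rfl | omega
      by_cases hC : j = 2 * (k * m) + (i * m + m')
      · subst hC
        have e : partner k m (2 * (k * m) + (i * m + m')) = recvR k m + (i * m + m') := by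
          unfold partner
          rw [if_neg (by omega), if_neg (by omega), if_pos (by omega)]; omega
        simp only [e, Function.update_apply]
        split_ifs <;> first | rfl | omega
      by_cases hE : j = recvR k m + (i * m + m')
      · subst hE
        have e : partner k m (recvR k m + (i * m + m')) = 2 * (k * m) + (i * m + m') := by
          unfold partner
          rw [if_neg (by omega), if_neg (by omega), if_neg (by omega), if_pos (by omega)]; omega
        simp only [e, Function.update_apply]
        split_ifs <;> first | rfl | omega
      have hp : ∀ x, j ≠ partner k m x → partner k m j ≠ x := fun x h h' =>
        h (by rw [← h', partner_partner])
      have pA : partner k m j ≠ i * m + m' := hp _ (by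
        unfold partner; rw [if_pos (by omega)]; exact hB)
      have pB : partner k m j ≠ k * m + (i * m + m') := hp _ (by
        unfold partner; rw [if_neg (by omega), if_pos (by omega)]; omega)
      have pC : partner k m j ≠ 2 * (k * m) + (i * m + m') := hp _ (by
        unfold partner; rw [if_neg (by omega), if_neg (by omega), if_pos (by omega)]; omega)
      have pE : partner k m j ≠ recvR k m + (i * m + m') := hp _ (by
        unfold partner
        rw [if_neg (by omega), if_neg (by omega), if_neg (by omega), if_pos (by omega)]; omega)
      rw [Function.update_of_ne pB, Function.update_of_ne pA, Function.update_of_ne pC,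
        Function.update_of_ne pE, Function.update_of_ne hB, Function.update_of_ne hA,
        Function.update_of_ne hC, Function.update_of_ne hE]
      refine if_congr ?_ rfl rfl
      omega

/-- The action of one SWAP test, on states whose control wire `c` and result wire `b` are `0`. -/
theorem acts_testOps {k m i : ℕ} (hm : 0 < m) (hi : i < k) {f : (ℕ → Bool) → ℂ}
    (hfc : ∀ s, s (recvR k m + 2 * (k * m) + i) = true → f s = 0)
    (hfb : ∀ s, s (3 * (k * m) + 2 + i) = true → f s = 0) (s : ℕ → Bool) :
    Op.acts (testOps k m i) f s =
      if s (3 * (k * m) + 2 + i) =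
        (s (recvR k m + 2 * (k * m) + i) && s (3 * (k * m) + 1 + i)) then
      1 / 2 * (f (Function.update (Function.update s (3 * (k * m) + 2 + i) false)
          (recvR k m + 2 * (k * m) + i) false) +
        Op.sgn (!s (recvR k m + 2 * (k * m) + i)) *
        f (Function.update (Function.update (swapBits k m {i} s) (3 * (k * m) + 2 + i) false)
          (recvR k m + 2 * (k * m) + i) false)) else 0 := by
  set c := recvR k m + 2 * (k * m) + i with hc
  set a := 3 * (k * m) + 1 + i with ha
  set b := 3 * (k * m) + 2 + i with hb
  have hD : recvR k m = 3 * (k * m) + k + 2 := rfl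
  have hca : c ≠ a := by omega
  have hcb : c ≠ b := by omega
  have hab : a ≠ b := by omega
  set g : (ℕ → Bool) → ℂ := fun s => Op.isqrt * f (Function.update s c false) with hg
  -- The control starts at `0`, so the first Hadamard only contributes a factor.
  have e₁ : Op.acts [.h c] f = g := by
    funext s
    rw [Op.acts, Op.acts, Op.act_h, hfc (Function.update s c true) (by simp), mul_zero, add_zero]
  set g₂ : (ℕ → Bool) → ℂ := fun s => g (if s c then swapBits k m {i} s else s) with hg₂
  have e₂ : Op.acts ((List.range m).flatMap fun j =>
      cswapOps c (i * m + j) (k * m + (i * m + j)) ++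
      cswapOps c (recvR k m + (i * m + j)) (2 * (k * m) + (i * m + j))) g = g₂ := by
    funext s
    rw [acts_cswaps hi (by omega) g m le_rfl s, hg₂]
    dsimp only
    congr 1
    funext j
    rw [if_congr (and_congr_right fun _ => (blockIndex_eq_iff hm hi).symm) rfl rfl]
    cases s c <;> simp [swapBits]
  rw [testOps, Op.acts_append, Op.acts_append, e₁, e₂]
  -- The control has been flipped: its value `1` stands for outcome `0` of the test, which is why
  -- the swapped term gets the sign of the negated bit.
  have e₃ : Op.acts [.h c, .x c, .ccx c a b] g₂ s =
      Op.isqrt * (g₂ (Function.update (Function.update (Function.update s b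
        (xor (s b) (s c && s a))) c (!s c)) c false) + Op.sgn (!s c) *
        g₂ (Function.update (Function.update (Function.update s b
        (xor (s b) (s c && s a))) c (!s c)) c true)) := by
    simp only [Op.acts]
    simp only [Op.act, Function.update_of_ne hcb, Function.update_self]
    rfl
  rw [e₃]
  simp only [Function.update_idem, hg₂, Function.update_self, Bool.false_eq_true, if_false, if_true,
    hg]
  have hsw : ∀ (t : ℕ → Bool) (x : ℕ) (v : Bool), 3 * (k * m) ≤ x →
      (x < recvR k m ∨ recvR k m + k * m ≤ x) → swapBits k m {i} (Function.update t x v) =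
        Function.update (swapBits k m {i} t) x v := by
    intro t x v h1 h2
    funext j
    have hx : partner k m x = x := partner_of_le h1 h2
    simp only [swapBits, Function.update_apply]
    by_cases hj : j = x
    · subst hj; simp [hx]
    · have : partner k m j ≠ x := fun h => hj (by rw [← hx, ← h, partner_partner])
      simp [hj, this]
  rw [hsw _ c _ (by omega) (by omega), hsw _ b _ (by omega) (by omega), Function.update_idem]
  -- The flag wire was `0` before the Toffoli gate, so afterwards it equals the conjunction, and all
  -- other strings have amplitude `0`.
  by_cases h : s b = (s c && s a)
  · rw [if_pos h, h, Bool.xor_self, ← Op.isqrt_mul_self]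
    ring
  · rw [if_neg h]
    have hx : xor (s b) (s c && s a) = true := by
      revert h
      cases s b <;> cases (s c && s a) <;> simp
    rw [hx, hfb, hfb]
    · ring
    · rw [Function.update_of_ne hcb.symm, Function.update_self]
    · rw [Function.update_of_ne hcb.symm, Function.update_self]

/-- Set the control and result wires of the first `i` SWAP tests to `0`. -/
def resetTests (k m i : ℕ) (s : ℕ → Bool) : ℕ → Bool := fun j =>
  if (recvR k m + 2 * (k * m) ≤ j ∧ j < recvR k m + 2 * (k * m) + i) ∨
    (3 * (k * m) + 2 ≤ j ∧ j < 3 * (k * m) + 2 + i) then false else s j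

/-- Outside the swapped blocks a test changes only its own control and flag. Hence the wires of
later tests, and the answer wire, are still `0`, as `acts_testOps` requires of the next test. -/
theorem acts_tests_eq_zero {k m : ℕ} (hm : 0 < m) {f : (ℕ → Bool) → ℂ}
    (hfc : ∀ l < k, ∀ s, s (recvR k m + 2 * (k * m) + l) = true → f s = 0)
    (hfb : ∀ l < k, ∀ s, s (3 * (k * m) + 2 + l) = true → f s = 0) {j : ℕ}
    (hj : j = 3 * (k * m) ∨ ∃ l < k, j = recvR k m + 2 * (k * m) + l ∨ j = 3 * (k * m) + 2 + l)
    (hf : ∀ s, s j = true → f s = 0) (i : ℕ) (hi : i ≤ k)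
    (hij : ∀ l < i, j ≠ recvR k m + 2 * (k * m) + l ∧ j ≠ 3 * (k * m) + 2 + l) (s : ℕ → Bool)
    (hs : s j = true) : Op.acts ((List.range i).flatMap (testOps k m)) f s = 0 := by
  have hD : recvR k m = 3 * (k * m) + k + 2 := rfl
  induction i generalizing s j with
  | zero => exact hf s hs
  | succ i ih =>
    have hj1 := hij i (by omega)
    have hj2 : 3 * (k * m) ≤ j ∧ (j < recvR k m ∨ recvR k m + k * m ≤ j) := by
      obtain h | ⟨l, hl, h | h⟩ := hj
      · omega
      · omega
      · omega
    rw [List.range_succ, List.flatMap_append, Op.acts_append, List.flatMap_singleton,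
      acts_testOps hm (by omega)]
    · have h0 := ih hj hf (by omega) fun l hl => hij l (by omega)
      rw [h0, h0, mul_zero, add_zero, mul_zero, ite_self]
      · rw [Function.update_of_ne hj1.1, Function.update_of_ne hj1.2,
          swapBits_of_le (by simpa using hi) _ hj2.1 hj2.2, hs]
      · rw [Function.update_of_ne hj1.1, Function.update_of_ne hj1.2, hs]
    · exact fun s hs => ih (Or.inr ⟨i, by omega, Or.inl rfl⟩) (hfc i (by omega)) (by omega)
        (fun l hl => by omega) s hs
    · exact fun s hs => ih (Or.inr ⟨i, by omega, Or.inr rfl⟩) (hfb i (by omega)) (by omega)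
        (fun l hl => by omega) s hs

/-- A `1` in the last flag forces, backwards along the chain, `1` in all earlier flags and controls,
and then every sign is positive. Each test contributes 1/2 and the choice to swap its block or not,
which gives a sum over sets of swapped blocks. -/
theorem acts_tests {k m : ℕ} (hm : 0 < m) {f : (ℕ → Bool) → ℂ}
    (hfc : ∀ l < k, ∀ s, s (recvR k m + 2 * (k * m) + l) = true → f s = 0)
    (hfb : ∀ l < k, ∀ s, s (3 * (k * m) + 2 + l) = true → f s = 0) (i : ℕ) (hi : i ≤ k)
    (s : ℕ → Bool) (hs : s (3 * (k * m) + 1 + i) = true) :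
    Op.acts ((List.range i).flatMap (testOps k m)) f s =
      if ∀ l < i, s (recvR k m + 2 * (k * m) + l) = true ∧ s (3 * (k * m) + 1 + l) = true then
        (1 / 2) ^ i * ∑ S ∈ (Finset.range i).powerset, f (resetTests k m i (swapBits k m S s))
      else 0 := by
  have hD : recvR k m = 3 * (k * m) + k + 2 := rfl
  induction i generalizing s with
  | zero =>
    have : resetTests k m 0 s = s := funext fun j => if_neg (by omega)
    simp [Op.acts, swapBits_empty, this]
  | succ i ih =>
    have hs' : s (3 * (k * m) + 2 + i) = true := by rw [← hs]; congr 1; ring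
    rw [List.range_succ, List.flatMap_append, Op.acts_append, List.flatMap_singleton,
      acts_testOps hm (by omega)]
    · rw [hs']
      by_cases h1 : s (recvR k m + 2 * (k * m) + i) = true ∧ s (3 * (k * m) + 1 + i) = true
      · rw [if_pos (by rw [h1.1, h1.2]; rfl), h1.1]
        have n1 : 3 * (k * m) + 1 + i ≠ recvR k m + 2 * (k * m) + i := by omega
        have n2 : 3 * (k * m) + 1 + i ≠ 3 * (k * m) + 2 + i := by omega
        have hsw : ∀ j, 3 * (k * m) ≤ j → (j < recvR k m ∨ recvR k m + k * m ≤ j) →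
            swapBits k m {i} s j = s j := fun j => swapBits_of_le (by simpa using hi) s
        rw [ih (by omega) _ (by rw [Function.update_of_ne n1, Function.update_of_ne n2, h1.2]),
          ih (by omega) _ (by rw [Function.update_of_ne n1, Function.update_of_ne n2,
            hsw _ (by omega) (by omega), h1.2])]
        have c1 : ∀ t : ℕ → Bool, (∀ j, 3 * (k * m) ≤ j →
            (j < recvR k m ∨ recvR k m + k * m ≤ j) → t j = s j) →
            ((∀ l < i, Function.update (Function.update t (3 * (k * m) + 2 + i) false)
              (recvR k m + 2 * (k * m) + i) false (recvR k m + 2 * (k * m) + l) = true ∧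
              Function.update (Function.update t (3 * (k * m) + 2 + i) false)
              (recvR k m + 2 * (k * m) + i) false (3 * (k * m) + 1 + l) = true) ↔
            ∀ l < i + 1, s (recvR k m + 2 * (k * m) + l) = true ∧
              s (3 * (k * m) + 1 + l) = true) := by
          intro t ht
          have : ∀ l < i, (Function.update (Function.update t (3 * (k * m) + 2 + i) false)
              (recvR k m + 2 * (k * m) + i) false (recvR k m + 2 * (k * m) + l) =
                s (recvR k m + 2 * (k * m) + l)) ∧
              Function.update (Function.update t (3 * (k * m) + 2 + i) false)
              (recvR k m + 2 * (k * m) + i) false (3 * (k * m) + 1 + l) =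
                s (3 * (k * m) + 1 + l) := fun l hl => by
            constructor <;> rw [Function.update_of_ne (by omega), Function.update_of_ne (by omega),
              ht _ (by omega) (by omega)]
          constructor
          · intro h l hl
            by_cases hli : l = i
            · subst hli; exact h1
            · have := this l (by omega)
              rw [← this.1, ← this.2]
              exact h l (by omega)
          · intro h l hl
            rw [(this l hl).1, (this l hl).2]
            exact h l (by omega)
        rw [if_congr (c1 s fun j _ _ => rfl) rfl rfl,
          if_congr (c1 (swapBits k m {i} s) fun j h h' => hsw j h h') rfl rfl]
        by_cases hall : ∀ l < i + 1, s (recvR k m + 2 * (k * m) + l) = true ∧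
            s (3 * (k * m) + 1 + l) = true
        · rw [if_pos hall, if_pos hall, if_pos hall, Finset.range_add_one,
            Finset.sum_powerset_insert Finset.notMem_range_self]
          have hreset : ∀ S ∈ (Finset.range i).powerset, ∀ t : ℕ → Bool,
              resetTests k m i (swapBits k m S (Function.update (Function.update t
                (3 * (k * m) + 2 + i) false) (recvR k m + 2 * (k * m) + i) false)) =
              resetTests k m (i + 1) (swapBits k m S t) := by
            intro S hS t
            have hSk : S ⊆ Finset.range k := (Finset.mem_powerset.1 hS).trans
              (Finset.range_subset_range.2 (by omega))
            funext j
            by_cases hj : 3 * (k * m) ≤ j ∧ (j < recvR k m ∨ recvR k m + k * m ≤ j)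
            · simp only [resetTests, swapBits_of_le hSk _ hj.1 hj.2, Function.update_apply]
              split_ifs <;> first | rfl | omega
            · have hp : ∀ x, 3 * (k * m) ≤ x → (x < recvR k m ∨ recvR k m + k * m ≤ x) →
                  partner k m j ≠ x := fun x h h' hh => by
                have := partner_of_le h h'
                rw [← hh, partner_partner] at this
                omega
              simp only [resetTests, swapBits]
              rw [Function.update_of_ne (hp _ (by omega) (by omega)),
                Function.update_of_ne (hp _ (by omega) (by omega)),
                Function.update_of_ne (by omega), Function.update_of_ne (by omega)]
              split_ifs <;> first | rfl | omega
          rw [Finset.sum_congr rfl fun S hS => congrArg f (hreset S hS s),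
            Finset.sum_congr rfl fun S hS => congrArg f (hreset S hS (swapBits k m {i} s)),
            Finset.sum_congr rfl fun S hS => congrArg f (congrArg (resetTests k m (i + 1))
              (swapBits_swapBits_singleton (fun h => by
                simpa using Finset.mem_powerset.1 hS h) s))]
          simp only [Op.sgn, Bool.not_true, Bool.false_eq_true, if_false]
          ring
        · rw [if_neg hall, if_neg hall, if_neg hall]
          ring
      · rw [if_neg, if_neg]
        · exact fun h => h1 (h i (by omega))
        · intro h
          apply h1
          simpa using h.symm
    · exact fun s hs => acts_tests_eq_zero hm hfc hfb (Or.inr ⟨i, by omega, Or.inl rfl⟩)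
        (hfc i (by omega)) i (by omega) (fun l hl => by omega) s hs
    · exact fun s hs => acts_tests_eq_zero hm hfc hfb (Or.inr ⟨i, by omega, Or.inr rfl⟩)
        (hfb i (by omega)) i (by omega) (fun l hl => by omega) s hs

/-! ### Tensor products of blocks -/

/-- A register of `k * m` qubits as `k` registers of `m` qubits. -/
def blockEquiv (k m : ℕ) : Qubits (k * m) ≃ (Fin k → Qubits m) where
  toFun x i := window x (i * m) m
  invFun y j := y j.divNat j.modNat
  left_inv x := by
    funext j
    have h : (j.divNat : ℕ) * m + j.modNat = j := by
      simp [Fin.divNat, Fin.modNat, Nat.div_add_mod']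
    simp only [window, h, j.isLt, dite_true]
  right_inv y := by
    funext i j
    have h := mul_add_lt_mul i.isLt j.isLt
    simp only [window, h, dite_true]
    congr 1
    · congr 1
      ext
      have hm : 0 < m := by have := j.isLt; omega
      simp [Fin.divNat, Nat.mul_comm _ m, Nat.mul_add_div hm]
    · ext
      simp [Fin.modNat, Nat.mod_eq_of_lt j.isLt]

theorem eq_of_windows {k m : ℕ} {x y : Qubits (k * m)}
    (h : ∀ i < k, window x (i * m) m = window y (i * m) m) : x = y :=
  (blockEquiv k m).injective (funext fun i => h i i.isLt)

theorem sum_prod_window {k m : ℕ} (f : Fin k → Qubits m → ℂ) :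
    ∑ x : Qubits (k * m), ∏ i : Fin k, f i (window x (i * m) m) = ∏ i, ∑ y, f i y := by
  rw [Fintype.prod_sum]
  exact Fintype.sum_equiv (blockEquiv k m) _ _ fun x => rfl

/-- The register `x` with the blocks in `S` replaced by those of `y`. -/
def mix {k m : ℕ} (S : Finset ℕ) (x y : Qubits (k * m)) : Qubits (k * m) := fun j =>
  if (j : ℕ) / m ∈ S then y j else x j

theorem window_mix {k m i : ℕ} (hi : i < k) (S : Finset ℕ) (x y : Qubits (k * m)) :
    window (mix S x y) (i * m) m = if i ∈ S then window y (i * m) m else window x (i * m) m := by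
  funext j
  have h := mul_add_lt_mul hi j.isLt
  have hm : 0 < m := by have := j.isLt; omega
  have hd : (i * m + j) / m = i := by
    rw [Nat.mul_comm, Nat.mul_add_div hm, Nat.div_eq_of_lt j.isLt, add_zero]
  simp only [window, h, dite_true, mix, hd]
  split_ifs <;> simp only [window] <;> rw [dif_pos h]

/-- Exchange the blocks in `S` of two pairs of registers. -/
def swapData {k m : ℕ} (S : Finset ℕ)
    (d : (Qubits (k * m) × Qubits (k * m)) × (Qubits (k * m) × Qubits (k * m))) :
    (Qubits (k * m) × Qubits (k * m)) × (Qubits (k * m) × Qubits (k * m)) :=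
  ((mix S d.1.1 d.2.1, mix S d.1.2 d.2.2), (mix S d.2.1 d.1.1, mix S d.2.2 d.1.2))

/-- With the control prepared in and found at `0`, the Hadamards average the two branches of the
controlled swap, the identity and the swap. -/
theorem swapTestAccept_apply {D : Type} [Fintype D] [DecidableEq D] (x y : D × D) :
    swapTestAccept D x y = 1 / 2 * ((if y = x.swap then 1 else 0) + if y = x then 1 else 0) := by
  have h2 : ((√2 : ℝ) : ℂ)⁻¹ * ((√2 : ℝ) : ℂ)⁻¹ = 1 / 2 := Op.isqrt_mul_self
  rw [swapTestAccept, Matrix.submatrix_apply, Matrix.mul_apply]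
  simp only [Matrix.mul_apply, Fintype.sum_prod_type (α₁ := Bool), Matrix.kroneckerMap_apply,
    Matrix.one_apply, Fintype.sum_bool, hadamard, Bool.false_and, Bool.and_false,
    Bool.false_eq_true, if_false, mul_one, controlledSwap, Prod.mk.injEq, mul_ite, ite_mul,
    mul_zero, zero_mul, Finset.sum_ite_eq', Finset.mem_univ, if_true,
    true_and, false_and, Bool.true_eq_false, Finset.sum_const_zero, add_zero, zero_add]
  have e1 : x = y.swap ↔ y = x.swap := by
    constructor <;> rintro rfl <;> simp
  simp only [e1, eq_comm (a := x), h2]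
  split_ifs <;> ring

/-- Expands the product of the operators (1 + SWAP)/2 over the sets of swapped blocks, the form in
which the circuit delivers it. -/
theorem allTestsAccept_apply {k m : ℕ}
    (d d' : (Qubits (k * m) × Qubits (k * m)) × (Qubits (k * m) × Qubits (k * m))) :
    allTestsAccept k m d d' =
      (1 / 2) ^ k * ∑ S ∈ (Finset.range k).powerset, if d' = swapData S d then 1 else 0 := by
  rw [allTestsAccept]
  simp only [swapTestAccept_apply, block, Finset.prod_mul_distrib, Finset.prod_const,
    Finset.card_univ, Fintype.card_fin]
  congr 1
  rw [Fin.prod_univ_eq_prod_range (fun i =>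
    (if ((window d'.1.1 (i * m) m, window d'.1.2 (i * m) m),
        (window d'.2.1 (i * m) m, window d'.2.2 (i * m) m)) =
      Prod.swap ((window d.1.1 (i * m) m, window d.1.2 (i * m) m),
        (window d.2.1 (i * m) m, window d.2.2 (i * m) m)) then (1 : ℂ) else 0) +
    if ((window d'.1.1 (i * m) m, window d'.1.2 (i * m) m),
        (window d'.2.1 (i * m) m, window d'.2.2 (i * m) m)) =
      ((window d.1.1 (i * m) m, window d.1.2 (i * m) m),
        (window d.2.1 (i * m) m, window d.2.2 (i * m) m)) then 1 else 0) k, Finset.prod_add]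
  refine Finset.sum_congr rfl fun S hS => ?_
  rw [prod_ite_one_zero, prod_ite_one_zero, ite_zero_mul_ite_zero, mul_one]
  refine if_congr ?_ rfl rfl
  have hSk : ∀ i ∈ S, i < k := fun i hi => by simpa using Finset.mem_powerset.1 hS hi
  constructor
  · rintro ⟨h1, h2⟩
    have key : ∀ i < k, window d'.1.1 (i * m) m = window (swapData S d).1.1 (i * m) m ∧
        window d'.1.2 (i * m) m = window (swapData S d).1.2 (i * m) m ∧
        window d'.2.1 (i * m) m = window (swapData S d).2.1 (i * m) m ∧
        window d'.2.2 (i * m) m = window (swapData S d).2.2 (i * m) m := by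
      intro i hi
      simp only [swapData, window_mix hi]
      by_cases hiS : i ∈ S
      · have := h1 i hiS
        simp only [Prod.swap_prod_mk, Prod.mk.injEq] at this
        simp only [hiS, if_true]
        tauto
      · have := h2 i (by simp [hi, hiS])
        simp only [Prod.mk.injEq] at this
        simp only [hiS, if_false]
        tauto
    exact Prod.ext (Prod.ext (eq_of_windows fun i hi => (key i hi).1)
      (eq_of_windows fun i hi => (key i hi).2.1)) (Prod.ext
      (eq_of_windows fun i hi => (key i hi).2.2.1) (eq_of_windows fun i hi => (key i hi).2.2.2))
  · rintro rfl
    constructor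
    · intro i hi
      simp only [swapData, window_mix (hSk i hi), hi, if_true, Prod.swap_prod_mk]
    · intro i hi
      simp only [Finset.mem_sdiff, Finset.mem_range] at hi
      simp only [swapData, window_mix hi.1, hi.2, if_false]

theorem allTestsAccept_mulVec {k m : ℕ}
    (v : (Qubits (k * m) × Qubits (k * m)) × (Qubits (k * m) × Qubits (k * m)) → ℂ)
    (d : (Qubits (k * m) × Qubits (k * m)) × (Qubits (k * m) × Qubits (k * m))) :
    (allTestsAccept k m *ᵥ v) d =
      (1 / 2) ^ k * ∑ S ∈ (Finset.range k).powerset, v (swapData S d) := by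
  change ∑ d', allTestsAccept k m d d' * v d' = _
  simp only [allTestsAccept_apply, mul_assoc, Finset.sum_mul]
  rw [← Finset.mul_sum, Finset.sum_comm]
  simp

/-- The matrix entries of a sum of rank-one operators after conjugation. -/
theorem conj_sum_vecMulVec {ι κ α : Type} [Fintype ι] [Fintype κ] [Fintype α]
    (U : Matrix κ ι ℂ) (ρ : Matrix α α ℂ) (v : α → ι → ℂ) {R : Matrix ι ι ℂ}
    (hR : ∀ z z', R z z' = ∑ a, ∑ a', ρ a a' * (v a z * star (v a' z'))) (y y' : κ) :
    (U * R * Uᴴ) y y' = ∑ a, ∑ a', ρ a a' * ((U *ᵥ v a) y * star ((U *ᵥ v a') y')) := by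
  have h : R = ∑ a, ∑ a', ρ a a' • Matrix.vecMulVec (v a) (star (v a')) := by
    ext z z'
    simp [hR, Matrix.sum_apply, Matrix.vecMulVec_apply]
  have h2 : ∀ a a', U * Matrix.vecMulVec (v a) (star (v a')) * Uᴴ =
      Matrix.vecMulVec (U *ᵥ v a) (star (U *ᵥ v a')) := fun a a' => by
    rw [Matrix.mul_vecMulVec, Matrix.vecMulVec_mul, Matrix.star_mulVec]
  rw [h, Matrix.mul_sum, Matrix.sum_mul, Matrix.sum_apply]
  refine Finset.sum_congr rfl fun a _ => ?_
  rw [Matrix.mul_sum, Matrix.sum_mul, Matrix.sum_apply]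
  refine Finset.sum_congr rfl fun a' _ => ?_
  rw [Matrix.mul_smul, Matrix.smul_mul, h2, Matrix.smul_apply, smul_eq_mul, Matrix.vecMulVec_apply]
  rfl

theorem conj_ketBra {ι κ : Type} [Fintype ι] (U : Matrix κ ι ℂ) (v : ι → ℂ) :
    U * ketBra v * Uᴴ = ketBra (U *ᵥ v) := by
  rw [ketBra, ketBra, Matrix.mul_vecMulVec, Matrix.vecMulVec_mul, Matrix.star_mulVec]

/-- The acceptance probability of the receiver. -/
theorem accept_eq {n : ℕ → ℕ} (k : ℕ) (θ : Ket (n k)) (b : Bool)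
    (ρ : Matrix (Qubits (k * n k) × Qubits (k * n k)) (Qubits (k * n k) × Qubits (k * n k)) ℂ) :
    (swapTestScheme n).accept k θ b ρ = (∑ d, ∑ a, ∑ a', ρ a a' *
      ((allTestsAccept k (n k) *ᵥ fun d => (if d.1 = a then 1 else 0) * bigPsi k k θ b d.2) d *
      star ((allTestsAccept k (n k) *ᵥ fun d => (if d.1 = a' then 1 else 0) *
        bigPsi k k θ b d.2) d))).re := by
  change Complex.re (Matrix.trace _) = _
  rw [Matrix.trace]
  congr 1
  refine Finset.sum_congr rfl fun d _ => ?_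
  rw [Matrix.diag_apply, conj_sum_vecMulVec (allTestsAccept k (n k)) ρ
    (fun a d => (if d.1 = a then 1 else 0) * bigPsi k k θ b d.2)]
  intro z z'
  simp [Matrix.kroneckerMap_apply, ketBra, Matrix.vecMulVec_apply,
    apply_ite (starRingEnd ℂ)]

theorem sum_mul_star_of_norm {m : ℕ} {θ : Ket m} (h : ‖θ‖ = 1) : ∑ x, θ x * star (θ x) = 1 := by
  have h1 := EuclideanSpace.norm_sq_eq θ
  rw [h, one_pow] at h1
  have h2 : ∀ x, θ x * star (θ x) = ((‖θ x‖ ^ 2 : ℝ) : ℂ) := fun x => by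
    rw [Complex.star_def, Complex.mul_conj, Complex.normSq_eq_norm_sq]
  simp only [h2]
  rw [← Complex.ofReal_sum, ← h1, Complex.ofReal_one]

/-- The auxiliary register holds either zeros or the displaced copies of `θ`, and both are
normalised. -/
theorem sum_junk {k m : ℕ} {θ : Ket m} (h : ‖θ‖ = 1) (b : Bool) :
    ∑ x : Qubits (k * m), junk θ b x * star (junk θ b x) = 1 := by
  cases b
  · simp [junk]
  · simp only [junk, if_true, star_prod, ← Finset.prod_mul_distrib]
    rw [sum_prod_window fun _ y => θ y * star (θ y)]
    rw [Finset.prod_congr rfl fun i _ => sum_mul_star_of_norm h, Finset.prod_const_one]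

/-! ### Committer and receiver are efficient -/

/-- A bit of a register, with `0` beyond its end. -/
def getBit {M : ℕ} (x : Qubits M) (j : ℕ) : Bool := if h : j < M then x ⟨j, h⟩ else false

theorem ofBits_getBit {w : ℕ} (z : Qubits w) : ofBits w (getBit z) = z := by
  funext i; simp [ofBits, getBit]

theorem eq_bitsAt_iff {M o : ℕ} {x : Qubits M} {s : ℕ → Bool} :
    bitsAt s o M = x ↔ ∀ j < M, s (o + j) = getBit x j := by
  constructor
  · rintro rfl j hj
    simp [getBit, bitsAt, hj]
  · intro h
    funext j
    rw [bitsAt, h _ j.isLt]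
    simp [getBit]

theorem forall_fin_le {w c : ℕ} (hc : c ≤ w) (p : ℕ → Prop) :
    (∀ i : Fin w, c ≤ (i : ℕ) → p i) ↔ ∀ q < w - c, p (c + q) := by
  constructor
  · intro h q hq
    exact h ⟨c + q, by omega⟩ (by simp)
  · intro h i hi
    have := h (i - c) (by have := i.isLt; omega)
    rwa [Nat.add_sub_cancel' hi] at this

/-- The basis state with the given contents of the three registers of the committer. -/
def committerState {M : ℕ} (p : (Qubits M × Qubits M) × Qubits M) : Qubits (3 * M) :=
  ofBits _ fun j => if j < M then getBit p.1.1 j else if j < 2 * M then getBit p.1.2 (j - M)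
    else getBit p.2 (j - 2 * M)

theorem window_committerState {M : ℕ} (p : (Qubits M × Qubits M) × Qubits M) :
    window (committerState p) 0 M = p.1.1 ∧ window (committerState p) M M = p.1.2 ∧
      window (committerState p) (2 * M) M = p.2 := by
  refine ⟨?_, ?_, ?_⟩
  · rw [committerState, window_ofBits (by omega), eq_bitsAt_iff]
    intro j hj
    rw [zero_add, if_pos hj]
  · rw [committerState, window_ofBits (by omega), eq_bitsAt_iff]
    intro j hj
    rw [if_neg (by omega), if_pos (by omega), Nat.add_sub_cancel_left]
  · rw [committerState, window_ofBits (by omega), eq_bitsAt_iff]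
    intro j hj
    rw [if_neg (by omega), if_neg (by omega), Nat.add_sub_cancel_left]

theorem committerState_windows {M : ℕ} (z : Qubits (3 * M)) :
    committerState ((window z 0 M, window z M M), window z (2 * M) M) = z := by
  funext i
  have hi := i.isLt
  simp only [committerState, ofBits, getBit, window]
  split_ifs <;> first | omega | (congr 1; ext; simp only; omega)

theorem sum_committerState {M : ℕ} (f : Qubits (3 * M) → ℂ) :
    ∑ z, f z = ∑ p, f (committerState p) :=
  (Fintype.sum_equiv
    { toFun := committerState
      invFun := fun z => ((window z 0 M, window z M M), window z (2 * M) M)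
      left_inv := fun p => by
        obtain ⟨h1, h2, h3⟩ := window_committerState p
        simp only [h1, h2, h3]
      right_inv := committerState_windows } _ _ fun _ => rfl).symm

/-- The discarded register is in a normalised product state with the others, so discarding it leaves
them pure. -/
theorem outputState_ketBra {M : ℕ} (Ψ : Qubits M × Qubits M → ℂ) (J : Qubits M → ℂ)
    (hJ : ∑ x, J x * star (J x) = 1) (φ : Qubits (3 * M) → ℂ)
    (hφ : ∀ p, φ (committerState p) = Ψ p.1 * J p.2) :
    outputState M M (ketBra φ) = ketBra Ψ := by
  funext a a'
  simp only [outputState]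
  rw [sum_committerState]
  have h : ∀ p q : (Qubits M × Qubits M) × Qubits M,
      (if (window (committerState p) 0 M, window (committerState p) M M) = a ∧
        (window (committerState q) 0 M, window (committerState q) M M) = a' ∧
        (∀ i : Fin (3 * M), M + M ≤ (i : ℕ) → committerState p i = committerState q i) then
        ketBra φ (committerState p) (committerState q) else 0) =
      if p.1 = a then if q.1 = a' then if p.2 = q.2 then
        Ψ p.1 * star (Ψ q.1) * (J p.2 * star (J q.2)) else 0 else 0 else 0 := by
    intro p q
    obtain ⟨h1, h2, h3⟩ := window_committerState p
    obtain ⟨g1, g2, g3⟩ := window_committerState q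
    have h4 : (∀ i : Fin (3 * M), M + M ≤ (i : ℕ) → committerState p i = committerState q i) ↔
        p.2 = q.2 := by
      have h5 := forall_fin_le (w := 3 * M) (c := M + M) (by omega)
        (fun i => getBit (committerState p) i = getBit (committerState q) i)
      simp only [getBit, Fin.is_lt, dite_true, Fin.eta] at h5
      rw [h5, show 3 * M - (M + M) = M by omega, ← h3, ← g3, ← two_mul]
      conv_rhs => rw [← ofBits_getBit (committerState p), ← ofBits_getBit (committerState q),
        window_ofBits (by omega), window_ofBits (by omega), bitsAt_eq_iff]
      rfl
    rw [h1, h2, g1, g2, ← ite_and, ← ite_and]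
    refine if_congr (by rw [h4, and_assoc]) ?_ rfl
    rw [ketBra, Matrix.vecMulVec_apply, Pi.star_apply, hφ, hφ, star_mul']
    ring
  rw [Finset.sum_congr rfl fun p _ => (sum_committerState _).trans
    (Finset.sum_congr rfl fun q _ => h p q)]
  simp only [Fintype.sum_prod_type (α₁ := Qubits M × Qubits M)]
  rw [Finset.sum_eq_single a (fun b _ hb => by simp [hb]) (by simp)]
  have h' : ∀ x : Qubits M, (∑ q : Qubits M × Qubits M, ∑ y : Qubits M, if a = a then
      if q = a' then if x = y then Ψ a * star (Ψ q) * (J x * star (J y)) else 0 else 0 else 0) =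
      Ψ a * star (Ψ a') * (J x * star (J x)) := fun x => by
    rw [Finset.sum_eq_single a' (fun b _ hb => by simp [hb]) (by simp)]
    rw [Finset.sum_eq_single x (fun b _ hb => by simp [hb.symm]) (by simp)]
    simp
  rw [Finset.sum_congr rfl fun x _ => h' x, ← Finset.mul_sum, hJ, mul_one, ketBra,
    Matrix.vecMulVec_apply, Pi.star_apply]

theorem committerInput_ofBits {k m : ℕ} (θ : Ket m) (s : ℕ → Bool) :
    committerInput k (3 * (k * m)) θ (ofBits _ s) =
      prepInput k (k * m) (2 * (k * m)) θ (fun _ => 1) s := by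
  rw [committerInput, prepInput, mul_one]
  have h : (∀ i : Fin (3 * (k * m)), k * m ≤ (i : ℕ) → ofBits (3 * (k * m)) s i = false) ↔
      (∀ q < k * m, s (k * m + q) = false) ∧ ∀ q < k * m, s (2 * (k * m) + q) = false := by
    refine (forall_fin_le (c := k * m) (by omega) (fun i => s i = false)).trans ?_
    constructor
    · refine fun h => ⟨fun q hq => h q (by omega), fun q hq => ?_⟩
      have := h (k * m + q) (by omega)
      rwa [← add_assoc, ← two_mul] at this
    · rintro ⟨h1, h2⟩ q hq
      by_cases hq' : q < k * m
      · exact h1 q hq'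
      · have := h2 (q - k * m) (by omega)
        rwa [show 2 * (k * m) + (q - k * m) = k * m + q by omega] at this
  rw [if_congr h rfl rfl, ite_and, copiesOf]
  have h2 : ∀ i : Fin k, window (ofBits (3 * (k * m)) s) (i * m) m = bitsAt s (i * m) m := fun i =>
    window_ofBits (by have := block_bound (m := m) i; omega) s
  simp only [h2]
  split_ifs <;> simp

theorem isQPTCommitter {n : ℕ → ℕ} (hn : PolyBounded n) (hkn : ∀ k, k ≤ n k) :
    (swapTestScheme n).IsQPTCommitter := by
  intro b
  refine ⟨_, _, isUniformPolyTime_committer hn hkn b, fun k => ⟨?_, ?_, fun θ hθ => ?_⟩⟩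
  · change k * n k ≤ 3 * (k * n k); omega
  · change k * n k + k * n k ≤ 3 * (k * n k); omega
  · change outputState (k * n k) (k * n k) _ = ketBra (bigPsi k k θ b)
    rw [conj_ketBra]
    refine outputState_ketBra _ (junk θ b) (sum_junk hθ b) _ fun p => ?_
    obtain ⟨h1, h2, h3⟩ := window_committerState p
    rw [← ofBits_getBit (committerState p), Op.mulVec_flatMap_gates
      (valid_prepOps (hkn k) b le_rfl (by omega) (by omega))]
    have : (fun s => committerInput k (3 * (k * n k)) θ (ofBits _ s)) =
        prepInput k (k * n k) (2 * (k * n k)) θ (fun _ => 1) :=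
      funext fun s => committerInput_ofBits θ s
    change Op.acts _ (fun s => committerInput k (3 * (k * n k)) θ (ofBits _ s)) _ = _
    rw [this, acts_prepOps (hkn k) le_rfl (by omega) θ b _ fun _ _ _ => rfl, mul_one,
      ← window_ofBits (w := 3 * (k * n k)) (by omega),
      ← window_ofBits (w := 3 * (k * n k)) (by omega),
      ← window_ofBits (w := 3 * (k * n k)) (by omega), ofBits_getBit, h1, h2, h3]

/-! ### The circuit of the receiver -/

/-- The condition that the registers `C` and `R` are in the basis state `a` and that the auxiliary
wires of the SWAP tests are `0`. -/
def receiverRest (k m : ℕ) (a : Qubits (k * m) × Qubits (k * m)) (s : ℕ → Bool) : ℂ :=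
  (if (bitsAt s (k * m) (k * m), bitsAt s (2 * (k * m)) (k * m)) = a then 1 else 0) *
    if (∀ q < k + 2, s (3 * (k * m) + q) = false) ∧
      ∀ q < k, s (recvR k m + 2 * (k * m) + q) = false then 1 else 0

theorem swapBits_register {k m : ℕ} {S : Finset ℕ} (s : ℕ → Bool) {o o' : ℕ}
    (h : ∀ j < k * m, blockIndex k m (o + j) = j / m ∧ partner k m (o + j) = o' + j) :
    bitsAt (swapBits k m S s) o (k * m) = mix S (bitsAt s o (k * m)) (bitsAt s o' (k * m)) := by
  funext j
  simp only [bitsAt, swapBits, mix, h j j.isLt]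

theorem swapBits_registers {k m : ℕ} (S : Finset ℕ) (s : ℕ → Bool) :
    ((bitsAt (swapBits k m S s) (k * m) (k * m), bitsAt (swapBits k m S s) (2 * (k * m)) (k * m)),
      (bitsAt (swapBits k m S s) 0 (k * m), bitsAt (swapBits k m S s) (recvR k m) (k * m))) =
    swapData S ((bitsAt s (k * m) (k * m), bitsAt s (2 * (k * m)) (k * m)),
      (bitsAt s 0 (k * m), bitsAt s (recvR k m) (k * m))) := by
  have hD : recvR k m = 3 * (k * m) + k + 2 := rfl
  rw [swapData, swapBits_register (o := k * m) (o' := 0), swapBits_register (o := 2 * (k * m))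
    (o' := recvR k m), swapBits_register (o := 0) (o' := k * m), swapBits_register (o := recvR k m)
    (o' := 2 * (k * m))]
  all_goals
    intro j hj
    simp only [blockIndex, partner]
    split_ifs <;> first | omega | (constructor <;> first | omega | (congr 1; omega))

/-- Only strings with answer `1` count towards acceptance. On these the sum over swapped blocks from
`acts_tests` is the one in `allTestsAccept_mulVec`, and the auxiliary register factors out. -/
theorem acts_receiverOps {k m : ℕ} (hkm : k ≤ m) (hm : 0 < m) (θ : Ket m) (b : Bool)
    (a : Qubits (k * m) × Qubits (k * m)) (s : ℕ → Bool) (hs : s (3 * (k * m)) = true) :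
    Op.acts (receiverOps k m b)
      (prepInput k (recvR k m) (recvR k m + k * m) θ (receiverRest k m a)) s =
    if (∀ l < k, s (recvR k m + 2 * (k * m) + l) = true) ∧
        ∀ l < k + 1, s (3 * (k * m) + 1 + l) = true then
      (allTestsAccept k m *ᵥ fun d => (if d.1 = a then 1 else 0) * bigPsi k k θ b d.2)
        ((bitsAt s (k * m) (k * m), bitsAt s (2 * (k * m)) (k * m)),
          (bitsAt s 0 (k * m), bitsAt s (recvR k m) (k * m))) *
        junk θ b (bitsAt s (recvR k m + k * m) (k * m))
    else 0 := by
  have hD : recvR k m = 3 * (k * m) + k + 2 := rfl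
  set f₁ : (ℕ → Bool) → ℂ := fun s => bigPsi k k θ b (bitsAt s 0 (k * m), bitsAt s (recvR k m) (k * m)) *
    junk θ b (bitsAt s (recvR k m + (k * m)) (k * m)) * receiverRest k m a s with hf₁
  have e₁ : Op.acts (prepOps k m (recvR k m) (recvR k m + (k * m)) b) (prepInput k (recvR k m) (recvR k m + (k * m)) θ (receiverRest k m a)) =
      f₁ := by
    funext s
    refine acts_prepOps hkm (by omega) le_rfl θ b _ (fun s t hst => ?_) s
    have h : ∀ j, (k * m) ≤ j → j < recvR k m ∨ recvR k m + 2 * (k * m) ≤ j → s j = t j := fun j h1 h2 =>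
      hst j (by omega) (by omega) (by omega)
    simp only [receiverRest]
    rw [bitsAt_congr (s := s) (t := t) (o := (k * m)) (o' := (k * m)) fun i hi => h _ (by omega) (by omega),
      bitsAt_congr (s := s) (t := t) (o := 2 * (k * m)) (o' := 2 * (k * m))
        fun i hi => h _ (by omega) (by omega)]
    congr 1
    refine if_congr (and_congr ?_ ?_) rfl rfl
    · exact forall₂_congr fun q hq => by rw [h _ (by omega) (by omega)]
    · exact forall₂_congr fun q hq => by rw [h _ (by omega) (by omega)]
  set f₂ : (ℕ → Bool) → ℂ := fun s => f₁ (Function.update s (3 * (k * m) + 1) (!s (3 * (k * m) + 1))) with hf₂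
  have e₂ : Op.acts [.x (3 * (k * m) + 1)] f₁ = f₂ := rfl
  have hrest : ∀ s : ℕ → Bool, ∀ j, (3 * (k * m) ≤ j ∧ j < recvR k m ∨ recvR k m + 2 * (k * m) ≤ j ∧ j < recvR k m + 2 * (k * m) + k) →
      s j = true → receiverRest k m a s = 0 := by
    intro s j hj hs
    rw [receiverRest, if_neg (c := _ ∧ _), mul_zero]
    rintro ⟨h1, h2⟩
    obtain hj | hj := hj
    · have := h1 (j - 3 * (k * m)) (by omega)
      rw [Nat.add_sub_cancel' hj.1, hs] at this
      exact absurd this (by decide)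
    · have := h2 (j - (recvR k m + 2 * (k * m))) (by omega)
      rw [Nat.add_sub_cancel' hj.1, hs] at this
      exact absurd this (by decide)
  have hzero : ∀ j, (3 * (k * m) ≤ j ∧ j < recvR k m ∨ recvR k m + 2 * (k * m) ≤ j ∧ j < recvR k m + 2 * (k * m) + k) → j ≠ 3 * (k * m) + 1 →
      ∀ s, s j = true → f₂ s = 0 := fun j hj hne s hs => by
    rw [hf₂]
    dsimp only
    rw [hf₁]
    dsimp only
    rw [hrest _ j hj (by rw [Function.update_of_ne hne, hs]), mul_zero]
  have hfc : ∀ l < k, ∀ s, s (recvR k m + 2 * (k * m) + l) = true → f₂ s = 0 := fun l hl =>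
    hzero _ (by omega) (by omega)
  have hfb : ∀ l < k, ∀ s, s (3 * (k * m) + 2 + l) = true → f₂ s = 0 := fun l hl =>
    hzero _ (by omega) (by omega)
  rw [receiverOps, Op.acts_append, Op.acts_append, Op.acts_append, e₁, e₂]
  change Op.acts _ f₂ (Function.update s (3 * (k * m)) (xor (s (3 * (k * m))) (s (3 * (k * m) + 1 + k)))) = _
  cases hk : s (3 * (k * m) + 1 + k)
  -- If the last flag is `0`, the final CNOT did nothing and the answer would have had to be `1`
  -- already; but no earlier gate acts on it.
  · rw [if_neg (fun h => by rw [h.2 k (by omega)] at hk; exact absurd hk (by decide))]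
    exact acts_tests_eq_zero hm hfc hfb (Or.inl rfl) (hzero _ (by omega) (by omega)) k le_rfl
      (fun l hl => by omega) _ (by rw [Function.update_self, hs]; rfl)
  · rw [hs, Bool.xor_self, acts_tests hm hfc hfb k le_rfl _
      (by rw [Function.update_of_ne (by omega), hk])]
    refine if_ctx_congr ?_ (fun h => ?_) fun _ => rfl
    · constructor
      · intro h
        refine ⟨fun l hl => ?_, fun l hl => ?_⟩
        · have := (h l hl).1
          rwa [Function.update_of_ne (by omega)] at this
        · by_cases hlk : l = k
          · rw [hlk, hk]
          · have := (h l (by omega)).2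
            rwa [Function.update_of_ne (by omega)] at this
      · rintro ⟨h1, h2⟩ l hl
        rw [Function.update_of_ne (by omega), Function.update_of_ne (by omega)]
        exact ⟨h1 l hl, h2 l (by omega)⟩
    · rw [allTestsAccept_mulVec, mul_assoc, Finset.sum_mul]
      congr 1
      refine Finset.sum_congr rfl fun S hS => ?_
      have hSk := Finset.mem_powerset.1 hS
      set t := Function.update s (3 * (k * m)) false with ht
      set u := resetTests k m k (swapBits k m S t) with hu
      have h1 : u (3 * (k * m) + 1) = true := by
        rw [hu, resetTests, if_neg (by omega), swapBits_of_le hSk _ (by omega) (by omega), ht,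
          Function.update_of_ne (by omega)]
        exact h.2 0 (by omega)
      rw [hf₂]
      dsimp only
      rw [h1, Bool.not_true]
      set v := Function.update u (3 * (k * m) + 1) false with hv
      have hreg : ∀ o, o + (k * m) ≤ 3 * (k * m) ∨ o = recvR k m → bitsAt v o (k * m) = bitsAt (swapBits k m S s) o (k * m) := by
        intro o ho
        refine bitsAt_congr fun i hi => ?_
        have hp : partner k m (o + i) ≠ 3 * (k * m) := by
          unfold partner
          split_ifs <;> omega
        rw [hv, Function.update_of_ne (by omega), hu, resetTests, if_neg (by omega), swapBits,
          swapBits, ht, Function.update_of_ne hp, Function.update_of_ne (by omega)]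
      have hjunk : bitsAt v (recvR k m + (k * m)) (k * m) = bitsAt s (recvR k m + (k * m)) (k * m) := by
        refine bitsAt_congr fun i hi => ?_
        rw [hv, Function.update_of_ne (by omega), hu, resetTests, if_neg (by omega),
          swapBits_of_le hSk _ (by omega) (by omega), ht, Function.update_of_ne (by omega)]
      have haux : (∀ q < k + 2, v (3 * (k * m) + q) = false) ∧ ∀ q < k, v (recvR k m + 2 * (k * m) + q) = false := by
        constructor
        · intro q hq
          by_cases hq1 : q = 1
          · rw [hq1, hv, Function.update_self]
          · rw [hv, Function.update_of_ne (by omega), hu, resetTests]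
            by_cases hq0 : q = 0
            · rw [if_neg (by omega), swapBits_of_le hSk _ (by omega) (by omega), hq0, ht]
              simp
            · rw [if_pos (by omega)]
        · intro q hq
          rw [hv, Function.update_of_ne (by omega), hu, resetTests, if_pos (by omega)]
      rw [hf₁]
      dsimp only
      rw [receiverRest, if_pos haux, hjunk, hreg 0 (by omega), hreg (recvR k m) (by simp),
        hreg (k * m) (by omega), hreg (2 * (k * m)) (by omega)]
      have := swapBits_registers S s (k := k) (m := m)
      rw [← this]
      ring

/-- The basis state of the receiver in which all auxiliary wires are `1` and the other registers
have the given contents. -/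
def receiverState {k m : ℕ} (p : ((Qubits (k * m) × Qubits (k * m)) ×
    (Qubits (k * m) × Qubits (k * m))) × Qubits (k * m)) : ℕ → Bool := fun j =>
  if j < k * m then getBit p.1.2.1 j else if j < 2 * (k * m) then getBit p.1.1.1 (j - k * m)
  else if j < 3 * (k * m) then getBit p.1.1.2 (j - 2 * (k * m)) else if j < recvR k m then true
  else if j < recvR k m + k * m then getBit p.1.2.2 (j - recvR k m)
  else if j < recvR k m + 2 * (k * m) then getBit p.2 (j - (recvR k m + k * m)) else true

/-- The contents of the registers of the receiver. -/
def receiverData (k m : ℕ) (s : ℕ → Bool) : ((Qubits (k * m) × Qubits (k * m)) ×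
    (Qubits (k * m) × Qubits (k * m))) × Qubits (k * m) :=
  (((bitsAt s (k * m) (k * m), bitsAt s (2 * (k * m)) (k * m)),
    (bitsAt s 0 (k * m), bitsAt s (recvR k m) (k * m))),
    bitsAt s (recvR k m + k * m) (k * m))

theorem receiverData_congr {k m : ℕ} {s t : ℕ → Bool}
    (h : ∀ j < recvR k m + 2 * (k * m), s j = t j) : receiverData k m s = receiverData k m t := by
  have hD : recvR k m = 3 * (k * m) + k + 2 := rfl
  have h' : ∀ o, o + k * m ≤ recvR k m + 2 * (k * m) → bitsAt s o (k * m) = bitsAt t o (k * m) :=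
    fun o ho => bitsAt_congr fun i hi => h _ (by omega)
  simp only [receiverData]
  rw [h' _ (by omega), h' _ (by omega), h' _ (by omega), h' _ (by omega), h' _ (by omega)]

theorem receiverData_receiverState {k m : ℕ} (p : ((Qubits (k * m) × Qubits (k * m)) ×
    (Qubits (k * m) × Qubits (k * m))) × Qubits (k * m)) :
    receiverData k m (receiverState p) = p := by
  have hD : recvR k m = 3 * (k * m) + k + 2 := rfl
  refine Prod.ext (Prod.ext (Prod.ext ?_ ?_) (Prod.ext ?_ ?_)) ?_ <;>
  · dsimp only [receiverData]
    refine eq_bitsAt_iff.2 fun j hj => ?_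
    simp only [receiverState]
    split_ifs <;> first | omega | (congr 1; omega)

theorem receiverState_receiverData {k m : ℕ} {s : ℕ → Bool}
    (h1 : ∀ l < k + 2, s (3 * (k * m) + l) = true)
    (h2 : ∀ l < k, s (recvR k m + 2 * (k * m) + l) = true) {j : ℕ}
    (hj : j < recvR k m + 2 * (k * m) + k) : receiverState (receiverData k m s) j = s j := by
  have hD : recvR k m = 3 * (k * m) + k + 2 := rfl
  simp only [receiverState, receiverData, getBit, bitsAt]
  split_ifs <;> first
    | omega
    | (congr 1; omega)
    | (have := h1 (j - 3 * (k * m)) (by omega)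
       rw [Nat.add_sub_cancel' (by omega)] at this; exact this.symm)
    | (have := h2 (j - (recvR k m + 2 * (k * m))) (by omega)
       rw [Nat.add_sub_cancel' (by omega)] at this; exact this.symm)

/-- Writes the mixed input as a combination of operators built from vectors, one vector for each
basis state of C and R, so that the computation on amplitudes applies. -/
theorem receiverInput_ofBits {k m : ℕ} (θ : Ket m)
    (ρ : Matrix (Qubits (k * m) × Qubits (k * m)) (Qubits (k * m) × Qubits (k * m)) ℂ)
    (s s' : ℕ → Bool) :
    receiverInput k (recvR k m + 2 * (k * m) + k) θ ρ (ofBits _ s) (ofBits _ s') =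
      ∑ a, ∑ a', ρ a a' *
        (prepInput k (recvR k m) (recvR k m + k * m) θ (receiverRest k m a) s *
        star (prepInput k (recvR k m) (recvR k m + k * m) θ (receiverRest k m a') s')) := by
  have hD : recvR k m = 3 * (k * m) + k + 2 := rfl
  set w := recvR k m + 2 * (k * m) + k with hw
  have haux : ∀ s : ℕ → Bool, (∀ i : Fin w, k * m + k * m + k * m ≤ (i : ℕ) →
      ofBits w s i = false) ↔ ((∀ q < k * m, s (recvR k m + q) = false) ∧
      (∀ q < k * m, s (recvR k m + k * m + q) = false)) ∧
      (∀ q < k + 2, s (3 * (k * m) + q) = false) ∧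
      ∀ q < k, s (recvR k m + 2 * (k * m) + q) = false := by
    intro s
    refine (forall_fin_le (c := k * m + k * m + k * m) (by omega) (fun i => s i = false)).trans ?_
    have e : ∀ j, k * m + k * m + k * m ≤ j → k * m + k * m + k * m +
      (j - (k * m + k * m + k * m)) = j := fun j hj => Nat.add_sub_cancel' hj
    constructor
    · intro h
      have h' : ∀ j, k * m + k * m + k * m ≤ j → j < w → s j = false := fun j h1 h2 => by
        rw [← e j h1]; exact h _ (by omega)
      exact ⟨⟨fun q hq => h' _ (by omega) (by omega), fun q hq => h' _ (by omega) (by omega)⟩,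
        fun q hq => h' _ (by omega) (by omega), fun q hq => h' _ (by omega) (by omega)⟩
    · rintro ⟨⟨h1, h2⟩, h3, h4⟩ q hq
      by_cases c1 : q < k + 2
      · have := h3 q c1
        rwa [show 3 * (k * m) = k * m + k * m + k * m by omega] at this
      by_cases c2 : q < k + 2 + k * m
      · have := h1 (q - (k + 2)) (by omega)
        rwa [show recvR k m + (q - (k + 2)) = k * m + k * m + k * m + q by omega] at this
      by_cases c3 : q < k + 2 + 2 * (k * m)
      · have := h2 (q - (k + 2 + k * m)) (by omega)
        rwa [show recvR k m + k * m + (q - (k + 2 + k * m)) = k * m + k * m + k * m + q by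
          omega] at this
      · have := h4 (q - (k + 2 + 2 * (k * m))) (by omega)
        rwa [show recvR k m + 2 * (k * m) + (q - (k + 2 + 2 * (k * m))) =
          k * m + k * m + k * m + q by omega] at this
  have hwin : ∀ (s : ℕ → Bool) (i : Fin k), window (ofBits w s) (i * m) m = bitsAt s (i * m) m :=
    fun s i => window_ofBits (by have := block_bound (m := m) i; omega) s
  have hand : (∀ i : Fin w, k * m + k * m + k * m ≤ (i : ℕ) →
      ofBits w s i = false ∧ ofBits w s' i = false) ↔ (∀ i : Fin w, k * m + k * m + k * m ≤ (i : ℕ) →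
      ofBits w s i = false) ∧ ∀ i : Fin w, k * m + k * m + k * m ≤ (i : ℕ) →
      ofBits w s' i = false := by
    simp only [← forall_and]
  have hin : ∀ (s : ℕ → Bool) (a), prepInput k (recvR k m) (recvR k m + k * m) θ
      (receiverRest k m a) s = if (bitsAt s (k * m) (k * m), bitsAt s (2 * (k * m)) (k * m)) = a then
      (if ∀ i : Fin w, k * m + k * m + k * m ≤ (i : ℕ) → ofBits w s i = false then
        ∏ i : Fin k, θ (bitsAt s (i * m) m) else 0) else 0 := by
    intro s a
    rw [prepInput, receiverRest, if_congr (haux s) rfl rfl]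
    simp only [ite_and]
    split_ifs <;> simp
  simp only [hin]
  rw [receiverInput, if_congr hand rfl rfl, window_ofBits (by omega), window_ofBits (by omega),
    window_ofBits (by omega), window_ofBits (by omega), ← two_mul (k * m), ite_and, ketBra,
    Matrix.vecMulVec_apply, copiesOf, Pi.star_apply, copiesOf]
  simp only [hwin]
  rw [Finset.sum_eq_single (bitsAt s (k * m) (k * m), bitsAt s (2 * (k * m)) (k * m))
    (fun a _ ha => by simp [ha.symm]) (by simp),
    Finset.sum_eq_single (bitsAt s' (k * m) (k * m), bitsAt s' (2 * (k * m)) (k * m))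
    (fun a _ ha => by simp [ha.symm]) (by simp), if_pos rfl, if_pos rfl]
  split_ifs
  · ring
  all_goals simp

theorem prepInput_getBit_ofBits {k m w : ℕ} (hw : recvR k m + 2 * (k * m) + k ≤ w) (θ : Ket m)
    (a : Qubits (k * m) × Qubits (k * m)) (t : ℕ → Bool) :
    prepInput k (recvR k m) (recvR k m + k * m) θ (receiverRest k m a) (getBit (ofBits w t)) =
      prepInput k (recvR k m) (recvR k m + k * m) θ (receiverRest k m a) t := by
  have hD : recvR k m = 3 * (k * m) + k + 2 := rfl
  have ht : ∀ j < w, getBit (ofBits w t) j = t j := fun j hj => by rw [getBit, dif_pos hj, ofBits]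
  have hb : ∀ o b, o + b ≤ w → bitsAt (getBit (ofBits w t)) o b = bitsAt t o b :=
    fun o b hob => bitsAt_congr fun i hi => ht _ (by omega)
  rw [prepInput, prepInput, receiverRest, receiverRest, hb _ _ (by omega), hb _ _ (by omega)]
  congr 1
  · congr 1
    · congr 1
      · exact Finset.prod_congr rfl fun i _ => by
          rw [hb _ _ (by have := block_bound (m := m) i; omega)]
      · exact if_congr (forall₂_congr fun q hq => by rw [ht _ (by omega)]) rfl rfl
    · exact if_congr (forall₂_congr fun q hq => by rw [ht _ (by omega)]) rfl rfl
  · congr 1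
    exact if_congr (and_congr (forall₂_congr fun q hq => by rw [ht _ (by omega)])
      (forall₂_congr fun q hq => by rw [ht _ (by omega)])) rfl rfl

/-- The final amplitudes of the accepting branch, up to the factor `junk`. -/
def acceptAmp {m : ℕ} (k : ℕ) (θ : Ket m) (b : Bool) (a : Qubits (k * m) × Qubits (k * m)) :
    (Qubits (k * m) × Qubits (k * m)) × (Qubits (k * m) × Qubits (k * m)) → ℂ :=
  allTestsAccept k m *ᵥ fun d => (if d.1 = a then 1 else 0) * bigPsi k k θ b d.2

theorem receiver_entry {k m w : ℕ} (hw : w = recvR k m + 2 * (k * m) + k) (hkm : k ≤ m)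
    (hm : 0 < m) (θ : Ket m) (b : Bool)
    (ρ : Matrix (Qubits (k * m) × Qubits (k * m)) (Qubits (k * m) × Qubits (k * m)) ℂ)
    (s : ℕ → Bool) (hs : s (3 * (k * m)) = true) :
    (circuitUnitary ((receiverOps k m b).flatMap (Op.gates w)) * receiverInput k w θ ρ *
      (circuitUnitary ((receiverOps k m b).flatMap (Op.gates w)))ᴴ) (ofBits w s) (ofBits w s) =
    if (∀ l < k, s (recvR k m + 2 * (k * m) + l) = true) ∧
      ∀ l < k + 1, s (3 * (k * m) + 1 + l) = true then
      (∑ a, ∑ a', ρ a a' * (acceptAmp k θ b a (receiverData k m s).1 *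
        star (acceptAmp k θ b a' (receiverData k m s).1))) *
        (junk θ b (receiverData k m s).2 * star (junk θ b (receiverData k m s).2))
    else 0 := by
  have hfin : ∀ a, (circuitUnitary ((receiverOps k m b).flatMap (Op.gates w)) *ᵥ fun z =>
      prepInput k (recvR k m) (recvR k m + k * m) θ (receiverRest k m a) (getBit z))
        (ofBits w s) =
      if (∀ l < k, s (recvR k m + 2 * (k * m) + l) = true) ∧
        ∀ l < k + 1, s (3 * (k * m) + 1 + l) = true then
        acceptAmp k θ b a (receiverData k m s).1 * junk θ b (receiverData k m s).2
      else 0 := by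
    intro a
    rw [Op.mulVec_flatMap_gates (hw ▸ valid_receiverOps hkm b)]
    simp only [prepInput_getBit_ofBits hw.ge]
    exact acts_receiverOps hkm hm θ b a s hs
  subst hw
  rw [conj_sum_vecMulVec _ ρ (fun a z => prepInput k (recvR k m) (recvR k m + k * m) θ
    (receiverRest k m a) (getBit z)) fun z z' => by
      rw [← receiverInput_ofBits, ofBits_getBit, ofBits_getBit]]
  simp only [hfin]
  split_ifs
  · simp only [Finset.sum_mul]
    refine Finset.sum_congr rfl fun a _ => Finset.sum_congr rfl fun a' _ => ?_
    rw [star_mul']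
    ring
  · simp

/-- Among the strings with answer `1`, only those with all flags and controls at `1` contribute.
They are enumerated injectively by `receiverState`, and the auxiliary register sums to one by
`sum_junk`. -/
theorem probOne_receiver {k m w : ℕ} (hw : w = recvR k m + 2 * (k * m) + k) (hkm : k ≤ m)
    (hm : 0 < m) {θ : Ket m} (hθ : ‖θ‖ = 1) (b : Bool)
    (ρ : Matrix (Qubits (k * m) × Qubits (k * m)) (Qubits (k * m) × Qubits (k * m)) ℂ)
    (i : Fin w) (hi : (i : ℕ) = 3 * (k * m)) :
    probOne i (circuitUnitary ((receiverOps k m b).flatMap (Op.gates w)) *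
      receiverInput k w θ ρ * (circuitUnitary ((receiverOps k m b).flatMap (Op.gates w)))ᴴ) =
    (∑ d, ∑ a, ∑ a', ρ a a' * (acceptAmp k θ b a d * star (acceptAmp k θ b a' d))).re := by
  have hD : recvR k m = 3 * (k * m) + k + 2 := rfl
  rw [probOne]
  refine congrArg Complex.re ?_
  have hsum : (∑ d, ∑ a, ∑ a', ρ a a' * (acceptAmp k θ b a d * star (acceptAmp k θ b a' d))) =
      ∑ p : ((Qubits (k * m) × Qubits (k * m)) × (Qubits (k * m) × Qubits (k * m))) ×
        Qubits (k * m), (∑ a, ∑ a', ρ a a' * (acceptAmp k θ b a p.1 *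
          star (acceptAmp k θ b a' p.1))) * (junk θ b p.2 * star (junk θ b p.2)) := by
    refine Eq.trans ?_ (Fintype.sum_prod_type _).symm
    refine Finset.sum_congr rfl fun d _ => ?_
    dsimp only
    rw [← Finset.mul_sum, sum_junk hθ b, mul_one]
  rw [hsum]
  symm
  refine Fintype.sum_of_injective (fun p => ofBits w (receiverState p)) ?_ _ _ ?_ ?_
  · have : Function.LeftInverse (fun z : Qubits w => receiverData k m (getBit z))
        fun p => ofBits w (receiverState p) := by
      intro p
      dsimp only
      rw [receiverData_congr (t := receiverState p), receiverData_receiverState]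
      intro j hj
      simp only [getBit, ofBits]
      rw [dif_pos (by omega)]
    exact this.injective
  · intro z hz
    by_cases hans : z i = true
    · have hs : getBit z (3 * (k * m)) = true := by
        rw [getBit, dif_pos (by omega), ← hans]
        congr 1
        exact Fin.ext hi.symm
      rw [if_pos hans]
      conv_lhs => rw [← ofBits_getBit z]
      rw [receiver_entry hw hkm hm θ b ρ _ hs, if_neg]
      rintro ⟨h1, h2⟩
      apply hz
      refine ⟨receiverData k m (getBit z), ?_⟩
      dsimp only
      conv_rhs => rw [← ofBits_getBit z]
      funext i
      refine receiverState_receiverData (fun l hl => ?_) h1 (by have := i.isLt; omega)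
      by_cases hl0 : l = 0
      · rw [hl0]; exact hs
      · have := h2 (l - 1) (by omega)
        rwa [show 3 * (k * m) + 1 + (l - 1) = 3 * (k * m) + l by omega] at this
    · rw [if_neg hans]
  · intro p
    have haux : (∀ l < k, (receiverState p) (recvR k m + 2 * (k * m) + l) = true) ∧
        ∀ l < k + 2, (receiverState p) (3 * (k * m) + l) = true := by
      constructor <;>
      · intro l hl
        simp only [receiverState]
        split_ifs <;> first | omega | rfl
    have hans : ofBits w (receiverState p) i = true := by
      rw [ofBits, hi]
      exact haux.2 0 (by omega)
    rw [if_pos hans, receiver_entry hw hkm hm θ b ρ _ (haux.2 0 (by omega)), if_pos,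
      receiverData_receiverState]
    exact ⟨haux.1, fun l hl => by rw [add_assoc]; exact haux.2 _ (by omega)⟩

theorem isQPTReceiver {n : ℕ → ℕ} (hn : PolyBounded n) (hkn : ∀ k, k < n k) :
    (swapTestScheme n).IsQPTReceiver := by
  intro b
  refine ⟨_, _, isUniformPolyTime_receiver hn (fun k => (hkn k).le) b, fun k => ⟨?_,
    fun θ hθ ρ _ => ?_⟩⟩
  · change k * n k + k * n k + k * n k < 3 * (k * n k) + k + 2 + 2 * (k * n k) + k
    omega
  · refine Eq.trans ?_ (accept_eq k θ b ρ).symm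
    refine probOne_receiver rfl (hkn k).le (by have := hkn k; omega) hθ b ρ _ ?_
    change k * n k + k * n k + k * n k = 3 * (k * n k)
    ring

/-! ### Tensor powers of operators -/

section Tensor

variable {k : ℕ} {X Y D E : Type}

/-- The tensor product of operators on the factors of a register `X = D × ⋯ × D`. -/
def tensor (e : X ≃ (Fin k → D)) (A : Fin k → Matrix D D ℂ) : Matrix X X ℂ :=
  fun a a' => ∏ i, A i (e a i) (e a' i)

theorem sum_prod_equiv [Fintype X] [Fintype D] (e : X ≃ (Fin k → D)) (f : Fin k → D → ℂ) :
    ∑ a, ∏ i, f i (e a i) = ∏ i, ∑ y, f i y := by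
  classical
  rw [Fintype.prod_sum]
  exact Fintype.sum_equiv e _ _ fun _ => rfl

/-- A pair of registers, factor by factor. -/
def pairEquiv (e : X ≃ (Fin k → D)) (e' : Y ≃ (Fin k → E)) : X × Y ≃ (Fin k → D × E) :=
  (e.prodCongr e').trans (Equiv.arrowProdEquivProdArrow (Fin k) (fun _ => D) (fun _ => E)).symm

theorem pairEquiv_apply (e : X ≃ (Fin k → D)) (e' : Y ≃ (Fin k → E)) (a : X × Y) (i : Fin k) :
    pairEquiv e e' a i = (e a.1 i, e' a.2 i) := rfl

theorem tensor_mul [Fintype X] [Fintype D] (e : X ≃ (Fin k → D)) (A B : Fin k → Matrix D D ℂ) :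
    tensor e A * tensor e B = tensor e fun i => A i * B i := by
  ext a a'
  simp only [Matrix.mul_apply, tensor, ← Finset.prod_mul_distrib]
  exact sum_prod_equiv e fun i y => A i (e a i) y * B i y (e a' i)

theorem tensor_conjTranspose (e : X ≃ (Fin k → D)) (A : Fin k → Matrix D D ℂ) :
    (tensor e A)ᴴ = tensor e fun i => (A i)ᴴ := by
  ext a a'
  simp [tensor, Matrix.conjTranspose_apply]

theorem tensor_one [DecidableEq X] [DecidableEq D] (e : X ≃ (Fin k → D)) :
    tensor e (fun _ => 1) = 1 := by
  ext a a'
  simp only [tensor, Matrix.one_apply]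
  rw [prod_ite_one_zero]
  refine if_congr ?_ rfl rfl
  simp only [Finset.mem_univ, forall_const]
  rw [← funext_iff, e.apply_eq_iff_eq]

theorem tensor_smul (e : X ≃ (Fin k → D)) (c : Fin k → ℂ) (A : Fin k → Matrix D D ℂ) :
    tensor e (fun i => c i • A i) = (∏ i, c i) • tensor e A := by
  ext a a'
  simp [tensor, Finset.prod_mul_distrib]

theorem tensor_add (e : X ≃ (Fin k → D)) (A B : Matrix D D ℂ) :
    tensor e (fun _ => A + B) =
      ∑ S : Finset (Fin k), tensor e fun i => if i ∈ S then A else B := by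
  ext a a'
  simp only [tensor, Matrix.add_apply, Matrix.sum_apply, Finset.prod_add, Finset.powerset_univ]
  refine Finset.sum_congr rfl fun S _ => ?_
  rw [← Finset.prod_mul_prod_compl S fun i : Fin k => (if i ∈ S then A else B) (e a i) (e a' i)]
  congr 1
  · exact Finset.prod_congr rfl fun i hi => by rw [if_pos hi]
  · exact Finset.prod_congr rfl fun i hi => by rw [if_neg (Finset.mem_compl.1 hi)]

theorem tensor_kronecker_one [DecidableEq Y] [DecidableEq E] (e : X ≃ (Fin k → D))
    (e' : Y ≃ (Fin k → E)) (A : Fin k → Matrix D D ℂ) :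
    tensor (pairEquiv e e') (fun i => A i ⊗ₖ (1 : Matrix E E ℂ)) =
      tensor e A ⊗ₖ (1 : Matrix Y Y ℂ) := by
  ext a a'
  rw [Matrix.kroneckerMap_apply, ← tensor_one e']
  simp only [tensor, pairEquiv_apply, Matrix.kroneckerMap_apply, Finset.prod_mul_distrib]

end Tensor

/-! ### The SWAP tests as an operator on C and R -/

/-- The `k` pairs `(C_i, R_i)` of registers. -/
def pairsEquiv (k m : ℕ) : Qubits (k * m) × Qubits (k * m) ≃ (Fin k → Qubits m × Qubits m) :=
  pairEquiv (blockEquiv k m) (blockEquiv k m)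

theorem allTestsAccept_eq_tensor (k m : ℕ) : allTestsAccept k m =
    tensor (pairEquiv (pairsEquiv k m) (pairsEquiv k m)) fun _ => swapTestAccept _ := rfl

theorem swapTestAccept_conjTranspose {D : Type} [Fintype D] [DecidableEq D] :
    (swapTestAccept D)ᴴ = swapTestAccept D := by
  ext x y
  have e1 : x = y.swap ↔ y = x.swap := by constructor <;> rintro rfl <;> simp
  simp only [Matrix.conjTranspose_apply, swapTestAccept_apply, e1, eq_comm (a := x)]
  split_ifs <;> simp

theorem swapTestAccept_mul_self {D : Type} [Fintype D] [DecidableEq D] :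
    swapTestAccept D * swapTestAccept D = swapTestAccept D := by
  ext x y
  have e1 : ∀ z : D × D, y = z.swap ↔ z = y.swap := fun z => by
    constructor <;> rintro rfl <;> simp
  rw [Matrix.mul_apply]
  simp only [swapTestAccept_apply, e1, eq_comm (a := y), mul_add, mul_ite, mul_one, mul_zero, add_mul, ite_mul, zero_mul,
    Finset.sum_add_distrib, Finset.sum_ite_eq', Finset.mem_univ, if_true]
  have e2 : y.swap = x ↔ x = y.swap := eq_comm
  have e3 : y.swap = x.swap ↔ x = y := by rw [Prod.swap_inj, eq_comm]
  simp only [e2, e3]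
  split_ifs <;> norm_num

/-- The accepting operator of a SWAP test is the projection onto the symmetric subspace, hence so is
its tensor power a projection. -/
theorem allTestsAccept_conj_mul (k m : ℕ) :
    (allTestsAccept k m)ᴴ * allTestsAccept k m = allTestsAccept k m := by
  rw [allTestsAccept_eq_tensor, tensor_conjTranspose, tensor_mul]
  simp only [swapTestAccept_conjTranspose, swapTestAccept_mul_self]

/-- The operator of the event that the receiver accepts. -/
def acceptOp {m : ℕ} (k : ℕ) (θ : Ket m) (b : Bool) :
    Matrix (Qubits (k * m) × Qubits (k * m)) (Qubits (k * m) × Qubits (k * m)) ℂ :=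
  tensor (pairsEquiv k m) fun _ => (1 / 2 : ℂ) • (ketBra (psi k θ b) + 1)

/-- Against ψ in the second register, the identity part of (1 + SWAP)/2 leaves the identity, because
ψ is normalised, and the swap part leaves |ψ⟩⟨ψ|. -/
theorem partial_swapTest {D : Type} [Fintype D] [DecidableEq D] {ψ : D → ℂ}
    (hψ : ∑ x, ψ x * star (ψ x) = 1) (x x' : D) :
    ∑ p : D × D, swapTestAccept D (x, p.1) (x', p.2) * (ψ p.2 * star (ψ p.1)) =
      ((1 / 2 : ℂ) • (ketBra ψ + 1)) x x' := by
  simp only [swapTestAccept_apply, Prod.swap_prod_mk, Prod.mk.injEq, Matrix.smul_apply,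
    Matrix.add_apply, Matrix.one_apply, ketBra, Matrix.vecMulVec_apply, smul_eq_mul,
    Fintype.sum_prod_type, mul_assoc, ← Finset.mul_sum, add_mul, Finset.sum_add_distrib, ite_mul,
    one_mul, zero_mul, ite_and, Pi.star_apply]
  congr 2
  · rw [Finset.sum_eq_single x' (fun y _ hy => by simp [hy.symm]) (by simp)]
    simp
  · have : ∀ y, (∑ y', if x' = x then if y' = y then ψ y' * star (ψ y) else 0 else 0) =
        if x = x' then ψ y * star (ψ y) else 0 := fun y => by
      by_cases h : x' = x
      · simp [h]
      · simp [h, Ne.symm h]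
    simp only [this]
    split_ifs
    · exact hψ
    · simp

/-- Tests and reference state are both products over the pairs, so the reference register can be
traced out pair by pair. -/
theorem accept_eq_trace {n : ℕ → ℕ} (k : ℕ) (θ : Ket (n k)) (b : Bool)
    (hψ : ∑ x, psi k θ b x * star (psi k θ b x) = 1)
    (ρ : Matrix (Qubits (k * n k) × Qubits (k * n k)) (Qubits (k * n k) × Qubits (k * n k)) ℂ) :
    (swapTestScheme n).accept k θ b ρ = (ρ * acceptOp k θ b).trace.re := by
  change Complex.re (Matrix.trace (allTestsAccept k (n k) * (ρ ⊗ₖ ketBra (bigPsi k k θ b)) *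
      (allTestsAccept k (n k))ᴴ)) = _
  rw [Matrix.trace_mul_comm, ← Matrix.mul_assoc, allTestsAccept_conj_mul]
  congr 1
  simp only [Matrix.trace, Matrix.diag_apply, Matrix.mul_apply, Matrix.kroneckerMap_apply]
  have h : ∀ x x', ∑ p : (Qubits (k * n k) × Qubits (k * n k)) × (Qubits (k * n k) × Qubits (k * n k)),
      allTestsAccept k (n k) (x, p.1) (x', p.2) *
        ketBra (bigPsi k k θ b) p.2 p.1 = acceptOp k θ b x x' := by
    intro x x'
    rw [acceptOp, tensor]
    simp only [← partial_swapTest hψ]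
    rw [← sum_prod_equiv (pairEquiv (pairsEquiv k (n k)) (pairsEquiv k (n k))) fun i p =>
      swapTestAccept _ (pairsEquiv k (n k) x i, p.1) (pairsEquiv k (n k) x' i, p.2) *
      (psi k θ b p.2 * star (psi k θ b p.1))]
    refine Finset.sum_congr rfl fun p _ => ?_
    simp only [Finset.prod_mul_distrib, pairEquiv_apply, ketBra, Matrix.vecMulVec_apply, bigPsi,
      Pi.star_apply, star_prod]
    rfl
  rw [Finset.sum_comm (f := fun x x' => ρ x x' * _)]
  simp only [← h, Finset.mul_sum]
  rw [Fintype.sum_prod_type]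
  refine Finset.sum_congr rfl fun x' _ => ?_
  rw [Finset.sum_congr rfl fun p _ => Fintype.sum_prod_type _, Finset.sum_comm]
  refine Finset.sum_congr rfl fun x _ => ?_
  refine Eq.trans ?_ (Fintype.sum_prod_type _).symm
  exact Finset.sum_congr rfl fun p _ => Finset.sum_congr rfl fun p' _ => by ring

/-! ### Normalisation of the states and perfect correctness -/

theorem sum_prefixSupported {k m : ℕ} (hkm : k ≤ m) :
    ∑ r : Qubits m, (if ∀ j : Fin m, k ≤ (j : ℕ) → r j = false then (1 : ℂ) else 0) = 2 ^ k := by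
  have h : ∀ r : Qubits m, (if ∀ j : Fin m, k ≤ (j : ℕ) → r j = false then (1 : ℂ) else 0) =
      ∏ j : Fin m, if k ≤ (j : ℕ) → r j = false then 1 else 0 := fun r => by
    rw [prod_ite_one_zero]
    simp
  simp only [h]
  rw [← Fintype.prod_sum fun (j : Fin m) (b : Bool) => if k ≤ (j : ℕ) → b = false then (1 : ℂ)
    else 0]
  have h2 : ∀ j : Fin m, (∑ b : Bool, if k ≤ (j : ℕ) → b = false then (1 : ℂ) else 0) =
      if (j : ℕ) < k then 2 else 1 := fun j => by
    by_cases hj : (j : ℕ) < k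
    · have : ¬ k ≤ (j : ℕ) := by omega
      simp only [this, hj, false_imp_iff, if_true, Fintype.sum_bool]
      norm_num
    · have : k ≤ (j : ℕ) := by omega
      simp [this, hj]
  rw [Finset.prod_congr rfl fun j _ => h2 j, Fin.prod_univ_eq_prod_range
    (fun j => if j < k then (2 : ℂ) else 1) m, Finset.prod_ite, Finset.prod_const,
    Finset.prod_const_one, mul_one]
  congr 1
  have : (Finset.range m).filter (fun j => j < k) = Finset.range k := by
    ext j; simp; omega
  rw [this, Finset.card_range]

theorem inv_sqrt_mul_star (k : ℕ) :
    ((√(2 ^ k) : ℝ) : ℂ)⁻¹ * star ((√(2 ^ k) : ℝ) : ℂ)⁻¹ = (2 ^ k)⁻¹ := by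
  rw [star_inv₀, Complex.star_def, Complex.conj_ofReal, ← mul_inv, ← Complex.ofReal_mul,
    Real.mul_self_sqrt (by positivity)]
  simp

theorem Op.sgn_mul_star (b : Bool) : sgn b * star (sgn b) = 1 := by
  cases b <;> simp [sgn]

/-- For the bit 0 the signs have modulus one, and each of the `2 ^ k` labels supported on the prefix
carries the weight of `θ` divided by `2 ^ k`. -/
theorem sum_psi {k m : ℕ} (hkm : k ≤ m) {θ : Ket m} (hθ : ‖θ‖ = 1) (b : Bool) :
    ∑ x, psi k θ b x * star (psi k θ b x) = 1 := by
  cases b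
  · have h : ∀ a : Qubits m × Qubits m, psi k θ false a * star (psi k θ false a) =
        (2 ^ k)⁻¹ * ((if ∀ j : Fin m, k ≤ (j : ℕ) → a.2 j = false then 1 else 0) *
          (θ a.1 * star (θ a.1))) := fun a => by
      change psiZero k θ a * star (psiZero k θ a) = _
      have hs : (∏ j : Fin k, Op.sgn (window a.1 0 k j && window a.2 0 k j)) *
          star (∏ j : Fin k, Op.sgn (window a.1 0 k j && window a.2 0 k j)) = 1 := by
        rw [star_prod, ← Finset.prod_mul_distrib]
        exact Finset.prod_eq_one fun j _ => Op.sgn_mul_star _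
      rw [psiZero_apply hkm, star_mul', star_mul', star_mul', ← inv_sqrt_mul_star k]
      split_ifs
      · rw [star_one]
        linear_combination (((√(2 ^ k) : ℝ) : ℂ)⁻¹ * star ((√(2 ^ k) : ℝ) : ℂ)⁻¹) *
          (θ a.1 * star (θ a.1)) * hs
      · simp
    rw [Finset.sum_congr rfl fun a _ => h a, ← Finset.mul_sum, Fintype.sum_prod_type]
    simp only [← Finset.sum_mul, sum_prefixSupported hkm]
    rw [← Finset.mul_sum, sum_mul_star_of_norm hθ, mul_one]
    exact inv_mul_cancel₀ (by positivity)
  · have h : ∀ a : Qubits m × Qubits m, psi k θ true a * star (psi k θ true a) =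
        (2 ^ m)⁻¹ * if a.1 = a.2 then 1 else 0 := fun a => by
      change psiOne m a * star (psiOne m a) = _
      rw [psiOne_apply, star_mul', ← inv_sqrt_mul_star m]
      split_ifs <;> simp
    rw [Finset.sum_congr rfl fun a _ => h a, ← Finset.mul_sum, Fintype.sum_prod_type]
    simp

theorem tensor_mulVec_prod {k : ℕ} {X D : Type} [Fintype X] [Fintype D] (e : X ≃ (Fin k → D))
    (A : Fin k → Matrix D D ℂ) (v : Fin k → D → ℂ) :
    (tensor e A *ᵥ fun a => ∏ i, v i (e a i)) = fun a => ∏ i, (A i *ᵥ v i) (e a i) := by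
  funext a
  simp only [Matrix.mulVec, dotProduct, tensor, ← Finset.prod_mul_distrib]
  exact sum_prod_equiv e fun i y => A i (e a i) y * v i y

theorem ketBra_mulVec_self {D : Type} [Fintype D] {ψ : D → ℂ}
    (hψ : ∑ x, ψ x * star (ψ x) = 1) : ketBra ψ *ᵥ ψ = ψ := by
  funext x
  simp only [Matrix.mulVec, dotProduct, ketBra, Matrix.vecMulVec_apply, Pi.star_apply, mul_assoc,
    ← Finset.mul_sum]
  simp only [mul_comm (star _)]
  rw [hψ, mul_one]

theorem acceptOp_mulVec {k m : ℕ} (hkm : k ≤ m) {θ : Ket m} (hθ : ‖θ‖ = 1) (b : Bool) :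
    acceptOp k θ b *ᵥ bigPsi k k θ b = bigPsi k k θ b := by
  refine (tensor_mulVec_prod (pairsEquiv k m) _ fun _ => psi k θ b).trans ?_
  have : ((1 / 2 : ℂ) • (ketBra (psi k θ b) + 1)) *ᵥ psi k θ b = psi k θ b := by
    rw [Matrix.smul_mulVec, Matrix.add_mulVec, ketBra_mulVec_self (sum_psi hkm hθ b),
      Matrix.one_mulVec, ← two_smul ℂ, smul_smul]
    norm_num
  simp only [this]
  rfl

theorem sum_bigPsi {k m : ℕ} (hkm : k ≤ m) {θ : Ket m} (hθ : ‖θ‖ = 1) (b : Bool) :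
    ∑ a, bigPsi k k θ b a * star (bigPsi k k θ b a) = 1 := by
  simp only [bigPsi, star_prod, ← Finset.prod_mul_distrib]
  refine (sum_prod_equiv (pairsEquiv k m) fun _ y => psi k θ b y * star (psi k θ b y)).trans ?_
  exact Finset.prod_eq_one fun _ _ => sum_psi hkm hθ b

theorem isPerfectlyCorrect {n : ℕ → ℕ} (hkn : ∀ k, k ≤ n k) :
    (swapTestScheme n).IsPerfectlyCorrect := by
  intro k θ hθ b
  refine (accept_eq_trace k θ b (sum_psi (hkn k) hθ b) _).trans ?_
  change Complex.re (Matrix.trace (ketBra (bigPsi k k θ b) * acceptOp k θ b)) = 1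
  rw [Matrix.trace_mul_comm, ketBra, Matrix.mul_vecMulVec, Matrix.trace_vecMulVec,
    acceptOp_mulVec (hkn k) hθ]
  exact congrArg Complex.re (sum_bigPsi (hkn k) hθ b)

/-! ### The Haar measure on pure states -/

instance isProbabilityMeasure_haarState (m : ℕ) : IsProbabilityMeasure (haarState m) := by
  refine ⟨?_⟩
  rw [haarState, Measure.smul_apply, smul_eq_mul]
  refine ENNReal.inv_mul_cancel ?_ (measure_ne_top _ _)
  rw [Measure.measure_univ_ne_zero]
  exact Measure.toSphere_ne_zero _

theorem integrable_haarState {m : ℕ} {E : Type} [NormedAddCommGroup E]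
    {f : Metric.sphere (0 : Ket m) 1 → E} (hf : Continuous f) : Integrable f (haarState m) :=
  hf.integrable_of_hasCompactSupport (HasCompactSupport.of_compactSpace f)

/-- The action of a unitary operator on pure states. -/
def sphereMap {m : ℕ} (U : Ket m ≃ₗᵢ[ℂ] Ket m) (θ : Metric.sphere (0 : Ket m) 1) :
    Metric.sphere (0 : Ket m) 1 :=
  ⟨U θ, by simp⟩

theorem continuous_sphereMap {m : ℕ} (U : Ket m ≃ₗᵢ[ℂ] Ket m) : Continuous (sphereMap U) :=
  (U.continuous.comp continuous_subtype_val).subtype_mk _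

/-- A linear equivalence scales Haar measure by a constant; the unit ball is preserved and has
finite positive measure, so the constant is 1. -/
theorem addHaar_preimage_isometry {m : ℕ} (U : Ket m ≃ₗᵢ[ℂ] Ket m) (s : Set (Ket m)) :
    (Measure.addHaar : Measure (Ket m)) (U ⁻¹' s) = Measure.addHaar s := by
  set L : Ket m ≃L[ℝ] Ket m := U.toContinuousLinearEquiv.restrictScalars ℝ with hL
  obtain ⟨c, h⟩ : ∃ c, ∀ s, (Measure.addHaar : Measure (Ket m)) (L ⁻¹' s) =
      c * Measure.addHaar s :=
    ⟨_, Measure.addHaar_preimage_continuousLinearEquiv (Measure.addHaar : Measure (Ket m)) L⟩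
  have hball : (L : Ket m → Ket m) ⁻¹' Metric.ball 0 1 = Metric.ball 0 1 := by
    have := U.preimage_ball 0 1
    rwa [map_zero] at this
  have h1 := h (Metric.ball 0 1)
  rw [hball] at h1
  have h0 : (Measure.addHaar : Measure (Ket m)) (Metric.ball 0 1) ≠ 0 :=
    (Metric.measure_ball_pos _ _ one_pos).ne'
  have h2 : c = 1 :=
    (ENNReal.mul_eq_right h0 measure_ball_lt_top.ne).1 h1.symm
  have h3 := h s
  rw [h2, one_mul] at h3
  exact h3

-- Up to a constant, the surface measure of a set is the volume of the cone over it, and a unitary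
-- map carries cones to cones.
open scoped Pointwise in
theorem measurePreserving_sphereMap {m : ℕ} (U : Ket m ≃ₗᵢ[ℂ] Ket m) :
    MeasurePreserving (sphereMap U) (haarState m) (haarState m) := by
  refine ⟨(continuous_sphereMap U).measurable, ?_⟩
  ext s hs
  rw [Measure.map_apply (continuous_sphereMap U).measurable hs, haarState, Measure.smul_apply,
    Measure.smul_apply, Measure.toSphere_apply' _ hs,
    Measure.toSphere_apply' _ ((continuous_sphereMap U).measurable hs),
    ← addHaar_preimage_isometry U (Set.Ioo (0 : ℝ) 1 • (Subtype.val '' s))]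
  congr 3
  ext x
  simp only [Set.mem_smul, Set.mem_image, Set.mem_preimage, Subtype.exists, exists_and_right,
    exists_eq_right]
  constructor
  · rintro ⟨r, hr, y, ⟨hy, hys⟩, rfl⟩
    exact ⟨r, hr, U y, ⟨by simpa using hy, hys⟩, (map_smul U (r : ℂ) y).symm⟩
  · rintro ⟨r, hr, y, ⟨hy, hys⟩, hx⟩
    refine ⟨r, hr, U.symm y, ⟨by simpa using hy, ?_⟩, ?_⟩
    · have : sphereMap U ⟨U.symm y, by simpa using hy⟩ = ⟨y, hy⟩ := Subtype.ext (by simp [sphereMap])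
      rwa [this]
    · apply U.injective
      rw [← hx]
      exact (map_smul U (r : ℂ) (U.symm y)).trans (by simp)

theorem integral_sphereMap {m : ℕ} {E : Type} [NormedAddCommGroup E] [NormedSpace ℝ E]
    (U : Ket m ≃ₗᵢ[ℂ] Ket m) {f : Metric.sphere (0 : Ket m) 1 → E} (hf : Continuous f) :
    ∫ θ, f (sphereMap U θ) ∂(haarState m) = ∫ θ, f θ ∂(haarState m) := by
  have h := measurePreserving_sphereMap U
  conv_rhs => rw [← h.map_eq]
  rw [integral_map h.measurable.aemeasurable hf.aestronglyMeasurable]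

/-! ### Sum-binding -/

section Projections

variable {X : Type} [Fintype X]

theorem re_trace_mul_nonneg {Y : Type} [Fintype Y] {ρ : Matrix X X ℂ} (hρ : ρ.PosSemidef)
    (C : Matrix Y X ℂ) : 0 ≤ (ρ * (Cᴴ * C)).trace.re := by
  rw [← Matrix.mul_assoc, Matrix.trace_mul_comm, ← Matrix.mul_assoc]
  exact (Complex.nonneg_iff.1 (hρ.mul_mul_conjTranspose_same C).trace_nonneg).1

theorem isStarProjection_iff_conjTranspose {P : Matrix X X ℂ} :
    IsStarProjection P ↔ Pᴴ = P ∧ P * P = P :=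
  ⟨fun h => ⟨h.isSelfAdjoint, h.isIdempotentElem⟩, fun h => ⟨h.2, h.1⟩⟩

theorem re_trace_le_of_mul_eq {ρ P Q : Matrix X X ℂ} (hρ : ρ.PosSemidef)
    (hP : IsStarProjection P) (hQ : IsStarProjection Q) (h : Q * P = P) :
    (ρ * P).trace.re ≤ (ρ * Q).trace.re := by
  have h1 := isStarProjection_iff_conjTranspose.1 (hP.sub_of_mul_eq_right hQ h)
  have := re_trace_mul_nonneg hρ (Q - P)
  rw [h1.1, h1.2, Matrix.mul_sub, Matrix.trace_sub, Complex.sub_re] at this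
  linarith

/-- Two projections with a small overlap are almost mutually exclusive. -/
theorem re_trace_add_le [DecidableEq X] {ρ P Q : Matrix X X ℂ} (hρ : ρ.PosSemidef)
    (hP : IsStarProjection P) (hQ : IsStarProjection Q) {c s : ℝ} (hs : 0 < s) (hcs : c ≤ s ^ 2)
    (h : P * Q * P = (c : ℂ) • P) :
    (ρ * P).trace.re + (ρ * Q).trace.re ≤ (1 + s) * ρ.trace.re := by
  obtain ⟨hP1, hP2⟩ := isStarProjection_iff_conjTranspose.1 hP
  obtain ⟨hQ1, hQ2⟩ := isStarProjection_iff_conjTranspose.1 hQ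
  -- Write p, q, t for the traces of ρ against P, Q, 1 and x + y for that against PQ + QP. The first
  -- square gives (1 + 2s)(p + q) - (x + y) ≤ (1 + s)² t. The second gives s(x + y) ≤ s² q + c p, so
  -- x + y ≤ s(p + q). Together these yield the claim after division by 1 + s.
  have a1 := re_trace_mul_nonneg hρ ((1 + s : ℂ) • 1 - P - Q)
  have a2 := re_trace_mul_nonneg hρ ((s : ℂ) • Q - Q * P)
  have a3 := re_trace_mul_nonneg hρ P
  have e1 : ((1 + s : ℂ) • 1 - P - Q)ᴴ * ((1 + s : ℂ) • 1 - P - Q) =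
      ((1 + s) ^ 2 : ℂ) • (1 : Matrix X X ℂ) - (1 + 2 * s : ℂ) • (P + Q) + (P * Q + Q * P) := by
    simp only [Matrix.conjTranspose_sub, Matrix.conjTranspose_smul, Matrix.conjTranspose_one,
      hP1, hQ1, star_add, star_one, Complex.star_def, Complex.conj_ofReal, Matrix.sub_mul,
      Matrix.mul_sub, Matrix.smul_mul, Matrix.mul_smul, Matrix.one_mul, Matrix.mul_one, hP2, hQ2]
    module
  have e2 : ((s : ℂ) • Q - Q * P)ᴴ * ((s : ℂ) • Q - Q * P) =
      ((s ^ 2 : ℝ) : ℂ) • Q - (s : ℂ) • (P * Q + Q * P) + (c : ℂ) • P := by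
    have q1 : P * Q * (Q * P) = (c : ℂ) • P := by
      rw [Matrix.mul_assoc, ← Matrix.mul_assoc Q, hQ2, ← Matrix.mul_assoc, h]
    have q2 : P * Q * Q = P * Q := by rw [Matrix.mul_assoc, hQ2]
    have q3 : Q * (Q * P) = Q * P := by rw [← Matrix.mul_assoc, hQ2]
    simp only [Matrix.conjTranspose_sub, Matrix.conjTranspose_smul, Matrix.conjTranspose_mul,
      hP1, hQ1, Complex.star_def, Complex.conj_ofReal, Matrix.sub_mul,
      Matrix.mul_sub, Matrix.smul_mul, Matrix.mul_smul, hQ2, q1, q2, q3]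
    push_cast
    module
  rw [e1] at a1
  rw [e2] at a2
  rw [hP1, hP2] at a3
  have r1 : (((1 : ℂ) + s) ^ 2) = (((1 + s) ^ 2 : ℝ) : ℂ) := by push_cast; ring
  have r2 : ((1 : ℂ) + 2 * s) = ((1 + 2 * s : ℝ) : ℂ) := by push_cast; ring
  simp only [r1, r2, Matrix.mul_add, Matrix.mul_sub, Matrix.mul_smul, Matrix.trace_add,
    Matrix.trace_sub, Matrix.trace_smul, Matrix.mul_one, Complex.add_re, Complex.sub_re,
    smul_eq_mul, Complex.re_ofReal_mul] at a1 a2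
  set p := (ρ * P).trace.re
  set q := (ρ * Q).trace.re
  set t := ρ.trace.re
  set x := (ρ * (P * Q)).trace.re
  set y := (ρ * (Q * P)).trace.re
  have h2 : s * (x + y) ≤ s * (s * (p + q)) := by nlinarith [mul_le_mul_of_nonneg_right hcs a3]
  have h3 : x + y ≤ s * (p + q) := le_of_mul_le_mul_left h2 hs
  have h4 : (1 + s) * (p + q) ≤ (1 + s) * ((1 + s) * t) := by nlinarith
  exact le_of_mul_le_mul_left h4 (by linarith)

theorem isStarProjection_ketBra {ψ : X → ℂ} (hψ : ∑ x, ψ x * star (ψ x) = 1) :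
    IsStarProjection (ketBra ψ) := by
  refine isStarProjection_iff_conjTranspose.2 ⟨?_, ?_⟩
  · simp [ketBra, Matrix.conjTranspose_vecMulVec]
  · conv_lhs => rw [ketBra, Matrix.mul_vecMulVec]
    rw [← ketBra, ketBra_mulVec_self hψ, ketBra]

theorem isStarProjection_tensor {k : ℕ} {D : Type} [Fintype D] (e : X ≃ (Fin k → D))
    {A : Fin k → Matrix D D ℂ} (hA : ∀ i, IsStarProjection (A i)) :
    IsStarProjection (tensor e A) := by
  refine isStarProjection_iff_conjTranspose.2 ⟨?_, ?_⟩
  · rw [tensor_conjTranspose]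
    simp only [(isStarProjection_iff_conjTranspose.1 (hA _)).1]
  · rw [tensor_mul]
    simp only [(isStarProjection_iff_conjTranspose.1 (hA _)).2]

end Projections

/-! ### Channels on one of two registers -/

section Channels

variable {S A B : Type} [Fintype S] [DecidableEq S] [Fintype A] [DecidableEq A] [Fintype B]

theorem QChannel.apply_posSemidef (Φ : QChannel A B) {ρ : Matrix A A ℂ} (hρ : ρ.PosSemidef) :
    (Φ.apply ρ).PosSemidef :=
  Matrix.posSemidef_sum _ fun _ _ => hρ.mul_mul_conjTranspose_same _

theorem QChannel.trace_apply (Φ : QChannel A B) (ρ : Matrix A A ℂ) :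
    (Φ.apply ρ).trace = ρ.trace := by
  rw [QChannel.apply, Matrix.trace_sum]
  simp only [Matrix.trace_mul_comm _ (_ᴴ), ← Matrix.mul_assoc]
  rw [← Matrix.trace_sum, ← Matrix.sum_mul, Φ.complete, Matrix.one_mul]

theorem QChannel.applyRight_posSemidef (Φ : QChannel A B) {ρ : Matrix (S × A) (S × A) ℂ}
    (hρ : ρ.PosSemidef) : (Φ.applyRight ρ).PosSemidef :=
  Matrix.posSemidef_sum _ fun _ _ => hρ.mul_mul_conjTranspose_same _

/-- A channel on the second register does not change the first register. -/
theorem QChannel.trace_applyRight_mul [DecidableEq B] (Φ : QChannel A B)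
    (ρ : Matrix (S × A) (S × A) ℂ) (O : Matrix S S ℂ) :
    (Φ.applyRight ρ * (O ⊗ₖ (1 : Matrix B B ℂ))).trace =
      (ρ * (O ⊗ₖ (1 : Matrix A A ℂ))).trace := by
  have h : ∀ i, (((1 : Matrix S S ℂ) ⊗ₖ Φ.kraus i) * ρ * ((1 : Matrix S S ℂ) ⊗ₖ Φ.kraus i)ᴴ *
      (O ⊗ₖ (1 : Matrix B B ℂ))).trace = (ρ * (O ⊗ₖ ((Φ.kraus i)ᴴ * Φ.kraus i))).trace := by
    intro i
    rw [Matrix.trace_mul_comm, ← Matrix.mul_assoc, ← Matrix.mul_assoc, Matrix.trace_mul_comm,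
      ← Matrix.mul_assoc, Matrix.trace_mul_comm, Matrix.conjTranspose_kronecker,
      ← Matrix.mul_kronecker_mul, ← Matrix.mul_kronecker_mul]
    simp
  rw [QChannel.applyRight, Matrix.sum_mul, Matrix.trace_sum, Finset.sum_congr rfl fun i _ => h i,
    ← Matrix.trace_sum, ← Matrix.mul_sum, ← Φ.complete]
  congr 2
  ext a b
  simp [Matrix.sum_apply, Matrix.kroneckerMap_apply, Finset.mul_sum]

end Channels

/-! ### Restrictions of the common state to prefixes -/

section Prefix

variable {k m : ℕ}

/-- The weight of the state `θ` on the labels that start with `p`. -/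
def prefixWeight (k : ℕ) (θ : Ket m) (p : Qubits k) : ℝ :=
  ∑ x : Qubits m, if window x 0 k = p then ‖θ x‖ ^ 2 else 0

theorem prefixWeight_eq (θ : Ket m) (p : Qubits k) :
    prefixWeight k θ p = ∑ x : Qubits m with window x 0 k = p, ‖θ x‖ ^ 2 :=
  (Finset.sum_filter _ _).symm

theorem prefixWeight_nonneg (θ : Ket m) (p : Qubits k) : 0 ≤ prefixWeight k θ p :=
  Finset.sum_nonneg fun _ _ => by positivity

/-- The projection onto the span of the restrictions of `θ` to the labels with a given prefix. -/
def prefixProj (k : ℕ) (θ : Ket m) : Matrix (Qubits m) (Qubits m) ℂ := fun x x' =>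
  if window x 0 k = window x' 0 k then
    ((prefixWeight k θ (window x 0 k))⁻¹ : ℂ) * (θ x * star (θ x')) else 0

/-- If a prefix has weight zero then `θ` vanishes there, so the default value `0⁻¹ = 0` is harmless.
-/
theorem weight_inv_mul_weight_mul (θ : Ket m) (x : Qubits m) :
    ((prefixWeight k θ (window x 0 k))⁻¹ : ℂ) * prefixWeight k θ (window x 0 k) * θ x = θ x := by
  by_cases h : prefixWeight k θ (window x 0 k) = 0
  · have h0 := (Finset.sum_eq_zero_iff_of_nonneg fun y _ => by positivity).1 h x
      (Finset.mem_univ _)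
    rw [if_pos rfl, sq_eq_zero_iff, norm_eq_zero] at h0
    rw [h0, mul_zero]
  · rw [inv_mul_cancel₀ (by exact_mod_cast h), one_mul]

/-- The projection fixes the vectors that are proportional to `θ` on the labels with a given
prefix. -/
theorem prefixProj_apply_sum (θ : Ket m) (g : Qubits k → ℂ) (x : Qubits m) :
    ∑ x', prefixProj k θ x x' * (g (window x' 0 k) * θ x') = g (window x 0 k) * θ x := by
  have h : ∀ x', prefixProj k θ x x' * (g (window x' 0 k) * θ x') =
      ((prefixWeight k θ (window x 0 k))⁻¹ : ℂ) * θ x * g (window x 0 k) *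
        ((if window x' 0 k = window x 0 k then ‖θ x'‖ ^ 2 else 0 : ℝ) : ℂ) := by
    intro x'
    rw [prefixProj]
    by_cases hx : window x 0 k = window x' 0 k
    · rw [if_pos hx, if_pos hx.symm, ← hx, ← Complex.normSq_eq_norm_sq, ← Complex.mul_conj,
        Complex.star_def]
      ring
    · rw [if_neg hx, if_neg (Ne.symm hx)]
      simp
  rw [Finset.sum_congr rfl fun x' _ => h x', ← Finset.mul_sum, ← Complex.ofReal_sum,
    ← prefixWeight]
  linear_combination g (window x 0 k) * weight_inv_mul_weight_mul θ x

theorem isStarProjection_prefixProj (θ : Ket m) : IsStarProjection (prefixProj k θ) := by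
  refine isStarProjection_iff_conjTranspose.2 ⟨?_, ?_⟩
  · ext x x'
    rw [Matrix.conjTranspose_apply, prefixProj, prefixProj]
    by_cases hx : window x 0 k = window x' 0 k
    · rw [if_pos hx, if_pos hx.symm, hx, star_mul', star_mul', star_star, star_inv₀,
        Complex.star_def, Complex.conj_ofReal]
      ring
    · rw [if_neg hx, if_neg (Ne.symm hx), star_zero]
  · ext x x'
    rw [Matrix.mul_apply]
    have h : ∀ y, prefixProj k θ y x' = (if window y 0 k = window x' 0 k then
        ((prefixWeight k θ (window y 0 k))⁻¹ : ℂ) * star (θ x') else 0) * θ y := by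
      intro y
      rw [prefixProj]
      split_ifs <;> ring
    rw [h x, ← prefixProj_apply_sum θ (fun p => if p = window x' 0 k then
        ((prefixWeight k θ p)⁻¹ : ℂ) * star (θ x') else 0) x]
    exact Finset.sum_congr rfl fun y _ => by rw [h y]

/-- At a fixed label of the second register, ψ_0 is `θ` times a function of the prefix, because Z^s
acts on the prefix only. -/
theorem prefixProj_mulVec_psiZero (hkm : k ≤ m) (θ : Ket m) :
    (prefixProj k θ ⊗ₖ (1 : Matrix (Qubits m) (Qubits m) ℂ)) *ᵥ psiZero k θ = psiZero k θ := by
  funext a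
  set g : Qubits k → ℂ := fun p => ((√(2 ^ k) : ℝ) : ℂ)⁻¹ *
      ((if ∀ j : Fin m, k ≤ (j : ℕ) → a.2 j = false then 1 else 0) *
        (∏ j : Fin k, Op.sgn (p j && window a.2 0 k j))) with hg
  have h : ∀ x, psiZero k θ (x, a.2) = g (window x 0 k) * θ x := fun x => by
    rw [psiZero_apply hkm, hg]
    ring
  rw [← Prod.mk.eta (p := a), h, ← prefixProj_apply_sum]
  simp only [Matrix.mulVec, dotProduct, Fintype.sum_prod_type, Matrix.kroneckerMap_apply,
    Matrix.one_apply, mul_ite, mul_one, mul_zero, ite_mul, zero_mul, Finset.sum_ite_eq,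
    Finset.mem_univ, if_true, h]

/-- Each prefix contributes at most one dimension: its diagonal entries add up to 1, or to 0 if its
weight vanishes. -/
theorem trace_prefixProj_le (θ : Ket m) :
    ∃ t : ℝ, 0 ≤ t ∧ t ≤ 2 ^ k ∧ (prefixProj k θ).trace = t := by
  refine ⟨∑ x : Qubits m, (prefixWeight k θ (window x 0 k))⁻¹ * ‖θ x‖ ^ 2, ?_, ?_, ?_⟩
  · exact Finset.sum_nonneg fun x _ => mul_nonneg (inv_nonneg.2 (prefixWeight_nonneg θ _))
      (by positivity)
  · rw [← Finset.sum_fiberwise Finset.univ fun x : Qubits m => window x 0 k]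
    have h : ∀ p : Qubits k, (∑ x : Qubits m with window x 0 k = p,
        (prefixWeight k θ (window x 0 k))⁻¹ * ‖θ x‖ ^ 2) ≤ 1 := by
      intro p
      have : (∑ x : Qubits m with window x 0 k = p,
          (prefixWeight k θ (window x 0 k))⁻¹ * ‖θ x‖ ^ 2) =
          (prefixWeight k θ p)⁻¹ * prefixWeight k θ p := by
        rw [prefixWeight_eq, Finset.mul_sum]
        refine Finset.sum_congr rfl fun x hx => ?_
        rw [(Finset.mem_filter.1 hx).2, prefixWeight_eq]
      rw [this]
      exact inv_mul_le_one
    refine (Finset.sum_le_sum fun p _ => h p).trans ?_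
    simp
  · rw [Matrix.trace]
    push_cast
    refine Finset.sum_congr rfl fun x _ => ?_
    rw [Matrix.diag_apply, prefixProj, if_pos rfl, Complex.star_def, Complex.mul_conj,
      Complex.normSq_eq_norm_sq]
    push_cast
    rfl

/-- One half of a maximally entangled state is maximally mixed, so the expectation of `Q` is its
normalised trace. -/
theorem ketBra_psiOne_mul {Q : Matrix (Qubits m) (Qubits m) ℂ} :
    ketBra (psiOne m) * (Q ⊗ₖ (1 : Matrix (Qubits m) (Qubits m) ℂ)) * ketBra (psiOne m) =
      ((2 ^ m)⁻¹ * Q.trace) • ketBra (psiOne m) := by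
  have h : star (psiOne m) ⬝ᵥ ((Q ⊗ₖ (1 : Matrix (Qubits m) (Qubits m) ℂ)) *ᵥ psiOne m) =
      (2 ^ m)⁻¹ * Q.trace := by
    simp only [dotProduct, Matrix.mulVec, Fintype.sum_prod_type, Matrix.kroneckerMap_apply,
      Matrix.one_apply, Pi.star_apply, psiOne_apply, star_mul', mul_ite, ite_mul, mul_one, mul_zero,
      zero_mul, Finset.sum_ite_eq, Finset.mem_univ, if_true, apply_ite star,
      star_zero, Matrix.trace, Matrix.diag_apply, Finset.mul_sum, ← inv_sqrt_mul_star m]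
    refine Finset.sum_congr rfl fun x _ => ?_
    ring
  rw [Matrix.mul_assoc]
  conv_lhs => rw [ketBra, Matrix.mul_vecMulVec, Matrix.vecMulVec_mul_vecMulVec, h]
  rw [Matrix.vecMulVec_smul, ketBra]

end Prefix

/-- A test behaves like a fair coin that decides whether the pair is really projected onto ψ_b or
accepted unseen; `S` is the set of pairs that are projected. -/
theorem acceptOp_eq_sum {k m : ℕ} (θ : Ket m) (b : Bool) : acceptOp k θ b =
    ((1 / 2 : ℝ) ^ k : ℝ) • ∑ S : Finset (Fin k),
      tensor (pairsEquiv k m) fun i => if i ∈ S then ketBra (psi k θ b) else 1 := by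
  rw [acceptOp, tensor_smul, tensor_add]
  ext a a'
  simp only [Matrix.smul_apply, Finset.prod_const, Finset.card_univ, Fintype.card_fin, smul_eq_mul,
    Complex.real_smul]
  push_cast
  rfl

theorem isStarProjection_ite {D : Type} [Fintype D] [DecidableEq D] {P : Matrix D D ℂ}
    (hP : IsStarProjection P) (p : Prop) [Decidable p] :
    IsStarProjection (if p then P else 1) := by
  split_ifs
  · exact hP
  · exact IsStarProjection.one _

theorem isStarProjection_kronecker_one {D E : Type} [Fintype D] [Fintype E] [DecidableEq E]
    {P : Matrix D D ℂ} (hP : IsStarProjection P) :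
    IsStarProjection (P ⊗ₖ (1 : Matrix E E ℂ)) := by
  obtain ⟨h1, h2⟩ := isStarProjection_iff_conjTranspose.1 hP
  refine isStarProjection_iff_conjTranspose.2 ⟨?_, ?_⟩
  · rw [Matrix.conjTranspose_kronecker, h1, Matrix.conjTranspose_one]
  · rw [← Matrix.mul_kronecker_mul, h2, Matrix.one_mul]

/-- The operator of the event that the tests in `S` would find the state `ψ_b`. -/
def subsetOp {m : ℕ} (k : ℕ) (θ : Ket m) (b : Bool) (S : Finset (Fin k)) :
    Matrix (Qubits (k * m) × Qubits (k * m)) (Qubits (k * m) × Qubits (k * m)) ℂ :=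
  tensor (pairsEquiv k m) fun i => if i ∈ S then ketBra (psi k θ b) else 1

/-- The operator `subsetOp k θ false S`, enlarged to one that acts only on the register `C`. -/
def subsetProj {m : ℕ} (k : ℕ) (θ : Ket m) (S : Finset (Fin k)) :
    Matrix (Qubits (k * m) × Qubits (k * m)) (Qubits (k * m) × Qubits (k * m)) ℂ :=
  tensor (pairsEquiv k m) fun i => if i ∈ S then
    prefixProj k θ ⊗ₖ (1 : Matrix (Qubits m) (Qubits m) ℂ) else 1

section

variable {k m : ℕ} {θ : Ket m} (S : Finset (Fin k))

theorem isStarProjection_subsetOp (hkm : k ≤ m) (hθ : ‖θ‖ = 1) (b : Bool) :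
    IsStarProjection (subsetOp k θ b S) :=
  isStarProjection_tensor _ fun _ => isStarProjection_ite
    (isStarProjection_ketBra (sum_psi hkm hθ b)) _

theorem isStarProjection_subsetProj : IsStarProjection (subsetProj k θ S) :=
  isStarProjection_tensor _ fun _ => isStarProjection_ite
    (isStarProjection_kronecker_one (isStarProjection_prefixProj θ)) _

theorem subsetProj_mul (hkm : k ≤ m) :
    subsetProj k θ S * subsetOp k θ false S = subsetOp k θ false S := by
  rw [subsetProj, subsetOp, tensor_mul]
  congr 1
  funext i
  split_ifs
  · change _ * ketBra (psiZero k θ) = ketBra (psiZero k θ)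
    conv_lhs => rw [ketBra, Matrix.mul_vecMulVec, prefixProj_mulVec_psiZero hkm, ← ketBra]
  · exact Matrix.one_mul 1

theorem subsetOp_mul_subsetProj_mul {t : ℝ} (ht : (prefixProj k θ).trace = t) :
    subsetOp k θ true S * subsetProj k θ S * subsetOp k θ true S =
      ((((2 ^ m)⁻¹ * t) ^ S.card : ℝ) : ℂ) • subsetOp k θ true S := by
  have h : ∀ i : Fin k, ((if i ∈ S then ketBra (psi k θ true) else 1) *
      (if i ∈ S then prefixProj k θ ⊗ₖ (1 : Matrix (Qubits m) (Qubits m) ℂ) else 1) *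
      if i ∈ S then ketBra (psi k θ true) else 1) =
      (if i ∈ S then (((2 ^ m)⁻¹ * t : ℝ) : ℂ) else 1) •
        if i ∈ S then ketBra (psi k θ true) else 1 := by
    intro i
    split_ifs
    · change ketBra (psiOne m) * _ * ketBra (psiOne m) = _ • ketBra (psiOne m)
      rw [ketBra_psiOne_mul, ht]
      push_cast
      rfl
    · simp
  rw [subsetOp, subsetProj, tensor_mul, tensor_mul]
  simp only [h]
  rw [tensor_smul, Finset.prod_ite_mem, Finset.univ_inter, Finset.prod_const]
  push_cast
  rfl

theorem subsetProj_eq_kronecker : subsetProj k θ S =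
    tensor (blockEquiv k m) (fun i => if i ∈ S then prefixProj k θ else 1) ⊗ₖ
      (1 : Matrix (Qubits (k * m)) (Qubits (k * m)) ℂ) := by
  rw [← tensor_kronecker_one (E := Qubits m) (blockEquiv k m) (blockEquiv k m), subsetProj]
  refine congrArg _ (funext fun i => ?_)
  split_ifs
  · rfl
  · exact Matrix.one_kronecker_one.symm

end

/-- If two states of the registers `C`, `R` agree on `C`, then the probabilities that the first is
accepted for `0` and the second for `1` add up to hardly more than `1`. -/
theorem trace_acceptOp_add_le {k m : ℕ} (hkm : k + 1 ≤ m) {θ : Ket m} (hθ : ‖θ‖ = 1)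
    {ρ₀ ρ₁ : Matrix (Qubits (k * m) × Qubits (k * m)) (Qubits (k * m) × Qubits (k * m)) ℂ}
    (h₀ : ρ₀.PosSemidef) (h₁ : ρ₁.PosSemidef) (ht : ρ₁.trace = 1)
    (hC : ∀ O : Matrix (Qubits (k * m)) (Qubits (k * m)) ℂ,
      (ρ₀ * (O ⊗ₖ (1 : Matrix (Qubits (k * m)) (Qubits (k * m)) ℂ))).trace =
        (ρ₁ * (O ⊗ₖ (1 : Matrix (Qubits (k * m)) (Qubits (k * m)) ℂ))).trace) :
    (ρ₀ * acceptOp k θ false).trace.re + (ρ₁ * acceptOp k θ true).trace.re ≤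
      1 + ((1 + √(1 / 2)) / 2) ^ k := by
  have hkm' : k ≤ m := by omega
  set s : ℝ := √(1 / 2) with hs
  have hs0 : 0 < s := Real.sqrt_pos.2 (by norm_num)
  have hs2 : s ^ 2 = 1 / 2 := Real.sq_sqrt (by norm_num)
  obtain ⟨t, ht0, ht2, htr⟩ := trace_prefixProj_le (k := k) θ
  -- The spare qubit in `k + 1 ≤ m` enters here: the overlap for one pair is at most 2^{k-m} ≤ 1/2.
  have hc2 : (2 ^ m)⁻¹ * t ≤ s ^ 2 := by
    rw [hs2]
    calc ((2 : ℝ) ^ m)⁻¹ * t ≤ (2 ^ m)⁻¹ * 2 ^ k := by gcongr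
      _ ≤ (2 ^ (k + 1))⁻¹ * 2 ^ k := by gcongr; norm_num
      _ = 1 / 2 := by rw [pow_succ]; field_simp
  have key : ∀ S : Finset (Fin k),
      (ρ₀ * subsetOp k θ false S).trace.re + (ρ₁ * subsetOp k θ true S).trace.re ≤
        1 + s ^ S.card := by
    intro S
    have h1 := re_trace_le_of_mul_eq h₀ (isStarProjection_subsetOp S hkm' hθ false)
      (isStarProjection_subsetProj S) (subsetProj_mul S hkm')
    have h2 := re_trace_add_le h₁ (isStarProjection_subsetOp S hkm' hθ true)
      (isStarProjection_subsetProj S) (pow_pos hs0 S.card)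
      (by rw [← pow_mul, mul_comm S.card, pow_mul]; exact pow_le_pow_left₀ (by positivity) hc2 _)
      (subsetOp_mul_subsetProj_mul S htr)
    rw [ht, Complex.one_re, mul_one] at h2
    -- The dominating projection acts on C alone, so its probability may be evaluated on `ρ₁`
    -- instead of `ρ₀`.
    rw [subsetProj_eq_kronecker, hC, ← subsetProj_eq_kronecker] at h1
    linarith
  -- The binomial theorem for the sum over all sets of tests.
  have hsum : ∑ S : Finset (Fin k), (1 + s ^ S.card) = 2 ^ k + (1 + s) ^ k := by
    have := Fin.sum_pow_mul_eq_add_pow (n := k) s 1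
    simp only [one_pow, mul_one] at this
    rw [Finset.sum_add_distrib, this, add_comm s]
    simp
  have hexp : ∀ (b : Bool) (ρ : Matrix (Qubits (k * m) × Qubits (k * m))
      (Qubits (k * m) × Qubits (k * m)) ℂ), (ρ * acceptOp k θ b).trace.re =
      (1 / 2) ^ k * ∑ S : Finset (Fin k), (ρ * subsetOp k θ b S).trace.re := by
    intro b ρ
    rw [acceptOp_eq_sum, Matrix.mul_smul, Matrix.trace_smul, Complex.smul_re, Matrix.mul_sum,
      Matrix.trace_sum, Complex.re_sum, smul_eq_mul]
    rfl
  rw [hexp, hexp, ← mul_add, ← Finset.sum_add_distrib]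
  calc _ ≤ (1 / 2 : ℝ) ^ k * ∑ S : Finset (Fin k), (1 + s ^ S.card) :=
        mul_le_mul_of_nonneg_left (Finset.sum_le_sum fun S _ => key S) (by positivity)
    _ = 1 + ((1 + s) / 2) ^ k := by
        rw [hsum, mul_add, ← mul_pow, ← mul_pow]
        rw [show (1 / 2 * 2 : ℝ) = 1 by norm_num, one_pow]
        congr 2
        ring

/-! ### Integration over the common state -/

theorem continuous_psi (k m : ℕ) (b : Bool) :
    Continuous fun θ : Metric.sphere (0 : Ket m) 1 => psi k (θ : Ket m) b := by
  refine continuous_pi fun a => ?_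
  cases b
  · change Continuous fun θ : Metric.sphere (0 : Ket m) 1 => psiZero k (θ : Ket m) a
    simp only [psiZero, pauliZ, Matrix.mulVec_diagonal]
    fun_prop
  · exact continuous_const

theorem continuous_copiesOf (m t : ℕ) :
    Continuous fun θ : Metric.sphere (0 : Ket m) 1 => copiesOf t (θ : Ket m) := by
  refine continuous_pi fun a => continuous_finsetProd _ fun i _ => ?_
  fun_prop

theorem continuous_ketBra {X ι : Type} [TopologicalSpace X] {f : X → ι → ℂ}
    (hf : Continuous f) : Continuous fun x => ketBra (f x) :=
  hf.matrix_vecMulVec (continuous_star.comp hf)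

theorem trace_ketBra_copiesOf {m : ℕ} (t : ℕ) {θ : Ket m} (hθ : ‖θ‖ = 1) :
    (ketBra (copiesOf t θ)).trace = 1 := by
  rw [ketBra, Matrix.trace_vecMulVec]
  simp only [dotProduct, copiesOf, Pi.star_apply, star_prod, ← Finset.prod_mul_distrib]
  rw [← Fintype.prod_sum fun (_ : Fin t) x => θ x * star (θ x)]
  exact Finset.prod_eq_one fun _ _ => sum_mul_star_of_norm hθ

theorem continuous_acceptOp (k m : ℕ) (b : Bool) :
    Continuous fun θ : Metric.sphere (0 : Ket m) 1 => acceptOp k (θ : Ket m) b := by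
  refine continuous_matrix fun a a' => ?_
  simp only [acceptOp, tensor]
  exact continuous_finsetProd _ fun i _ =>
    (((continuous_ketBra (continuous_psi k m b)).add continuous_const).const_smul
      (1 / 2 : ℂ)).matrix_elem _ _

/-- The state of the registers `C` and `R` that a malicious sender produces. -/
def senderState {m k T d : ℕ} (com : QChannel (Fin T → Qubits m) (Qubits (k * m) × Fin d))
    (rev : QChannel (Fin d) (Qubits (k * m))) (θ : Ket m) :
    Matrix (Qubits (k * m) × Qubits (k * m)) (Qubits (k * m) × Qubits (k * m)) ℂ :=
  rev.applyRight (com.apply (ketBra (copiesOf T θ)))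

theorem continuous_senderState {m k T d : ℕ}
    (com : QChannel (Fin T → Qubits m) (Qubits (k * m) × Fin d))
    (rev : QChannel (Fin d) (Qubits (k * m))) :
    Continuous fun θ : Metric.sphere (0 : Ket m) 1 => senderState com rev (θ : Ket m) := by
  have h : Continuous fun θ : Metric.sphere (0 : Ket m) 1 =>
      com.apply (ketBra (copiesOf T (θ : Ket m))) := by
    simp only [QChannel.apply]
    exact continuous_finsetSum _ fun i _ => (continuous_const.matrix_mul
      (continuous_ketBra (continuous_copiesOf m T))).matrix_mul continuous_const
  simp only [senderState, QChannel.applyRight]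
  exact continuous_finsetSum _ fun i _ => (continuous_const.matrix_mul h).matrix_mul
    continuous_const

theorem senderState_add_le {m k T d : ℕ} (hkm : k + 1 ≤ m)
    (com : QChannel (Fin T → Qubits m) (Qubits (k * m) × Fin d))
    (rev : Bool → QChannel (Fin d) (Qubits (k * m))) {θ : Ket m} (hθ : ‖θ‖ = 1) :
    (senderState com (rev false) θ * acceptOp k θ false).trace.re +
      (senderState com (rev true) θ * acceptOp k θ true).trace.re ≤
        1 + ((1 + √(1 / 2)) / 2) ^ k := by
  have hσ : (com.apply (ketBra (copiesOf T θ))).PosSemidef :=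
    com.apply_posSemidef (Matrix.posSemidef_vecMulVec_self_star _)
  refine trace_acceptOp_add_le hkm hθ ((rev _).applyRight_posSemidef hσ)
    ((rev _).applyRight_posSemidef hσ) ?_ fun O => ?_
  · have := (rev true).trace_applyRight_mul (com.apply (ketBra (copiesOf T θ))) 1
    rw [Matrix.one_kronecker_one, Matrix.one_kronecker_one, Matrix.mul_one,
      Matrix.mul_one] at this
    rw [senderState, this, com.trace_apply, trace_ketBra_copiesOf T hθ]
  · rw [senderState, senderState, QChannel.trace_applyRight_mul, QChannel.trace_applyRight_mul]

theorem integral_senderState_add_le {m k T d : ℕ} (hkm : k + 1 ≤ m)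
    (com : QChannel (Fin T → Qubits m) (Qubits (k * m) × Fin d))
    (rev : Bool → QChannel (Fin d) (Qubits (k * m))) :
    (∫ θ : Metric.sphere (0 : Ket m) 1,
      (senderState com (rev false) (θ : Ket m) * acceptOp k (θ : Ket m) false).trace.re
        ∂(haarState m)) +
    (∫ θ : Metric.sphere (0 : Ket m) 1,
      (senderState com (rev true) (θ : Ket m) * acceptOp k (θ : Ket m) true).trace.re
        ∂(haarState m)) ≤ 1 + ((1 + √(1 / 2)) / 2) ^ k := by
  have hcont : ∀ b, Continuous fun θ : Metric.sphere (0 : Ket m) 1 =>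
      (senderState com (rev b) (θ : Ket m) * acceptOp k (θ : Ket m) b).trace.re := fun b =>
    Complex.continuous_re.comp
      ((continuous_senderState com (rev b)).matrix_mul (continuous_acceptOp k m b)).matrix_trace
  rw [← integral_add (integrable_haarState (hcont _)) (integrable_haarState (hcont _))]
  refine (integral_mono (g := fun _ => 1 + ((1 + √(1 / 2)) / 2) ^ k)
    (integrable_haarState ((hcont _).add (hcont _)))
    (integrable_const _) fun θ => senderState_add_le hkm com rev (by simp)).trans_eq ?_
  simp

theorem bindingProb_eq {n : ℕ → ℕ} {k T d : ℕ} (hkn : k ≤ n k)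
    (com : QChannel (Fin T → Qubits (n k)) (Qubits (k * n k) × Fin d))
    (rev : QChannel (Fin d) (Qubits (k * n k))) (b : Bool) :
    (swapTestScheme n).bindingProb k T d com rev b =
      ∫ θ : Metric.sphere (0 : Ket (n k)) 1,
        (senderState com rev (θ : Ket (n k)) * acceptOp k (θ : Ket (n k)) b).trace.re
          ∂(haarState (n k)) :=
  integral_congr_ae (Filter.Eventually.of_forall fun θ =>
    accept_eq_trace k (θ : Ket (n k)) b (sum_psi hkn (by simp) b) _)

theorem negligible_pow {r : ℝ} (h0 : 0 ≤ r) (h1 : r < 1) :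
    CommitmentScheme.Negligible fun k => r ^ k := fun j =>
  tendsto_pow_const_mul_const_pow_of_lt_one j h0 h1

theorem isStatisticallySumBinding {n : ℕ → ℕ} (hkn : ∀ k, k + 1 ≤ n k) :
    (swapTestScheme n).IsStatisticallySumBinding := by
  intro T d com rev
  refine ⟨fun k => ((1 + √(1 / 2)) / 2) ^ k, negligible_pow (by positivity) ?_, fun k => ?_⟩
  · have : √(1 / 2) < 1 := by
      rw [Real.sqrt_lt' one_pos]; norm_num
    linarith
  · have hk : k ≤ n k := by have := hkn k; omega
    refine (congrArg₂ (· + ·) (bindingProb_eq hk (com k) (rev false k) false)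
      (bindingProb_eq hk (com k) (rev true k) true)).trans_le ?_
    exact integral_senderState_add_le (hkn k) (com k) fun b => rev b k

/-! ### Moments of the Haar measure -/

section Moments

variable {m : ℕ} {ι : Type} [Fintype ι]

/-- A diagonal unitary operator. -/
def phaseMap (d : Qubits m → ℂ) (hd : ∀ x, ‖d x‖ = 1) : Ket m ≃ₗᵢ[ℂ] Ket m where
  toFun θ := WithLp.toLp 2 fun x => d x * θ x
  map_add' θ θ' := by ext x; simp [mul_add]
  map_smul' c θ := by ext x; simp [mul_left_comm]
  invFun θ := WithLp.toLp 2 fun x => (d x)⁻¹ * θ x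
  left_inv θ := by
    ext x
    exact inv_mul_cancel_left₀ (norm_ne_zero_iff.1 (by rw [hd]; exact one_ne_zero)) _
  right_inv θ := by
    ext x
    exact mul_inv_cancel_left₀ (norm_ne_zero_iff.1 (by rw [hd]; exact one_ne_zero)) _
  norm_map' θ := by
    simp [EuclideanSpace.norm_eq, hd]

theorem phaseMap_apply (d : Qubits m → ℂ) (hd : ∀ x, ‖d x‖ = 1) (θ : Ket m) (x : Qubits m) :
    phaseMap d hd θ x = d x * θ x := rfl

/-- The operator that permutes the computational basis. -/
def permMap (σ : Equiv.Perm (Qubits m)) : Ket m ≃ₗᵢ[ℂ] Ket m :=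
  LinearIsometryEquiv.piLpCongrLeft 2 ℂ ℂ σ.symm

theorem permMap_apply (σ : Equiv.Perm (Qubits m)) (θ : Ket m) (x : Qubits m) :
    permMap σ θ x = θ (σ x) := rfl

/-- The reflection about `2|x⟩ + |y⟩`. -/
def mixMap (x y : Qubits m) : Ket m ≃ₗᵢ[ℂ] Ket m :=
  (ℂ ∙ (EuclideanSpace.single x (2 : ℂ) + EuclideanSpace.single y (1 : ℂ))).reflection

/-- The squared length of the axis is 5, so the two matrix entries are 2·4/5 - 1 = 3/5 and 2·2/5 =
4/5, both rational. -/
theorem mixMap_apply {x y : Qubits m} (h : x ≠ y) (θ : Ket m) :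
    mixMap x y θ x = (3 * θ x + 4 * θ y) / 5 := by
  have hn : ‖(EuclideanSpace.single x (2 : ℂ) + EuclideanSpace.single y (1 : ℂ) : Ket m)‖ ^ 2 =
      5 := by
    rw [norm_add_sq (𝕜 := ℂ)]
    simp [EuclideanSpace.inner_single_left, h]
    norm_num
  have hn' : ((‖(EuclideanSpace.single x (2 : ℂ) + EuclideanSpace.single y (1 : ℂ) : Ket m)‖ :
      ℂ)) ^ 2 = 5 := by exact_mod_cast hn
  rw [mixMap, Submodule.reflection_singleton_apply]
  simp only [Complex.coe_algebraMap]
  rw [hn']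
  simp [inner_add_left, EuclideanSpace.inner_single_left, h, Complex.conj_ofNat]
  ring

/-- The monomial `∏ᵢ θ(wᵢ)`. -/
def monomial (w : ι → Qubits m) (θ : Ket m) : ℂ := ∏ i, θ (w i)

theorem continuous_monomial (w : ι → Qubits m) :
    Continuous fun θ : Metric.sphere (0 : Ket m) 1 => monomial w (θ : Ket m) := by
  refine continuous_finsetProd _ fun i _ => ?_
  fun_prop

/-- The moments of the Haar measure. -/
def moment (w w' : ι → Qubits m) : ℂ :=
  ∫ θ : Metric.sphere (0 : Ket m) 1, monomial w (θ : Ket m) * star (monomial w' (θ : Ket m))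
    ∂(haarState m)

theorem continuous_monomial_mul (w w' : ι → Qubits m) :
    Continuous fun θ : Metric.sphere (0 : Ket m) 1 =>
      monomial w (θ : Ket m) * star (monomial w' (θ : Ket m)) :=
  (continuous_monomial w).mul (continuous_star.comp (continuous_monomial w'))

theorem moment_comp (σ : Equiv.Perm (Qubits m)) (w w' : ι → Qubits m) :
    moment (σ ∘ w) (σ ∘ w') = moment w w' :=
  integral_sphereMap (permMap σ) (continuous_monomial_mul w w')

theorem moment_phase (d : Qubits m → ℂ) (hd : ∀ x, ‖d x‖ = 1) (w w' : ι → Qubits m) :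
    (∏ i, d (w i)) * star (∏ i, d (w' i)) * moment w w' = moment w w' := by
  conv_rhs => rw [moment, ← integral_sphereMap (phaseMap d hd) (continuous_monomial_mul w w')]
  rw [moment, ← integral_const_mul]
  refine integral_congr_ae (Filter.Eventually.of_forall fun θ => ?_)
  simp only [monomial, sphereMap, phaseMap_apply, Finset.prod_mul_distrib, star_mul']
  ring

theorem exists_perm_of_card_eq {α : Type} [DecidableEq α] {w w' : ι → α}
    (h : ∀ x, Fintype.card {i // w' i = x} = Fintype.card {i // w i = x}) :
    ∃ τ : Equiv.Perm ι, w' = w ∘ τ :=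
  ⟨Equiv.ofFiberEquiv fun x => Fintype.equivOfCardEq (h x),
    funext fun i => (Equiv.ofFiberEquiv_map _ i).symm⟩

/-- By invariance under phases, most of the moments vanish. -/
theorem moment_eq_zero {w w' : ι → Qubits m} (h : ¬ ∃ τ : Equiv.Perm ι, w' = w ∘ τ) :
    moment w w' = 0 := by
  obtain ⟨x, hx⟩ : ∃ x, Fintype.card {i // w' i = x} ≠ Fintype.card {i // w i = x} := by
    by_contra! hc
    exact h (exists_perm_of_card_eq hc)
  -- Put a phase `c` on the single label `x`, which occurs with different multiplicities in `w` and
  -- `w'`.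
  have hphase : ∀ c : ℂ, ‖c‖ = 1 → c ^ Fintype.card {i // w i = x} *
      star (c ^ Fintype.card {i // w' i = x}) * moment w w' = moment w w' := by
    intro c hc
    have := moment_phase (fun y => if y = x then c else 1)
      (fun y => by split_ifs <;> simp [hc]) w w'
    simpa only [Finset.prod_ite, Finset.prod_const, Finset.prod_const_one, one_pow, mul_one,
      ← Fintype.card_subtype] using this
  -- With `d` the difference of the multiplicities, a phase with `c ^ d = -1` makes the moment equal
  -- to its own negative.
  have hroot : ∀ d : ℕ, d ≠ 0 → ∃ c : ℂ, ‖c‖ = 1 ∧ c ^ d = -1 := fun d hd =>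
    ⟨Complex.exp ((Real.pi / d : ℝ) * Complex.I), Complex.norm_exp_ofReal_mul_I _, by
      rw [← Complex.exp_nat_mul, ← Complex.exp_pi_mul_I]
      congr 1
      push_cast
      field_simp⟩
  have hneg : ∀ c : ℂ, ‖c‖ = 1 → ∀ a, c ^ a * star (c ^ a) = 1 := fun c hc a => by
    rw [Complex.star_def, Complex.mul_conj, Complex.normSq_eq_norm_sq, norm_pow, hc]
    simp
  have hfin : -moment w w' = moment w w' := by
    obtain hlt | hlt := lt_or_gt_of_ne hx
    · obtain ⟨d, hd⟩ := Nat.exists_eq_add_of_lt hlt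
      obtain ⟨c, hc, hcd⟩ := hroot (d + 1) (by omega)
      have := hphase c hc
      rw [hd, add_assoc, pow_add, hcd, mul_right_comm (c ^ _), hneg c hc] at this
      linear_combination this
    · obtain ⟨d, hd⟩ := Nat.exists_eq_add_of_lt hlt
      obtain ⟨c, hc, hcd⟩ := hroot (d + 1) (by omega)
      have := hphase c hc
      rw [hd, add_assoc, pow_add, hcd, star_mul', ← mul_assoc, hneg c hc, star_neg, star_one]
        at this
      linear_combination this
  linear_combination (-1 / 2 : ℂ) * hfin

theorem moment_perm (w : ι → Qubits m) (τ : Equiv.Perm ι) : moment w (w ∘ τ) = moment w w := by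
  have : ∀ θ : Ket m, monomial (w ∘ τ) θ = monomial w θ := fun θ =>
    Equiv.prod_comp τ fun i => θ (w i)
  simp only [moment, this]

/-- A permutation of the basis carries any injective tuple to any other, and the Haar measure does
not notice. -/
theorem moment_eq_of_injective {w u : ι → Qubits m} (hw : Function.Injective w)
    (hu : Function.Injective u) : moment w w = moment u u := by
  classical
  obtain ⟨σ, hσ⟩ : ∃ σ : Equiv.Perm (Qubits m), ∀ i, σ (w i) = u i := by
    let e := (Equiv.ofInjective w hw).symm.trans (Equiv.ofInjective u hu)
    refine ⟨e.extendSubtype, fun i => ?_⟩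
    rw [Equiv.extendSubtype_apply_of_mem e (w i) ⟨i, rfl⟩]
    simp [e, Equiv.ofInjective_symm_apply]
  rw [← moment_comp σ w w, show σ ∘ w = u from funext hσ]

end Moments

/-! ### The second moment of the weight of a prefix -/

section Collision

variable {m : ℕ}

/-- The expectation of `|θ(x)|² |θ(y)|²`. -/
def pairMoment (x y : Qubits m) : ℝ :=
  ∫ θ : Metric.sphere (0 : Ket m) 1, ‖(θ : Ket m) x‖ ^ 2 * ‖(θ : Ket m) y‖ ^ 2 ∂(haarState m)

theorem continuous_pairMoment (x y : Qubits m) : Continuous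
    fun θ : Metric.sphere (0 : Ket m) 1 => ‖(θ : Ket m) x‖ ^ 2 * ‖(θ : Ket m) y‖ ^ 2 := by
  fun_prop

theorem pairMoment_self (x y : Qubits m) : pairMoment x x = pairMoment y y := by
  have := integral_sphereMap (permMap (Equiv.swap x y)) (continuous_pairMoment x x)
  rw [pairMoment, ← this]
  simp only [sphereMap, permMap_apply, Equiv.swap_apply_left, pairMoment]

/-- A diagonal unitary removes the phase `c`; the reflection `mixMap` then identifies the integrand
with 5⁴|θ(x)|⁴. -/
theorem integral_mix {x y : Qubits m} (h : x ≠ y) {c : ℂ} (hc : ‖c‖ = 1) :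
    ∫ θ : Metric.sphere (0 : Ket m) 1, ‖3 * (θ : Ket m) x + 4 * (c * (θ : Ket m) y)‖ ^ 4
      ∂(haarState m) = 625 * pairMoment x x := by
  have h1 := integral_sphereMap (mixMap x y) (continuous_pairMoment x x)
  have h2 : Continuous fun θ : Metric.sphere (0 : Ket m) 1 =>
      ‖3 * (θ : Ket m) x + 4 * (θ : Ket m) y‖ ^ 4 := by fun_prop
  have h3 := integral_sphereMap (phaseMap (fun z => if z = y then c else 1)
    (fun z => by split_ifs <;> simp [hc])) h2
  simp only [sphereMap, phaseMap_apply, h, if_false, if_true, one_mul] at h3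
  rw [h3, pairMoment, ← h1, ← integral_const_mul]
  refine integral_congr_ae (Filter.Eventually.of_forall fun θ => ?_)
  simp only [sphereMap, mixMap_apply h, norm_div, Complex.norm_ofNat]
  ring

/-- Summing over the fourth roots of unity cancels every term that is not invariant under the
relative phase of `a` and `b`. -/
theorem sum_norm_mix (a b : ℂ) :
    ‖3 * a + 4 * (1 * b)‖ ^ 4 + ‖3 * a + 4 * (-1 * b)‖ ^ 4 +
      (‖3 * a + 4 * (Complex.I * b)‖ ^ 4 + ‖3 * a + 4 * (-Complex.I * b)‖ ^ 4) =
    324 * (‖a‖ ^ 2 * ‖a‖ ^ 2) + 1024 * (‖b‖ ^ 2 * ‖b‖ ^ 2) + 2304 * (‖a‖ ^ 2 * ‖b‖ ^ 2) := by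
  have h : ∀ z : ℂ, ‖z‖ ^ 4 = (‖z‖ ^ 2) ^ 2 := fun z => by ring
  simp only [h, ← Complex.normSq_eq_norm_sq, Complex.normSq_apply]
  simp
  ring

/-- With A for the diagonal and B for the mixed moment, the four phases give 4·625 A = (324 + 1024)
A + 2304 B, that is, A = 2B. -/
theorem pairMoment_self_eq {x y : Qubits m} (h : x ≠ y) :
    pairMoment x x = 2 * pairMoment x y := by
  have h1 : ∫ θ : Metric.sphere (0 : Ket m) 1,
      (324 * (‖(θ : Ket m) x‖ ^ 2 * ‖(θ : Ket m) x‖ ^ 2) +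
      1024 * (‖(θ : Ket m) y‖ ^ 2 * ‖(θ : Ket m) y‖ ^ 2) +
      2304 * (‖(θ : Ket m) x‖ ^ 2 * ‖(θ : Ket m) y‖ ^ 2)) ∂(haarState m) =
      4 * (625 * pairMoment x x) := by
    simp only [← sum_norm_mix]
    rw [integral_add, integral_add, integral_add, integral_mix h (by simp),
      integral_mix h (by simp), integral_mix h (by simp), integral_mix h (by simp)]
    · ring
    all_goals exact integrable_haarState (by fun_prop)
  rw [integral_add (integrable_haarState (by fun_prop)) (integrable_haarState (by fun_prop)),
    integral_add (integrable_haarState (by fun_prop)) (integrable_haarState (by fun_prop)),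
    integral_const_mul, integral_const_mul, integral_const_mul] at h1
  change 324 * pairMoment x x + 1024 * pairMoment y y + 2304 * pairMoment x y = _ at h1
  rw [pairMoment_self y x] at h1
  linarith

theorem sum_norm_sq_eq_one {θ : Ket m} (h : ‖θ‖ = 1) : ∑ x, ‖θ x‖ ^ 2 = 1 := by
  have := EuclideanSpace.norm_sq_eq θ
  rw [h, one_pow] at this
  exact this.symm

/-- All diagonal moments equal some A and all others A/2. Their sum over N² pairs, with N = 2^m, is
1 by normalisation, so N(N + 1)A/2 = 1. -/
theorem pairMoment_le (x y : Qubits m) : pairMoment x y ≤ 2 / (2 ^ m) ^ 2 := by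
  set N : ℝ := 2 ^ m with hN
  have hcard : (Fintype.card (Qubits m) : ℝ) = N := by simp [hN]
  have hN0 : 0 < N := by positivity
  set A := pairMoment x x with hA
  have hA0 : 0 ≤ A := integral_nonneg fun θ => by positivity
  have hxy : ∀ u v : Qubits m, pairMoment u v = if u = v then A else A / 2 := by
    intro u v
    split_ifs with huv
    · rw [huv, hA, pairMoment_self]
    · rw [hA, pairMoment_self x u, pairMoment_self_eq huv]
      ring
  have hsum : ∑ u : Qubits m, ∑ v : Qubits m, pairMoment u v = 1 := by
    have h1 : ∀ θ : Metric.sphere (0 : Ket m) 1, ∑ u : Qubits m, ∑ v : Qubits m,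
        ‖(θ : Ket m) u‖ ^ 2 * ‖(θ : Ket m) v‖ ^ 2 = 1 := fun θ => by
      simp only [← Finset.mul_sum, ← Finset.sum_mul]
      rw [sum_norm_sq_eq_one (by simp), one_mul]
    have h2 : ∫ θ : Metric.sphere (0 : Ket m) 1, (∑ u : Qubits m, ∑ v : Qubits m,
        ‖(θ : Ket m) u‖ ^ 2 * ‖(θ : Ket m) v‖ ^ 2) ∂(haarState m) = 1 := by
      simp [h1]
    rw [integral_finsetSum _ fun u _ => integrable_finsetSum _ fun v _ =>
      integrable_haarState (continuous_pairMoment u v)] at h2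
    rw [← h2]
    exact Finset.sum_congr rfl fun u _ => (integral_finsetSum _ fun v _ =>
      integrable_haarState (continuous_pairMoment u v)).symm
  have hcount : ∑ u : Qubits m, ∑ v : Qubits m, (if u = v then A else A / 2) =
      N * (A / 2) + N * (N * (A / 2)) := by
    have : ∀ u v : Qubits m, (if u = v then A else A / 2) = (if u = v then A / 2 else 0) + A / 2 :=
      fun u v => by split_ifs <;> ring
    simp only [this, Finset.sum_add_distrib, Finset.sum_ite_eq, Finset.mem_univ, if_true,
      Finset.sum_const, Finset.card_univ, nsmul_eq_mul, hcard]
  have hA2 : A ≤ 2 / N ^ 2 := by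
    simp only [hxy] at hsum
    rw [hcount] at hsum
    rw [le_div_iff₀ (by positivity)]
    nlinarith [mul_nonneg hN0.le hA0]
  rw [hxy]
  split_ifs
  · exact hA2
  · linarith

theorem card_prefix {k : ℕ} (hkm : k ≤ m) (p : Qubits k) :
    (∑ x : Qubits m, if window x 0 k = p then (1 : ℝ) else 0) = 2 ^ m / 2 ^ k := by
  have h : ∀ x : Qubits m, (if window x 0 k = p then (1 : ℝ) else 0) =
      ∏ j : Fin m, if ∀ hj : (j : ℕ) < k, x j = p ⟨j, hj⟩ then 1 else 0 := fun x => by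
    have hx : window x 0 k = p ↔ ∀ (j : Fin m) (hj : (j : ℕ) < k), x j = p ⟨j, hj⟩ := by
      simp only [funext_iff, window, zero_add]
      constructor
      · intro h j hj
        rw [← h ⟨j, hj⟩, dif_pos j.isLt]
      · intro h j
        rw [dif_pos (by omega)]
        exact h ⟨j, by omega⟩ j.isLt
    by_cases hp : window x 0 k = p
    · rw [if_pos hp, Finset.prod_eq_one fun j _ => if_pos (hx.1 hp j)]
    · rw [if_neg hp]
      obtain ⟨j, hj⟩ := not_forall.1 (fun h => hp (hx.2 h))
      exact (Finset.prod_eq_zero (Finset.mem_univ j) (if_neg hj)).symm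
  simp only [h]
  rw [← Fintype.prod_sum fun (j : Fin m) (b : Bool) =>
    if ∀ hj : (j : ℕ) < k, b = p ⟨j, hj⟩ then (1 : ℝ) else 0]
  have h2 : ∀ j : Fin m, (∑ b : Bool, if ∀ hj : (j : ℕ) < k, b = p ⟨j, hj⟩ then (1 : ℝ) else 0) =
      if (j : ℕ) < k then 1 else 2 := fun j => by
    by_cases hj : (j : ℕ) < k
    · simp [hj]
    · simp [hj]
  rw [Finset.prod_congr rfl fun j _ => h2 j, Fin.prod_univ_eq_prod_range
    (fun j => if j < k then (1 : ℝ) else 2) m, Finset.prod_ite, Finset.prod_const,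
    Finset.prod_const, one_pow, one_mul, eq_div_iff (by positivity), ← pow_add]
  congr 1
  have : (Finset.range m).filter (fun j => ¬ j < k) = Finset.Ico k m := by
    ext j; simp; omega
  rw [this, Nat.card_Ico]
  omega

/-- The expected probability that two samples from `θ` have the same prefix. -/
theorem integral_sum_prefixWeight_sq_le {k : ℕ} (hkm : k ≤ m) :
    ∫ θ : Metric.sphere (0 : Ket m) 1, ∑ p : Qubits k, prefixWeight k (θ : Ket m) p ^ 2
      ∂(haarState m) ≤ 2 / 2 ^ k := by
  have h : ∀ θ : Metric.sphere (0 : Ket m) 1, ∑ p : Qubits k, prefixWeight k (θ : Ket m) p ^ 2 =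
      ∑ x : Qubits m, ∑ y : Qubits m, (if window y 0 k = window x 0 k then (1 : ℝ) else 0) *
        (‖(θ : Ket m) x‖ ^ 2 * ‖(θ : Ket m) y‖ ^ 2) := by
    intro θ
    simp only [prefixWeight, sq (∑ _, _), Finset.sum_mul_sum]
    rw [Finset.sum_comm]
    refine Finset.sum_congr rfl fun x _ => ?_
    rw [Finset.sum_comm]
    refine Finset.sum_congr rfl fun y _ => ?_
    rw [Finset.sum_eq_single (window x 0 k) (fun p _ hp => by rw [if_neg (Ne.symm hp), zero_mul])
      (by simp), if_pos rfl]
    split_ifs <;> ring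
  have hint : ∀ x y : Qubits m, Integrable (fun θ : Metric.sphere (0 : Ket m) 1 =>
      (if window y 0 k = window x 0 k then (1 : ℝ) else 0) *
        (‖(θ : Ket m) x‖ ^ 2 * ‖(θ : Ket m) y‖ ^ 2)) (haarState m) := fun x y =>
    integrable_haarState (continuous_const.mul (continuous_pairMoment x y))
  simp only [h]
  rw [integral_finsetSum _ fun x _ => integrable_finsetSum _ fun y _ => hint x y]
  calc _ = ∑ x : Qubits m, ∑ y : Qubits m, (if window y 0 k = window x 0 k then (1 : ℝ) else 0) *
        pairMoment x y := by
        refine Finset.sum_congr rfl fun x _ => ?_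
        rw [integral_finsetSum _ fun y _ => hint x y]
        exact Finset.sum_congr rfl fun y _ => integral_const_mul _ _
    _ ≤ ∑ x : Qubits m, ∑ y : Qubits m, (if window y 0 k = window x 0 k then (1 : ℝ) else 0) *
        (2 / (2 ^ m) ^ 2) := by
        refine Finset.sum_le_sum fun x _ => Finset.sum_le_sum fun y _ =>
          mul_le_mul_of_nonneg_left (pairMoment_le x y) (by split_ifs <;> norm_num)
    _ = 2 / 2 ^ k := by
        simp only [← Finset.sum_mul, card_prefix hkm]
        simp
        field_simp

end Collision

/-! ### Distinguishing two states that are proportional on a large block -/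

section Distinguish

variable {X : Type} [Fintype X] [DecidableEq X]

/-- The sum of the diagonal entries outside of a set of labels. -/
def badWeight (good : X → Prop) [DecidablePred good] (ρ : Matrix X X ℂ) : ℝ :=
  (∑ x, if good x then 0 else ρ x x).re

/-- Here `a` is the weight of the good part, `p` its accepted share, and `e`, `d` are the same for
the bad part. The cross equation says that acceptance conditioned on the good part is equally likely
in both cases, so p₀ - p₁ is at most e₁, and symmetrically. -/
theorem abs_sub_le_of_cross_eq {a₀ a₁ p₀ p₁ d₀ d₁ e₀ e₁ : ℝ} (hp₀ : 0 ≤ p₀) (hpa₀ : p₀ ≤ a₀)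
    (hp₁ : 0 ≤ p₁) (hpa₁ : p₁ ≤ a₁) (hd₀ : 0 ≤ d₀) (hde₀ : d₀ ≤ e₀) (hd₁ : 0 ≤ d₁) (hde₁ : d₁ ≤ e₁)
    (h₀ : a₀ + e₀ = 1) (h₁ : a₁ + e₁ = 1) (h : a₀ * p₁ = a₁ * p₀) :
    |(p₀ + d₀) - (p₁ + d₁)| ≤ e₀ + e₁ := by
  have key : ∀ {a₀ a₁ p₀ p₁ e₁ : ℝ}, 0 ≤ p₀ → p₀ ≤ a₀ → 0 ≤ p₁ → a₀ ≤ 1 → a₁ + e₁ = 1 →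
      0 ≤ e₁ → a₀ * p₁ = a₁ * p₀ → p₀ - p₁ ≤ e₁ := by
    intro a₀ a₁ p₀ p₁ e₁ h1 h2 h3 h4 h5 h6 h7
    obtain ha | ha := (h1.trans h2).eq_or_lt
    · linarith
    · refine le_of_mul_le_mul_left ?_ ha
      nlinarith [mul_nonneg h6 ha.le, mul_nonneg h6 (sub_nonneg.2 h2),
        mul_nonneg (sub_nonneg.2 h4) h1]
  have k1 := key hp₀ hpa₀ hp₁ (by linarith) h₁ (by linarith) h
  have k2 := key hp₁ hpa₁ hp₀ (by linarith) h₀ (by linarith) h.symm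
  rw [abs_le]
  constructor <;> linarith

open scoped MatrixOrder in
theorem exists_eq_conjTranspose_mul_self {M : Matrix X X ℂ} (hM : M.PosSemidef) :
    ∃ C : Matrix X X ℂ, M = Cᴴ * C :=
  CStarAlgebra.nonneg_iff_eq_star_mul_self.mp hM.nonneg

theorem re_trace_mul_conj_nonneg {M : Matrix X X ℂ} (hM : M.PosSemidef) {ρ : Matrix X X ℂ}
    (hρ : ρ.PosSemidef) (P : Matrix X X ℂ) : 0 ≤ (ρ * (Pᴴ * M * P)).trace.re := by
  obtain ⟨C, rfl⟩ := exists_eq_conjTranspose_mul_self hM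
  have e : Pᴴ * (Cᴴ * C) * P = (C * P)ᴴ * (C * P) := by
    rw [Matrix.conjTranspose_mul]
    simp only [Matrix.mul_assoc]
  rw [e]
  exact re_trace_mul_nonneg hρ _

/-- If two states have no matrix entries between the good and the bad labels and are proportional
on the good ones, then they are as close as they are concentrated on the good labels. -/
theorem abs_trace_sub_le {good : X → Prop} [DecidablePred good] {ρ₀ ρ₁ M : Matrix X X ℂ}
    (h₀ : ρ₀.PosSemidef) (h₁ : ρ₁.PosSemidef) (ht₀ : ρ₀.trace = 1) (ht₁ : ρ₁.trace = 1)
    (hM : M.PosSemidef) (hM' : (1 - M).PosSemidef)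
    (hb₀ : ∀ x x', ¬ (good x ↔ good x') → ρ₀ x x' = 0)
    (hb₁ : ∀ x x', ¬ (good x ↔ good x') → ρ₁ x x' = 0) {c₀ c₁ : ℝ} {K : X → X → ℂ}
    (hK₀ : ∀ x x', good x → good x' → ρ₀ x x' = c₀ * K x x')
    (hK₁ : ∀ x x', good x → good x' → ρ₁ x x' = c₁ * K x x') :
    |(M * ρ₀).trace.re - (M * ρ₁).trace.re| ≤ badWeight good ρ₀ + badWeight good ρ₁ := by
  set P : Bool → Matrix X X ℂ := fun b => Matrix.diagonal fun x =>
    if (good x ↔ b = true) then 1 else 0 with hP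
  have hPH : ∀ b, (P b)ᴴ = P b := fun b => by
    simp only [hP, Matrix.diagonal_conjTranspose]
    congr 1
    funext x
    simp [apply_ite star]
  have hPP : ∀ b, P b * P b = P b := fun b => by
    simp only [hP, Matrix.diagonal_mul_diagonal]
    congr 1
    funext x
    split_ifs <;> simp
  have htr : ∀ (b : Bool) (ρ A : Matrix X X ℂ), (ρ * ((P b)ᴴ * A * P b)).trace =
      ∑ x, ∑ x', if (good x ↔ b = true) ∧ (good x' ↔ b = true) then ρ x x' * A x' x else 0 := by
    intro b ρ A
    rw [hPH]
    simp only [Matrix.trace, Matrix.diag_apply, Matrix.mul_apply (M := ρ), hP,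
      Matrix.mul_diagonal, Matrix.diagonal_mul]
    refine Finset.sum_congr rfl fun x _ => Finset.sum_congr rfl fun x' _ => ?_
    rw [ite_and]
    split_ifs <;> simp
  set p : Bool → Matrix X X ℂ → ℝ := fun b ρ => (ρ * ((P b)ᴴ * M * P b)).trace.re with hp
  set a : Bool → Matrix X X ℂ → ℝ := fun b ρ => (ρ * ((P b)ᴴ * 1 * P b)).trace.re with ha
  have hp0 : ∀ b {ρ : Matrix X X ℂ}, ρ.PosSemidef → 0 ≤ p b ρ := fun b ρ hρ =>
    re_trace_mul_conj_nonneg hM hρ _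
  have hpa : ∀ b {ρ : Matrix X X ℂ}, ρ.PosSemidef → p b ρ ≤ a b ρ := fun b ρ hρ => by
    have := re_trace_mul_conj_nonneg hM' hρ (P b)
    rw [Matrix.mul_sub, Matrix.sub_mul, Matrix.mul_sub, Matrix.trace_sub, Complex.sub_re] at this
    exact sub_nonneg.1 this
  have hsplit : ∀ {ρ : Matrix X X ℂ}, (∀ x x', ¬ (good x ↔ good x') → ρ x x' = 0) →
      ∀ A : Matrix X X ℂ, (A * ρ).trace =
        (ρ * ((P true)ᴴ * A * P true)).trace + (ρ * ((P false)ᴴ * A * P false)).trace := by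
    intro ρ hρ A
    rw [htr, htr, Matrix.trace_mul_comm, Matrix.trace, ← Finset.sum_add_distrib]
    refine Finset.sum_congr rfl fun x _ => ?_
    rw [Matrix.diag_apply, Matrix.mul_apply, ← Finset.sum_add_distrib]
    refine Finset.sum_congr rfl fun x' _ => ?_
    by_cases h1 : good x <;> by_cases h2 : good x'
    · simp [h1, h2]
    · simp [h1, h2, hρ x x' (by tauto)]
    · simp [h1, h2, hρ x x' (by tauto)]
    · simp [h1, h2]
  have hae : ∀ {ρ : Matrix X X ℂ}, (∀ x x', ¬ (good x ↔ good x') → ρ x x' = 0) → ρ.trace = 1 →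
      a true ρ + a false ρ = 1 := by
    intro ρ hρ ht
    have := congrArg Complex.re (hsplit hρ 1)
    rw [Matrix.one_mul, ht, Complex.add_re, Complex.one_re] at this
    exact this.symm
  have hbad : ∀ ρ : Matrix X X ℂ, a false ρ = badWeight good ρ := by
    intro ρ
    rw [ha]
    dsimp only
    rw [htr, badWeight]
    congr 1
    refine Finset.sum_congr rfl fun x _ => ?_
    rw [Finset.sum_eq_single x (fun x' _ hx' => by simp [Matrix.one_apply, hx']) (by simp)]
    by_cases hx : good x <;> simp [hx]
  have hfac : ∀ {ρ : Matrix X X ℂ} {c : ℝ}, (∀ x x', good x → good x' → ρ x x' = c * K x x') →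
      ∀ A : Matrix X X ℂ, (ρ * ((P true)ᴴ * A * P true)).trace.re = c *
        (∑ x, ∑ x', if good x ∧ good x' then K x x' * A x' x else 0).re := by
    intro ρ c hρ A
    rw [htr, ← Complex.re_ofReal_mul, Finset.mul_sum]
    congr 1
    refine Finset.sum_congr rfl fun x _ => ?_
    rw [Finset.mul_sum]
    refine Finset.sum_congr rfl fun x' _ => ?_
    by_cases h : good x ∧ good x'
    · simp [h, hρ x x' h.1 h.2, mul_assoc]
    · rw [if_neg h, if_neg (by simpa using h), mul_zero]
  -- On the good labels both states are multiples of the same `K`, so all four traces factor.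
  have hcross : a true ρ₀ * p true ρ₁ = a true ρ₁ * p true ρ₀ := by
    rw [hp, ha]
    dsimp only
    rw [hfac hK₀, hfac hK₀, hfac hK₁, hfac hK₁]
    ring
  have e₀ := congrArg Complex.re (hsplit hb₀ M)
  have e₁ := congrArg Complex.re (hsplit hb₁ M)
  rw [Complex.add_re] at e₀ e₁
  rw [e₀, e₁, ← hbad, ← hbad]
  exact abs_sub_le_of_cross_eq (hp0 _ h₀) (hpa _ h₀) (hp0 _ h₁) (hpa _ h₁) (hp0 _ h₀) (hpa _ h₀)
    (hp0 _ h₁) (hpa _ h₁) (hae hb₀ ht₀) (hae hb₁ ht₁) hcross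

end Distinguish

/-! ### Collisions of prefixes -/

section Collisions

variable {ι Q P : Type} [Fintype ι] [DecidableEq ι] [Fintype Q] [DecidableEq Q] [Fintype P]
  [DecidableEq P]

/-- The distribution of the image of a sample. -/
def imageWeight (pre : Q → P) (f : Q → ℝ) (p : P) : ℝ := ∑ x, if pre x = p then f x else 0

/-- For a fixed common image `p` the sum over tuples factorises, and the factors at all other
indices are 1. -/
theorem sum_collision (pre : Q → P) {f : ι → Q → ℝ} (h1 : ∀ i, ∑ x, f i x = 1) {i j : ι}
    (hij : i ≠ j) : ∑ w : ι → Q, (if pre (w i) = pre (w j) then ∏ l, f l (w l) else 0) =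
      ∑ p, imageWeight pre (f i) p * imageWeight pre (f j) p := by
  have h : ∀ w : ι → Q, (if pre (w i) = pre (w j) then ∏ l, f l (w l) else 0) =
      ∑ p, ∏ l, if (l = i ∨ l = j) → pre (w l) = p then f l (w l) else 0 := by
    intro w
    have hp : ∀ p, (∏ l, if (l = i ∨ l = j) → pre (w l) = p then f l (w l) else 0) =
        if pre (w i) = p then if pre (w j) = p then ∏ l, f l (w l) else 0 else 0 := by
      intro p
      split_ifs with hi hj
      · refine Finset.prod_congr rfl fun l _ => if_pos ?_
        rintro (rfl | rfl)
        · exact hi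
        · exact hj
      · exact Finset.prod_eq_zero (Finset.mem_univ j) (if_neg fun h => hj (h (Or.inr rfl)))
      · exact Finset.prod_eq_zero (Finset.mem_univ i) (if_neg fun h => hi (h (Or.inl rfl)))
    simp only [hp, Finset.sum_ite_eq, Finset.mem_univ, if_true]
    exact if_congr eq_comm rfl rfl
  simp only [h]
  rw [Finset.sum_comm]
  refine Finset.sum_congr rfl fun p _ => ?_
  rw [← Fintype.prod_sum fun l x => if (l = i ∨ l = j) → pre x = p then f l x else 0]
  rw [Finset.prod_eq_mul i j hij (fun l _ hl => ?_) (by simp) (by simp)]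
  · simp [imageWeight]
  · simp only [hl.1, hl.2, or_self, false_imp_iff, if_true, h1]

/-- Union bound over pairs of indices. The distributions differ from index to index, so each
collision probability is bounded by the mean of two sums of squares. -/
theorem sum_not_injective_le (pre : Q → P) {f : ι → Q → ℝ} (h0 : ∀ i x, 0 ≤ f i x)
    (h1 : ∀ i, ∑ x, f i x = 1) [DecidablePred fun w : ι → Q => Function.Injective (pre ∘ w)] :
    ∑ w : ι → Q, (if Function.Injective (pre ∘ w) then 0 else ∏ l, f l (w l)) ≤
      Fintype.card ι * ∑ i, ∑ p, imageWeight pre (f i) p ^ 2 := by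
  set G : ι → ι → (ι → Q) → ℝ := fun i j w =>
    if i ≠ j then if pre (w i) = pre (w j) then ∏ l, f l (w l) else 0 else 0 with hG
  have hprod : ∀ w : ι → Q, 0 ≤ ∏ l, f l (w l) := fun w => Finset.prod_nonneg fun l _ => h0 l _
  have hG0 : ∀ i j w, 0 ≤ G i j w := fun i j w => by
    simp only [hG]
    split_ifs
    · exact hprod w
    all_goals exact le_rfl
  have hW0 : ∀ i p, 0 ≤ imageWeight pre (f i) p := fun i p =>
    Finset.sum_nonneg fun x _ => by split_ifs; exacts [h0 i x, le_rfl]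
  have hterm : ∀ w : ι → Q, (if Function.Injective (pre ∘ w) then 0 else ∏ l, f l (w l)) ≤
      ∑ i, ∑ j, G i j w := by
    intro w
    split_ifs with hw
    · exact Finset.sum_nonneg fun i _ => Finset.sum_nonneg fun j _ => hG0 i j w
    · simp only [Function.Injective, not_forall] at hw
      obtain ⟨i, j, hp, hij⟩ := hw
      have : G i j w = ∏ l, f l (w l) := by
        simp only [hG]
        rw [if_pos hij]
        exact if_pos hp
      rw [← this]
      exact (Finset.single_le_sum (f := fun j => G i j w) (fun j _ => hG0 i j w)
        (Finset.mem_univ j)).trans (Finset.single_le_sum (f := fun i => ∑ j, G i j w)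
        (fun i _ => Finset.sum_nonneg fun j _ => hG0 i j w) (Finset.mem_univ i))
  have hpair : ∀ i j, ∑ w, G i j w ≤
      (∑ p, imageWeight pre (f i) p ^ 2 + ∑ p, imageWeight pre (f j) p ^ 2) / 2 := by
    intro i j
    have hle : ∑ p, imageWeight pre (f i) p * imageWeight pre (f j) p ≤
        (∑ p, imageWeight pre (f i) p ^ 2 + ∑ p, imageWeight pre (f j) p ^ 2) / 2 := by
      rw [← Finset.sum_add_distrib, Finset.sum_div]
      refine Finset.sum_le_sum fun p _ => ?_
      nlinarith [sq_nonneg (imageWeight pre (f i) p - imageWeight pre (f j) p)]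
    refine le_trans ?_ hle
    by_cases hij : i = j
    · simp only [hG, hij, ne_eq, not_true, if_false, Finset.sum_const_zero]
      exact Finset.sum_nonneg fun p _ => mul_nonneg (hW0 j p) (hW0 j p)
    · simp only [hG, ne_eq, hij, not_false_iff, if_true]
      exact (sum_collision pre h1 hij).le
  calc _ ≤ ∑ w : ι → Q, ∑ i, ∑ j, G i j w := Finset.sum_le_sum fun w _ => hterm w
    _ = ∑ i, ∑ j, ∑ w, G i j w := by
        rw [Finset.sum_comm]
        exact Finset.sum_congr rfl fun i _ => Finset.sum_comm
    _ ≤ ∑ i, ∑ j, (∑ p, imageWeight pre (f i) p ^ 2 + ∑ p, imageWeight pre (f j) p ^ 2) / 2 :=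
        Finset.sum_le_sum fun i _ => Finset.sum_le_sum fun j _ => hpair i j
    _ = _ := by
        simp only [← Finset.sum_div, Finset.sum_add_distrib, Finset.sum_const, Finset.card_univ,
          nsmul_eq_mul, ← Finset.mul_sum]
        ring

end Collisions

/-! ### The states of the malicious receiver -/

theorem sum_mul_star_single {S R : Type} [Fintype S] [DecidableEq S] [Fintype R] [DecidableEq R]
    {e : S → R} (he : Function.Injective e) (A B : S → ℂ) :
    ∑ r, (∑ s, A s * (Pi.single (e s) 1 : R → ℂ) r) *
      star (∑ s, B s * (Pi.single (e s) 1 : R → ℂ) r) = ∑ s, A s * star (B s) := by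
  simp only [star_sum, Finset.sum_mul]
  rw [Finset.sum_comm]
  refine Finset.sum_congr rfl fun s _ => ?_
  rw [Finset.sum_eq_single (e s) (fun r _ hr => by rw [Pi.single_eq_of_ne hr, mul_zero, zero_mul])
    (by simp), Pi.single_eq_same, mul_one, Finset.sum_eq_single s (fun s' _ hs => by
      rw [Pi.single_eq_of_ne (fun h => hs (he h.symm)), mul_zero, star_zero]) (by simp),
    Pi.single_eq_same, mul_one]

/-- The reduced state on `C_i`. -/
theorem sum_psiZero {k m : ℕ} (hkm : k ≤ m) (θ : Ket m) (u u' : Qubits m) :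
    ∑ r, psiZero k θ (u, r) * star (psiZero k θ (u', r)) =
      (if window u 0 k = window u' 0 k then 1 else 0) * (θ u * star (θ u')) := by
  have hinj : Function.Injective fun s : Qubits k => window s 0 m := by
    refine fun s s' h => funext fun j => ?_
    have := congrFun h ⟨j, by omega⟩
    simpa [window] using this
  -- A character sum: the signs of two prefixes, multiplied and summed over all s, detect whether
  -- the prefixes agree. This dephases `θ` with respect to its prefix.
  have hsum : ∑ s : Qubits k, ∏ j : Fin k, (Op.sgn (s j && window u 0 k j) *
      Op.sgn (s j && window u' 0 k j)) = if window u 0 k = window u' 0 k then 2 ^ k else 0 := by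
    rw [← Fintype.prod_sum fun (j : Fin k) b =>
      Op.sgn (b && window u 0 k j) * Op.sgn (b && window u' 0 k j)]
    have : ∀ j : Fin k, (∑ b : Bool, Op.sgn (b && window u 0 k j) *
        Op.sgn (b && window u' 0 k j)) =
        2 * if window u 0 k j = window u' 0 k j then 1 else 0 := by
      intro j
      rw [Fintype.sum_bool]
      cases window u 0 k j <;> cases window u' 0 k j <;> norm_num [Op.sgn]
    rw [Finset.prod_congr rfl fun j _ => this j, Finset.prod_mul_distrib, Finset.prod_const,
      prod_ite_one_zero, Finset.card_univ, Fintype.card_fin]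
    simp only [Finset.mem_univ, forall_const, ← funext_iff]
    split_ifs <;> simp
  have hpauli : ∀ (s : Qubits k) (u : Qubits m), (pauliZ s m *ᵥ θ.ofLp) u =
      (∏ j : Fin k, Op.sgn (s j && window u 0 k j)) * θ u := fun s u => by
    rw [pauliZ, Matrix.mulVec_diagonal]
    rfl
  have hstar : ∀ b : Bool, star (Op.sgn b) = Op.sgn b := fun b => by
    cases b <;> simp [Op.sgn]
  have hterm : ∀ s : Qubits k, (∏ j : Fin k, Op.sgn (s j && window u 0 k j)) * θ u *
      star ((∏ j : Fin k, Op.sgn (s j && window u' 0 k j)) * θ u') = (∏ j : Fin k,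
        (Op.sgn (s j && window u 0 k j) * Op.sgn (s j && window u' 0 k j))) *
        (θ u * star (θ u')) := fun s => by
    rw [star_mul', star_prod, Finset.prod_mul_distrib]
    simp only [hstar]
    ring
  have hsplit : ∀ r, psiZero k θ (u, r) * star (psiZero k θ (u', r)) = (2 ^ k)⁻¹ *
      ((∑ s : Qubits k, (pauliZ s m *ᵥ θ.ofLp) u *
        (Pi.single (window s 0 m) 1 : Qubits m → ℂ) r) *
      star (∑ s : Qubits k, (pauliZ s m *ᵥ θ.ofLp) u' *
        (Pi.single (window s 0 m) 1 : Qubits m → ℂ) r)) := fun r => by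
    rw [psiZero, psiZero, star_mul', ← inv_sqrt_mul_star k]
    ring
  simp only [hsplit, ← Finset.mul_sum]
  rw [sum_mul_star_single hinj]
  simp only [hpauli, hterm, ← Finset.sum_mul]
  rw [hsum]
  split_ifs
  · field_simp
  · simp

theorem sum_psiOne {m : ℕ} (u u' : Qubits m) :
    ∑ r, psiOne m (u, r) * star (psiOne m (u', r)) = (2 ^ m)⁻¹ * if u = u' then 1 else 0 := by
  simp only [psiOne_apply, star_mul', apply_ite star, star_one, star_zero, mul_ite, mul_one,
    mul_zero, ite_mul, zero_mul, Finset.sum_ite_eq, Finset.sum_ite_eq', Finset.mem_univ, if_true,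
    ← inv_sqrt_mul_star m, eq_comm (a := u)]

theorem traceRight_bigPsi {k m : ℕ} (θ : Ket m) (b : Bool) (y y' : Qubits (k * m)) :
    traceRight (ketBra (bigPsi k k θ b)) y y' =
      ∏ j, ∑ r, psi k θ b (blockEquiv k m y j, r) * star (psi k θ b (blockEquiv k m y' j, r)) := by
  rw [← sum_prod_equiv (blockEquiv k m) fun j r =>
    psi k θ b (blockEquiv k m y j, r) * star (psi k θ b (blockEquiv k m y' j, r))]
  refine Finset.sum_congr rfl fun r _ => ?_
  rw [Finset.prod_mul_distrib, ketBra, Matrix.vecMulVec_apply, Pi.star_apply, bigPsi, bigPsi,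
    star_prod]
  rfl

/-! ### Averages over the Haar measure -/

section Average

variable {m : ℕ} {X : Type} [Fintype X] [DecidableEq X]

/-- The expectation of a random matrix. -/
def average (R : Metric.sphere (0 : Ket m) 1 → Matrix X X ℂ) : Matrix X X ℂ := fun x x' =>
  ∫ θ, R θ x x' ∂(haarState m)

variable {R : Metric.sphere (0 : Ket m) 1 → Matrix X X ℂ}

theorem trace_mul_average (hR : Continuous R) (M : Matrix X X ℂ) :
    (M * average R).trace = ∫ θ, (M * R θ).trace ∂(haarState m) := by
  have hint : ∀ x x', Integrable (fun θ => M x x' * R θ x' x) (haarState m) := fun x x' =>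
    integrable_haarState (continuous_const.mul (hR.matrix_elem x' x))
  simp only [Matrix.trace, Matrix.diag_apply, Matrix.mul_apply]
  rw [integral_finsetSum _ fun x _ => integrable_finsetSum _ fun x' _ => hint x x']
  refine Finset.sum_congr rfl fun x _ => ?_
  rw [integral_finsetSum _ fun x' _ => hint x x']
  exact Finset.sum_congr rfl fun x' _ => (integral_const_mul _ _).symm

theorem re_trace_mul_average (hR : Continuous R) (M : Matrix X X ℂ) :
    (M * average R).trace.re = ∫ θ, (M * R θ).trace.re ∂(haarState m) := by
  rw [trace_mul_average hR]
  exact (integral_re (integrable_haarState (continuous_const.matrix_mul hR).matrix_trace)).symm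

theorem average_posSemidef (hR : Continuous R) (h : ∀ θ, (R θ).PosSemidef) :
    (average R).PosSemidef := by
  refine Matrix.PosSemidef.of_dotProduct_mulVec_nonneg ?_ fun v => ?_
  · ext x x'
    rw [Matrix.conjTranspose_apply, average, average, Complex.star_def, ← integral_conj]
    exact integral_congr_ae (Filter.Eventually.of_forall fun θ => (h θ).isHermitian.apply x x')
  · have e : ∀ A : Matrix X X ℂ, star v ⬝ᵥ (A *ᵥ v) = (Matrix.vecMulVec v (star v) * A).trace :=
      fun A => by
        rw [Matrix.vecMulVec_mul, Matrix.trace_vecMulVec, Matrix.dotProduct_mulVec, dotProduct_comm]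
    rw [e, trace_mul_average hR]
    refine integral_nonneg fun θ => ?_
    rw [← e]
    exact (h θ).dotProduct_mulVec_nonneg v

theorem trace_average (hR : Continuous R) (h : ∀ θ, (R θ).trace = 1) :
    (average R).trace = 1 := by
  have := trace_mul_average hR 1
  simpa [h] using this

theorem badWeight_eq_trace (good : X → Prop) [DecidablePred good] (ρ : Matrix X X ℂ) :
    badWeight good ρ = (Matrix.diagonal (fun x => if good x then (0 : ℂ) else 1) * ρ).trace.re := by
  simp [badWeight, Matrix.trace, Matrix.diagonal_mul]

theorem badWeight_average (hR : Continuous R) (good : X → Prop) [DecidablePred good] :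
    badWeight good (average R) = ∫ θ, badWeight good (R θ) ∂(haarState m) := by
  simp only [badWeight_eq_trace]
  exact re_trace_mul_average hR _

theorem continuous_badWeight (hR : Continuous R) (good : X → Prop) [DecidablePred good] :
    Continuous fun θ => badWeight good (R θ) := by
  simp only [badWeight_eq_trace]
  exact Complex.continuous_re.comp (continuous_const.matrix_mul hR).matrix_trace

theorem exists_moment_eq_of_injective (m : ℕ) (ι : Type) [Fintype ι] :
    ∃ c : ℝ, ∀ w : ι → Qubits m, Function.Injective w → moment w w = c := by
  by_cases h : ∃ u : ι → Qubits m, Function.Injective u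
  · obtain ⟨u, hu⟩ := h
    refine ⟨∫ θ : Metric.sphere (0 : Ket m) 1, ‖monomial u (θ : Ket m)‖ ^ 2 ∂(haarState m),
      fun w hw => ?_⟩
    rw [moment_eq_of_injective hw hu, moment]
    refine Eq.trans ?_ integral_ofReal
    refine integral_congr_ae (Filter.Eventually.of_forall fun θ => ?_)
    exact (Complex.mul_conj _).trans (by rw [Complex.normSq_eq_norm_sq]; rfl)
  -- With more indices than labels there is nothing to show, and any constant does.
  · exact ⟨0, fun w hw => (h ⟨w, hw⟩).elim⟩

end Average

/-! ### The states of the malicious receiver -/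

/-- The state that a malicious receiver with `t` copies of `θ` holds after the commit phase. -/
def adversaryState (k t : ℕ) {m : ℕ} (θ : Ket m) (b : Bool) :
    Matrix ((Fin t → Qubits m) × Qubits (k * m)) ((Fin t → Qubits m) × Qubits (k * m)) ℂ :=
  ketBra (copiesOf t θ) ⊗ₖ traceRight (ketBra (bigPsi k k θ b))

/-- The labels of all the `m`-qubit registers that the malicious receiver holds. -/
def labels {k m t : ℕ} : (Fin t → Qubits m) × Qubits (k * m) ≃ (Fin t ⊕ Fin k → Qubits m) :=
  ((Equiv.refl _).prodCongr (blockEquiv k m)).trans (Equiv.sumArrowEquivProdArrow _ _ _).symm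

section Receiver

variable {k m t : ℕ}

theorem labels_inl (x : (Fin t → Qubits m) × Qubits (k * m)) (i : Fin t) :
    labels x (Sum.inl i) = x.1 i := rfl

theorem labels_inr (x : (Fin t → Qubits m) × Qubits (k * m)) (j : Fin k) :
    labels x (Sum.inr j) = blockEquiv k m x.2 j := rfl

theorem continuous_adversaryState (k m t : ℕ) (b : Bool) :
    Continuous fun θ : Metric.sphere (0 : Ket m) 1 => adversaryState k t (θ : Ket m) b := by
  have h : Continuous fun θ : Metric.sphere (0 : Ket m) 1 => bigPsi k k (θ : Ket m) b :=
    continuous_pi fun a => continuous_finsetProd _ fun i _ =>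
      (continuous_apply _).comp (continuous_psi k m b)
  refine continuous_matrix fun x x' => ?_
  exact ((continuous_ketBra (continuous_copiesOf m t)).matrix_elem _ _).mul
    (continuous_finsetSum _ fun r _ => (continuous_ketBra h).matrix_elem _ _)

theorem adversaryState_posSemidef (θ : Ket m) (b : Bool) : (adversaryState k t θ b).PosSemidef := by
  refine Matrix.PosSemidef.kronecker (Matrix.posSemidef_vecMulVec_self_star _) ?_
  have : traceRight (ketBra (bigPsi k k θ b)) =
      ∑ r, ketBra fun y => bigPsi k k θ b (y, r) := by
    ext y y'
    rw [Matrix.sum_apply]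
    rfl
  rw [this]
  exact Matrix.posSemidef_sum _ fun r _ => Matrix.posSemidef_vecMulVec_self_star _

theorem trace_adversaryState (hkm : k ≤ m) {θ : Ket m} (hθ : ‖θ‖ = 1) (b : Bool) :
    (adversaryState k t θ b).trace = 1 := by
  rw [adversaryState, Matrix.trace_kronecker, trace_ketBra_copiesOf t hθ, one_mul]
  exact (Fintype.sum_prod_type _).symm.trans (sum_bigPsi hkm hθ b)

theorem adversaryState_false (hkm : k ≤ m) (θ : Ket m)
    (x x' : (Fin t → Qubits m) × Qubits (k * m)) :
    adversaryState k t θ false x x' = (if ∀ j : Fin k, window (labels x (Sum.inr j)) 0 k =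
      window (labels x' (Sum.inr j)) 0 k then 1 else 0) *
        (monomial (labels x) θ * star (monomial (labels x') θ)) := by
  rw [adversaryState, Matrix.kronecker_apply, traceRight_bigPsi]
  change _ * (∏ j, ∑ r, psiZero k θ (_, r) * star (psiZero k θ (_, r))) = _
  have h : (if ∀ j : Fin k, window (labels x (Sum.inr j)) 0 k =
      window (labels x' (Sum.inr j)) 0 k then (1 : ℂ) else 0) = ∏ j : Fin k,
        if window (blockEquiv k m x.2 j) 0 k = window (blockEquiv k m x'.2 j) 0 k then 1 else 0 := by
    simp only [prod_ite_one_zero, Finset.mem_univ, true_imp_iff]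
    rfl
  rw [h]
  simp only [sum_psiZero hkm, Finset.prod_mul_distrib, monomial, Fintype.prod_sum_type,
    labels_inl, labels_inr, star_mul', star_prod, ketBra, Matrix.vecMulVec_apply, Pi.star_apply,
    copiesOf]
  ring

theorem adversaryState_true (θ : Ket m) (x x' : (Fin t → Qubits m) × Qubits (k * m)) :
    adversaryState k t θ true x x' = ((2 ^ m)⁻¹ ^ k * if x.2 = x'.2 then 1 else 0) *
      (monomial x.1 θ * star (monomial x'.1 θ)) := by
  rw [adversaryState, Matrix.kronecker_apply, traceRight_bigPsi]
  change _ * (∏ j, ∑ r, psiOne m (_, r) * star (psiOne m (_, r))) = _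
  have h : (∀ j, blockEquiv k m x.2 j = blockEquiv k m x'.2 j) ↔ x.2 = x'.2 := by
    rw [← funext_iff, (blockEquiv k m).apply_eq_iff_eq]
  simp only [sum_psiOne, Finset.prod_mul_distrib, prod_ite_one_zero, Finset.mem_univ,
    true_imp_iff, h, Finset.prod_const, Finset.card_univ, Fintype.card_fin]
  exact mul_comm _ _

/-- The expected state of the malicious receiver. -/
def averageState (k m t : ℕ) (b : Bool) :
    Matrix ((Fin t → Qubits m) × Qubits (k * m)) ((Fin t → Qubits m) × Qubits (k * m)) ℂ :=
  average fun θ : Metric.sphere (0 : Ket m) 1 => adversaryState k t (θ : Ket m) b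

theorem averageState_false (hkm : k ≤ m) (x x' : (Fin t → Qubits m) × Qubits (k * m)) :
    averageState k m t false x x' = (if ∀ j : Fin k, window (labels x (Sum.inr j)) 0 k =
      window (labels x' (Sum.inr j)) 0 k then 1 else 0) * moment (labels x) (labels x') := by
  simp only [averageState, average, adversaryState_false hkm]
  exact integral_const_mul _ _

theorem averageState_true (x x' : (Fin t → Qubits m) × Qubits (k * m)) :
    averageState k m t true x x' =
      ((2 ^ m)⁻¹ ^ k * if x.2 = x'.2 then 1 else 0) * moment x.1 x'.1 := by
  simp only [averageState, average, adversaryState_true]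
  exact integral_const_mul _ _

/-! ### Registers with distinct prefixes -/

/-- The prefixes of all the registers are different. -/
def PrefixesDistinct (x : (Fin t → Qubits m) × Qubits (k * m)) : Prop :=
  Function.Injective fun i => window (labels x i) 0 k

theorem PrefixesDistinct.labels_injective {x : (Fin t → Qubits m) × Qubits (k * m)}
    (hx : PrefixesDistinct x) : Function.Injective (labels x) :=
  Function.Injective.of_comp (f := fun q : Qubits m => window q 0 k) hx

theorem prefixesDistinct_iff {x x' : (Fin t → Qubits m) × Qubits (k * m)}
    {τ : Equiv.Perm (Fin t ⊕ Fin k)} (h : labels x' = labels x ∘ τ) :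
    PrefixesDistinct x ↔ PrefixesDistinct x' := by
  rw [PrefixesDistinct, PrefixesDistinct, h]
  exact (τ.injective_comp fun i => window (labels x i) 0 k).symm

theorem labels_eq_comp {x x' : (Fin t → Qubits m) × Qubits (k * m)} {τ : Equiv.Perm (Fin t)}
    (h : x'.1 = x.1 ∘ τ) (h2 : x.2 = x'.2) :
    labels x' = labels x ∘ (Equiv.sumCongr τ (Equiv.refl (Fin k))) := by
  funext i
  cases i with
  | inl i => exact congrFun h i
  | inr j => rw [labels_inr, ← h2]; rfl

/-- No two registers of `x` share a prefix, so agreement of prefixes on the committed registers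
forces `σ` to fix each of them; what is left is a permutation of the `t` copies. -/
theorem PrefixesDistinct.exists_perm {x x' : (Fin t → Qubits m) × Qubits (k * m)}
    (hx : PrefixesDistinct x) {σ : Equiv.Perm (Fin t ⊕ Fin k)} (h : labels x' = labels x ∘ σ)
    (hp : ∀ j : Fin k, window (labels x (Sum.inr j)) 0 k = window (labels x' (Sum.inr j)) 0 k) :
    x.2 = x'.2 ∧ ∃ τ : Equiv.Perm (Fin t), x'.1 = x.1 ∘ τ := by
  have hr : ∀ j : Fin k, σ (Sum.inr j) = Sum.inr j := fun j => by
    have := hp j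
    rw [h] at this
    exact (hx this).symm
  have hl : ∀ i : Fin t, ∃ i', σ (Sum.inl i) = Sum.inl i' := fun i => by
    cases hi : σ (Sum.inl i) with
    | inl i' => exact ⟨i', rfl⟩
    | inr j =>
      rw [← hr j] at hi
      exact absurd (σ.injective hi) Sum.inl_ne_inr
  choose f hf using hl
  have hinj : Function.Injective f := fun i i' hi => by
    have : σ (Sum.inl i) = σ (Sum.inl i') := by rw [hf, hf, hi]
    exact Sum.inl_injective (σ.injective this)
  refine ⟨(blockEquiv k m).injective (funext fun j => ?_),
    Equiv.ofBijective f (Finite.injective_iff_bijective.1 hinj), funext fun i => ?_⟩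
  · have := congrFun h (Sum.inr j)
    rw [Function.comp_apply, hr] at this
    exact this.symm
  · have := congrFun h (Sum.inl i)
    rw [Function.comp_apply, hf] at this
    exact this

open Classical in
/-- The pattern of the states of the malicious receiver on distinct prefixes. -/
def pattern (x x' : (Fin t → Qubits m) × Qubits (k * m)) : ℂ :=
  if x.2 = x'.2 ∧ ∃ τ : Equiv.Perm (Fin t), x'.1 = x.1 ∘ τ then 1 else 0

/-- Nonzero entries only join label tuples that are permutations of each other, and such tuples have
the same multiset of prefixes. -/
theorem averageState_eq_zero (hkm : k ≤ m) (b : Bool)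
    {x x' : (Fin t → Qubits m) × Qubits (k * m)}
    (h : ¬ (PrefixesDistinct x ↔ PrefixesDistinct x')) : averageState k m t b x x' = 0 := by
  cases b
  · rw [averageState_false hkm, moment_eq_zero, mul_zero]
    rintro ⟨τ, hτ⟩
    exact h (prefixesDistinct_iff hτ)
  · rw [averageState_true]
    by_cases h2 : x.2 = x'.2
    · rw [moment_eq_zero, mul_zero]
      rintro ⟨τ, hτ⟩
      exact h (prefixesDistinct_iff (labels_eq_comp hτ h2))
    · rw [if_neg h2, mul_zero, zero_mul]

/-- For the bit 0 dephasing forces the committed labels to agree, through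
`PrefixesDistinct.exists_perm`; for the bit 1 they agree because these registers are maximally
mixed. Distinct prefixes make the labels distinct, so the surviving moments are all equal. -/
theorem exists_averageState_eq (hkm : k ≤ m) (t : ℕ) (b : Bool) :
    ∃ c : ℝ, ∀ x x' : (Fin t → Qubits m) × Qubits (k * m), PrefixesDistinct x →
      averageState k m t b x x' = c * pattern x x' := by
  cases b
  · obtain ⟨c, hc⟩ := exists_moment_eq_of_injective m (Fin t ⊕ Fin k)
    refine ⟨c, fun x x' hx => ?_⟩
    rw [averageState_false hkm, pattern]
    split_ifs with hp hq hq
    · obtain ⟨h2, τ, hτ⟩ := hq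
      rw [labels_eq_comp hτ h2, moment_perm, hc _ hx.labels_injective]
      ring
    · rw [moment_eq_zero, mul_zero, mul_zero]
      rintro ⟨σ, hσ⟩
      exact hq (hx.exists_perm hσ hp)
    · obtain ⟨h2, τ, hτ⟩ := hq
      exact absurd (fun j => by rw [labels_inr, labels_inr, h2]) hp
    · rw [zero_mul, mul_zero]
  · obtain ⟨c, hc⟩ := exists_moment_eq_of_injective m (Fin t)
    refine ⟨(2 ^ m)⁻¹ ^ k * c, fun x x' hx => ?_⟩
    have hinj : Function.Injective x.1 := hx.labels_injective.comp Sum.inl_injective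
    rw [averageState_true, pattern]
    push_cast
    by_cases h2 : x.2 = x'.2
    · by_cases hτ : ∃ τ : Equiv.Perm (Fin t), x'.1 = x.1 ∘ τ
      · rw [if_pos h2, if_pos ⟨h2, hτ⟩]
        obtain ⟨τ, hτ⟩ := hτ
        rw [hτ, moment_perm, hc _ hinj]
        ring
      · rw [moment_eq_zero hτ, if_neg (not_and_of_not_right _ hτ), mul_zero, mul_zero]
    · rw [if_neg h2, if_neg (not_and_of_not_left _ h2), mul_zero, zero_mul, mul_zero]

/-! ### Collision probabilities of prefixes -/

/-- The distribution of the label of a register that the malicious receiver holds. -/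
def sampleProb (k t : ℕ) (θ : Ket m) (b : Bool) (i : Fin t ⊕ Fin k) (q : Qubits m) : ℝ :=
  if b ∧ i.isRight then (2 ^ m)⁻¹ else ‖θ q‖ ^ 2

theorem sampleProb_nonneg (θ : Ket m) (b : Bool) (i : Fin t ⊕ Fin k) (q : Qubits m) :
    0 ≤ sampleProb k t θ b i q := by
  rw [sampleProb]
  split_ifs <;> positivity

theorem sum_sampleProb {θ : Ket m} (hθ : ‖θ‖ = 1) (b : Bool) (i : Fin t ⊕ Fin k) :
    ∑ q, sampleProb k t θ b i q = 1 := by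
  simp only [sampleProb]
  split_ifs
  · simp
  · exact sum_norm_sq_eq_one hθ

/-- Given `θ`, measuring all registers in the computational basis yields independent samples, to
which `sum_not_injective_le` applies. -/
theorem adversaryState_self (hkm : k ≤ m) (θ : Ket m) (b : Bool)
    (x : (Fin t → Qubits m) × Qubits (k * m)) :
    adversaryState k t θ b x x = ((∏ i, sampleProb k t θ b i (labels x i) : ℝ) : ℂ) := by
  have h : ∀ {ι : Type} [Fintype ι] (w : ι → Qubits m), monomial w θ * star (monomial w θ) =
      ((∏ i, ‖θ (w i)‖ ^ 2 : ℝ) : ℂ) := fun w => by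
    rw [Complex.star_def, Complex.mul_conj, Complex.normSq_eq_norm_sq, monomial, norm_prod,
      Finset.prod_pow]
  cases b
  · rw [adversaryState_false hkm, if_pos fun _ => rfl, one_mul, h]
    simp [sampleProb]
  · rw [adversaryState_true, if_pos rfl, h, Fintype.prod_sum_type]
    simp [sampleProb, labels_inl, mul_comm]

/-- A uniform label has collision probability exactly 2^{-k}; a label sampled from `θ` is covered by
`integral_sum_prefixWeight_sq_le`. -/
theorem integral_sum_imageWeight_sq_le (hkm : k ≤ m) (b : Bool) (i : Fin t ⊕ Fin k) :
    ∫ θ : Metric.sphere (0 : Ket m) 1, ∑ p : Qubits k,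
      imageWeight (fun q : Qubits m => window q 0 k) (sampleProb k t (θ : Ket m) b i) p ^ 2
        ∂(haarState m) ≤ 2 / 2 ^ k := by
  by_cases hb : b ∧ i.isRight
  · have h : ∀ (θ : Ket m) (p : Qubits k), imageWeight (fun q : Qubits m => window q 0 k)
        (sampleProb k t θ b i) p = (2 ^ k)⁻¹ := fun θ p => by
      have : ∀ q : Qubits m, (if window q 0 k = p then (2 ^ m : ℝ)⁻¹ else 0) =
          (2 ^ m)⁻¹ * if window q 0 k = p then 1 else 0 := fun q => by split_ifs <;> simp
      simp only [imageWeight, sampleProb, if_pos hb, this, ← Finset.mul_sum, card_prefix hkm]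
      field_simp
    simp only [h, integral_const, probReal_univ, one_smul, Finset.sum_const, Finset.card_univ,
      Fintype.card_pi, Fintype.card_bool, Finset.prod_const, Fintype.card_fin, nsmul_eq_mul]
    push_cast
    rw [sq, mul_inv_cancel_left₀ (by positivity), div_eq_mul_inv]
    exact le_mul_of_one_le_left (by positivity) one_le_two
  · have h : ∀ (θ : Ket m) (p : Qubits k), imageWeight (fun q : Qubits m => window q 0 k)
        (sampleProb k t θ b i) p = prefixWeight k θ p := fun θ p => by
      simp only [imageWeight, sampleProb, if_neg hb, prefixWeight]
    simp only [h]
    exact integral_sum_prefixWeight_sq_le hkm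

theorem continuous_sum_imageWeight_sq (b : Bool) (i : Fin t ⊕ Fin k) :
    Continuous fun θ : Metric.sphere (0 : Ket m) 1 => ∑ p : Qubits k,
      imageWeight (fun q : Qubits m => window q 0 k) (sampleProb k t (θ : Ket m) b i) p ^ 2 := by
  have h : ∀ q, Continuous fun θ : Metric.sphere (0 : Ket m) 1 =>
      sampleProb k t (θ : Ket m) b i q := fun q => by
    simp only [sampleProb]
    split_ifs
    · exact continuous_const
    · fun_prop
  refine continuous_finsetSum _ fun p _ => Continuous.pow (continuous_finsetSum _ fun q _ => ?_) 2
  split_ifs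
  · exact h q
  · exact continuous_const

open Classical in
theorem badWeight_adversaryState_le (hkm : k ≤ m) {θ : Ket m} (hθ : ‖θ‖ = 1) (b : Bool) :
    badWeight PrefixesDistinct (adversaryState k t θ b) ≤ (t + k : ℕ) * ∑ i, ∑ p : Qubits k,
      imageWeight (fun q : Qubits m => window q 0 k) (sampleProb k t θ b i) p ^ 2 := by
  have h := sum_not_injective_le (fun q : Qubits m => window q 0 k)
    (sampleProb_nonneg (k := k) (t := t) θ b) (sum_sampleProb hθ b)
  rw [Fintype.card_sum, Fintype.card_fin, Fintype.card_fin] at h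
  refine le_of_eq_of_le ?_ h
  rw [badWeight, Complex.re_sum]
  refine Fintype.sum_equiv labels _ _ fun x => ?_
  rw [adversaryState_self hkm]
  by_cases hx : PrefixesDistinct x
  · rw [if_pos hx]
    exact (if_pos hx).symm
  · rw [if_neg hx, Complex.ofReal_re]
    exact (if_neg hx).symm

-- One factor t + k is the prefactor of the union bound; the other counts the registers, each of
-- which contributes at most 2·2^{-k}.
open Classical in
theorem badWeight_averageState_le (hkm : k ≤ m) (t : ℕ) (b : Bool) :
    badWeight PrefixesDistinct (averageState k m t b) ≤ 2 * (t + k : ℕ) ^ 2 * (1 / 2) ^ k := by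
  rw [averageState, badWeight_average (continuous_adversaryState k m t b)]
  have hint : ∀ i : Fin t ⊕ Fin k, Integrable (fun θ : Metric.sphere (0 : Ket m) 1 =>
      ∑ p : Qubits k, imageWeight (fun q : Qubits m => window q 0 k)
        (sampleProb k t (θ : Ket m) b i) p ^ 2) (haarState m) := fun i =>
    integrable_haarState (continuous_sum_imageWeight_sq b i)
  refine (integral_mono (integrable_haarState
    (continuous_badWeight (continuous_adversaryState k m t b) _))
    ((integrable_finsetSum Finset.univ fun i _ => hint i).const_mul ((t + k : ℕ) : ℝ))
    fun θ => badWeight_adversaryState_le hkm (by simp) b).trans ?_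
  rw [integral_const_mul, integral_finsetSum _ fun i _ => hint i]
  calc _ ≤ ((t + k : ℕ) : ℝ) * ∑ _i : Fin t ⊕ Fin k, (2 : ℝ) / 2 ^ k :=
        mul_le_mul_of_nonneg_left (Finset.sum_le_sum fun i _ =>
          integral_sum_imageWeight_sq_le hkm b i) (by positivity)
    _ = _ := by
        rw [Finset.sum_const, Finset.card_univ, Fintype.card_sum, Fintype.card_fin,
          Fintype.card_fin, nsmul_eq_mul, one_div, inv_pow, div_eq_mul_inv]
        ring

/-- A malicious receiver cannot tell the commitments to `0` and `1` apart. -/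
theorem abs_integral_sub_le (hkm : k ≤ m)
    {M : Matrix ((Fin t → Qubits m) × Qubits (k * m)) ((Fin t → Qubits m) × Qubits (k * m)) ℂ}
    (hM : M.PosSemidef) (hM' : (1 - M).PosSemidef) :
    |(∫ θ : Metric.sphere (0 : Ket m) 1, (M * adversaryState k t (θ : Ket m) false).trace.re
        ∂(haarState m)) -
      ∫ θ : Metric.sphere (0 : Ket m) 1, (M * adversaryState k t (θ : Ket m) true).trace.re
        ∂(haarState m)| ≤ 4 * (t + k : ℕ) ^ 2 * (1 / 2) ^ k := by
  classical
  have hc := continuous_adversaryState k m t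
  rw [← re_trace_mul_average (hc false), ← re_trace_mul_average (hc true)]
  obtain ⟨c₀, h₀⟩ := exists_averageState_eq hkm t false
  obtain ⟨c₁, h₁⟩ := exists_averageState_eq hkm t true
  have hpsd : ∀ b, (averageState k m t b).PosSemidef := fun b =>
    average_posSemidef (hc b) fun θ => adversaryState_posSemidef _ b
  have htr : ∀ b, (averageState k m t b).trace = 1 := fun b =>
    trace_average (hc b) fun θ => trace_adversaryState hkm (by simp) b
  refine (abs_trace_sub_le (hpsd false) (hpsd true) (htr false) (htr true) hM hM'
    (fun _ _ => averageState_eq_zero hkm false) (fun _ _ => averageState_eq_zero hkm true)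
    (fun x x' hx _ => h₀ x x' hx) fun x x' hx _ => h₁ x x' hx).trans ?_
  have e₀ := badWeight_averageState_le hkm t false
  have e₁ := badWeight_averageState_le hkm t true
  linarith

end Receiver

theorem negligible_hiding (P : Polynomial ℕ) : CommitmentScheme.Negligible fun k : ℕ =>
    4 * ((P.eval k + k : ℕ) : ℝ) ^ 2 * (1 / 2) ^ k := by
  have h := (negligible_pow (r := 1 / 2) (by norm_num) (by norm_num)).polynomial_mul
    (4 * (P.map (Nat.castRingHom ℝ) + Polynomial.X) ^ 2)
  refine h.congr fun k => ?_
  simp [Polynomial.eval_natCast_map]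

theorem isPolyCopyStatisticallyHiding {n : ℕ → ℕ} (hkn : ∀ k, k ≤ n k) :
    (swapTestScheme n).IsPolyCopyStatisticallyHiding := by
  rintro t ⟨P, hP⟩ M hM
  refine ⟨_, negligible_hiding P, fun k => ?_⟩
  refine (abs_integral_sub_le (hkn k) (hM k).1 (hM k).2).trans ?_
  have := hP k
  gcongr

end CHS

end

theorem mainTheorem8 (n : ℕ → ℕ) (hn : ∀ k, k + 1 ≤ n k) (hpoly : CHS.PolyBounded n) :
    (CHS.swapTestScheme n).IsQuantumCommitment ∧
      (CHS.swapTestScheme n).IsPerfectlyCorrect ∧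
      (CHS.swapTestScheme n).IsPolyCopyStatisticallyHiding ∧
      (CHS.swapTestScheme n).IsStatisticallySumBinding :=
  have hle : ∀ k, k ≤ n k := fun k => Nat.le_of_succ_le (hn k)
  ⟨⟨⟨Polynomial.X, fun k => by simp [CHS.swapTestScheme]⟩, CHS.isQPTCommitter hpoly hle,
      CHS.isQPTReceiver hpoly hn⟩,
    CHS.isPerfectlyCorrect hle, CHS.isPolyCopyStatisticallyHiding hle,
    CHS.isStatisticallySumBinding hn⟩
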